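/- **Language and theory.** Let $L_{BA}$ be the first-order language with equality, the predicate $\le$ and the functions $0$, $1$, $x+y$, $\lfloor x/2\rfloor$, $|x|$ (binary length), $x\#y=2^{|x|\cdot|y|}$, $x\cdot 2^{|y|}$, $x\dot-y$ and $x[i,j)=\lfloor x/2^i\rfloor \bmod 2^{j\dot- i}$; put $\|x\|=||x||$, $\mathrm{Bit}(i,x)=x[i,i+1)$, $\mathrm{MSP}(x,i)=x[i,|x|)$ and $2x=x+x$. A $\Sigma_0^b$-formula is one all of whose quantifiers are sharply bounded ($Qz\le|t|$ with $z$ not in $t$). For every linear form $\ell\|\bar x\|=\sum_i c_i\|x_i\|+d$ with $c_i,d\in\mathbb N$, all $\Sigma_0^b$-formulae $B(\bar x,p),D_1(\bar x,p),\dots,D_m(\bar x,p)$ of $L_{BA}$ and every boolean formula $I(d_1,\dots,d_m,p_0,p_1)$, let $L_{AID}$ contain a new predicate constant $A=A^{\ell,B,\bar D,I}$. $AID$ is the theory in $L_{AID}$ with the axioms: * $BASIC$: Buss' basic axioms (of his theories $S_2^i$) that do not mention multiplication, with $x+1$ for the successor of $x$; the axioms $j\le i\to x[i,j)=0$; $i<j\to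 x[i+1,j+1)=\lfloor x/2\rfloor[i,j)$; $(2x)[0,j+1)=2\cdot x[0,j)$ and $(2x+1)[0,j+1)=2\cdot x[0,j)+1$; $x\cdot2^{|0|}=x$; $y\ne0\to x\cdot2^{|y|}=x\cdot2^{|\lfloor y/2\rfloor|}+x\cdot2^{|\lfloor y/2\rfloor|}$; $x\le y\to x\dot-y=0$; $x\ge y\to(x+1)\dot-y=(x\dot-y)+1$; and the basic facts $|x\#y|=(|x\#y|\dot-1)+1$; $|x|=|u|+|v|\to x\#y=(u\#y)\cdot2^{|v|\cdot|y|}$, where $2^{|v|\cdot|y|}$ is written $2^{|\lfloor (v\#y)/2\rfloor|}$; $1\#1=1+1$; $\mathrm{MSP}(x,0)=x$; $\mathrm{MSP}(x,i+1)=\lfloor\mathrm{MSP}(x,i)/2\rfloor$; $|x|\le i\to x[i,j)=0$; $y\le x\to(x\dot-y)+y=x$; * bit extensionality $|x|=|y|\wedge\forall i<|x|\,(\mathrm{Bit}(i,x)=\mathrm{Bit}(i,y))\to x=y$; * $\varphi(0)\wedge\forall y<|x|\,(\varphi(y)\to\varphi(y+1))\to\varphi(|x|)$ for each $\Sigma_0^b$-formula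 $\varphi$ of $L_{AID}$ (parameters allowed); * for each $A=A^{\ell,B,\bar D,I}$: $A(\bar x,p)\to0\ne|p|\le\ell\|\bar x\|$; $0\ne|p|=\ell\|\bar x\|\to[A(\bar x,p)\leftrightarrow B(\bar x,p)]$; $0\ne|p|<\ell\|\bar x\|\to[A(\bar x,p)\leftrightarrow I(\bar D(\bar x,p),A(\bar x,2p),A(\bar x,2p+1))]$. The standard model of $L_{AID}$ is $\mathbb N$ with the intended functions and with each $A$ interpreted as the predicate determined by its last three axioms. $AID$ *proves* a formula if the formula is valid in all models of $AID$. **Bitdefinability.** A function $F:\mathbb N^n\to\mathbb N$ is $\Sigma_0^b$-bitdefinable in $AID$, by a $\Sigma_0^b$-formula $A_F(i,\bar x)$ of $L_{AID}$ and a polynomial $p$ with coefficients in $\mathbb N$, if $|F(\bar x)|\le p(|\bar x|)$ for all $\bar x\in\mathbb N^n$ and, in the standard model, $A_F(i,\bar x)\leftrightarrow\mathrm{Bit}(i,F(\bar x))=1$ for all $i,\bar x$. Inside $AID$ the value $F(\bar x)$ is then represented by the set of digits $\{i<p(|\bar x|):A_F(i,\bar x)\}$. **Theorem 2.1 (Bounded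 vector summation).** Let $f(i,\bar y)$ be $\Sigma_0^b$-bitdefinable in $AID$ by $A_f$ and $p$. Then there are $A_g$ and $q$ by which the function $$g(x,\bar y)=\sum_{i<|x|}f(i,\bar y)$$ is $\Sigma_0^b$-bitdefinable in $AID$, such that $AID$ proves $$g(0,\bar y)=0\qquad\text{and}\qquad g(x,\bar y)=g(\lfloor x/2\rfloor,\bar y)+f(|x|-1,\bar y)\quad\text{for }x\neq0,$$ where $f$ and $g$ are represented by $(A_f,p)$ and $(A_g,q)$. The two equations are meant in both of the following senses: (a) as equalities of sets of digits, where the $i$-th digit of the sum of $U$ and $V$ is $U(i)\oplus V(i)\oplus\exists j<i\,[U(j)\wedge V(j)\wedge\forall k\,(j<k<i\to U(k)\oplus V(k))]$; (b) for numbers: if $w=g(0,\bar y)$ then $w=0$; if $x\ne0$, $w=g(x,\bar y)$, $u=g(\lfloor x/2\rfloor,\bar y)$ and $v=f(|x|-1,\bar y)$, then $w=u+v$; here $w=\{i<r:A(i)\}$ means $|w|\le r\wedge\forall i<r\,(\mathrm{Bit}(i,w)=1\leftrightarrow A(i))$. -/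

import Mathlib

open FirstOrder FirstOrder.Language

namespace BoundedArith

/-! ### The languages `L_BA(X)` -/

/-- The function symbols of `L_BA`, by arity. -/
inductive BAFunc : ℕ → Type
  | zero : BAFunc 0
  | one : BAFunc 0
  /-- `x + y` -/
  | add : BAFunc 2
  /-- `⌊x / 2⌋` -/
  | half : BAFunc 1
  /-- `|x|`, the length of the binary representation of `x` -/
  | len : BAFunc 1
  /-- `x # y = 2 ^ (|x| * |y|)` -/
  | smash : BAFunc 2
  /-- `x * 2 ^ |y|` -/
  | pad : BAFunc 2
  /-- modified subtraction -/
  | sub : BAFunc 2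
  /-- `x[i, j)`, the number with the binary digits `x_{j-1} ... x_i` -/
  | part : BAFunc 3

/-- The only predicate symbol of `L_BA` besides equality. -/
inductive BARel : ℕ → Type
  | le : BARel 2

/-- `L_BA(X)`: the language `L_BA` expanded by a set `X` of predicate constants. -/
abbrev LBA (X : ℕ → Type) : Language := ⟨BAFunc, fun n => BARel n ⊕ X n⟩

/-- `L_BA` itself. -/
abbrev LBase : Language := LBA fun _ => Empty

section TermsAndFormulas

variable {X : ℕ → Type} {α β : Type}

instance : Zero ((LBA X).Term α) := ⟨Term.func BAFunc.zero Fin.elim0⟩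
instance : One ((LBA X).Term α) := ⟨Term.func BAFunc.one Fin.elim0⟩
instance : Add ((LBA X).Term α) := ⟨fun s t => Term.func BAFunc.add ![s, t]⟩
/-- Subtraction of terms is the symbol for modified (truncated) subtraction. -/
instance : Sub ((LBA X).Term α) := ⟨fun s t => Term.func BAFunc.sub ![s, t]⟩

def half (t : (LBA X).Term α) : (LBA X).Term α := Term.func BAFunc.half ![t]
def len (t : (LBA X).Term α) : (LBA X).Term α := Term.func BAFunc.len ![t]
def smash (s t : (LBA X).Term α) : (LBA X).Term α := Term.func BAFunc.smash ![s, t]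
def pad (s t : (LBA X).Term α) : (LBA X).Term α := Term.func BAFunc.pad ![s, t]
def part (t i j : (LBA X).Term α) : (LBA X).Term α := Term.func BAFunc.part ![t, i, j]

/-- `Bit(i, t)`, the `i`-th binary digit of `t`. -/
def bit (i t : (LBA X).Term α) : (LBA X).Term α := part t i (i + 1)

/-- `MSP(t, i)`, the most significant part of `t`. -/
def msp (t i : (LBA X).Term α) : (LBA X).Term α := part t i (len t)

/-- The term `c · t = t + ... + t` with a constant `c`; `times c 1` is the numeral `c`. -/
def times : ℕ → (LBA X).Term α → (LBA X).Term α
  | 0, _ => 0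
  | c + 1, t => times c t + t

def le (s t : (LBA X).Term α) : (LBA X).Formula α :=
  Relations.formula (L := LBA X) (n := 2) (Sum.inl BARel.le) ![s, t]
def lt (s t : (LBA X).Term α) : (LBA X).Formula α := ∼(le t s)
def eqq (s t : (LBA X).Term α) : (LBA X).Formula α := Term.equal s t
def ne (s t : (LBA X).Term α) : (LBA X).Formula α := ∼(eqq s t)

def xor (φ ψ : (LBA X).Formula α) : (LBA X).Formula α := ∼(φ ⇔ ψ)

/-- Universal quantification of the variable `none`. -/
def allV (φ : (LBA X).Formula (Option α)) : (LBA X).Formula α :=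
  BoundedFormula.all (n := 0)
    (BoundedFormula.relabel (n := 1) (k := 0)
      (fun o : Option α => o.elim (Sum.inr 0) Sum.inl) φ)

/-- Existential quantification of the variable `none`. -/
def exV (φ : (LBA X).Formula (Option α)) : (LBA X).Formula α := ∼(allV ∼φ)

/-- A term, seen in a context with one more variable `none`. -/
def up (t : (LBA X).Term α) : (LBA X).Term (Option α) := t.relabel some

/-- The universal closure. -/
def closure {n : ℕ} (φ : (LBA X).Formula (Fin n)) : (LBA X).Sentence :=
  BoundedFormula.alls (BoundedFormula.relabel (n := n) (k := 0) (Sum.inr : Fin n → Empty ⊕ Fin n) φ)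

/-- The `Σ₀ᵇ`-formulae, i.e. the formulae all of whose quantifiers are sharply bounded:
`∀ x ≤ |t|` with a term `t` in which `x` does not occur. Negation, conjunction, disjunction and the
existential quantifiers `∃ x ≤ |t|` are expressed by `⊥`, `→` and `∀ x ≤ |t|` as usual. -/
inductive IsSigma0 : ∀ {n : ℕ}, (LBA X).BoundedFormula α n → Prop
  | falsum {n : ℕ} : IsSigma0 (BoundedFormula.falsum : (LBA X).BoundedFormula α n)
  | equal {n : ℕ} (s t : (LBA X).Term (α ⊕ Fin n)) : IsSigma0 (BoundedFormula.equal s t)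
  | rel {n l : ℕ} (R : (LBA X).Relations l) (ts : Fin l → (LBA X).Term (α ⊕ Fin n)) :
      IsSigma0 (BoundedFormula.rel R ts)
  | imp {n : ℕ} {φ ψ : (LBA X).BoundedFormula α n} :
      IsSigma0 φ → IsSigma0 ψ → IsSigma0 (φ.imp ψ)
  | ball {n : ℕ} (t : (LBA X).Term (α ⊕ Fin n)) {φ : (LBA X).BoundedFormula α (n + 1)} :
      IsSigma0 φ →
      IsSigma0 (BoundedFormula.all
        ((Relations.boundedFormula (L := LBA X) (n := 2) (Sum.inl BARel.le)
          ![Term.var (Sum.inr (Fin.last n)),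
            len (t.relabel (Sum.map id Fin.castSucc))]).imp φ))

end TermsAndFormulas

/-! ### The base theory -/

section Base

variable (X : ℕ → Type)

/-- The variables used in the basic axioms. -/
def vx : (LBA X).Term (Fin 4) := Term.var 0
def vy : (LBA X).Term (Fin 4) := Term.var 1
def vz : (LBA X).Term (Fin 4) := Term.var 2
def vw : (LBA X).Term (Fin 4) := Term.var 3

/-- Buss' basic axioms that do not mention multiplication; `2 x` stands for `x + x`. -/
def bussAxioms : List ((LBA X).Formula (Fin 4)) :=
  let x := vx X
  let y := vy X
  let z := vz X
  [ le y x ⟹ le y (x + 1),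
    ne x (x + 1),
    le 0 x,
    (le x y ⊓ ne x y) ⇔ le (x + 1) y,
    ne x 0 ⟹ ne (x + x) 0,
    le y x ⊔ le x y,
    (le x y ⊓ le y x) ⟹ eqq x y,
    (le x y ⊓ le y z) ⟹ le x z,
    eqq (len 0) 0,
    ne x 0 ⟹ (eqq (len (x + x)) (len x + 1) ⊓ eqq (len (x + x + 1)) (len x + 1)),
    eqq (len 1) 1,
    le x y ⟹ le (len x) (len y),
    eqq (smash 0 y) 1,
    ne x 0 ⟹ (eqq (smash 1 (x + x)) (smash 1 x + smash 1 x) ⊓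
      eqq (smash 1 (x + x + 1)) (smash 1 x + smash 1 x)),
    eqq (smash x y) (smash y x),
    eqq (len x) (len y) ⟹ eqq (smash x z) (smash y z),
    le x (x + y),
    (le x y ⊓ ne x y) ⟹ (le (x + x + 1) (y + y) ⊓ ne (x + x + 1) (y + y)),
    eqq (x + y) (y + x),
    eqq (x + 0) x,
    eqq (x + (y + 1)) (x + y + 1),
    eqq (x + y + z) (x + (y + z)),
    le (x + y) (x + z) ⇔ le y z,
    ne x 0 ⟹ eqq (len x) (len (half x) + 1),
    eqq x (half y) ⇔ (eqq (x + x) y ⊔ eqq (x + x + 1) y) ]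

/-- The axioms for the part function, padding and modified subtraction. -/
def newAxioms : List ((LBA X).Formula (Fin 4)) :=
  let x := vx X
  let y := vy X
  let i := vz X
  let j := vw X
  [ le j i ⟹ eqq (part x i j) 0,
    lt i j ⟹ eqq (part x (i + 1) (j + 1)) (part (half x) i j),
    eqq (part (x + x) 0 (j + 1)) (part x 0 j + part x 0 j) ⊓
      eqq (part (x + x + 1) 0 (j + 1)) (part x 0 j + part x 0 j + 1),
    eqq (pad x 0) x,
    ne y 0 ⟹ eqq (pad x y) (pad x (half y) + pad x (half y)),
    le x y ⟹ eqq (x - y) 0,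
    le y x ⟹ eqq (x + 1 - y) (x - y + 1) ]

/-- Further basic facts about the functions of `L_BA`, all of them quantifier-free.
The first three are Buss' axioms `|x # y| = |x| * |y| + 1` and
`|x| = |u| + |v| → x # y = (u # y) * (v # y)`, together with their consequence `1 # 1 = 2`, written
without multiplication: the product `|v| * |y|` of lengths is `|v # y| - 1`, which is also
`|⌊(v # y) / 2⌋|`, so that multiplication by `v # y` is padding by this length.
Then follow `MSP(x, 0) = x` and `MSP(x, i + 1) = ⌊MSP(x, i) / 2⌋`, the vanishing of the digits
beyond the length, and the characteristic property of subtraction. -/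
def furtherAxioms : List ((LBA X).Formula (Fin 4)) :=
  let x := vx X
  let y := vy X
  let u := vz X
  let v := vw X
  let i := vz X
  let j := vw X
  [ eqq (len (smash x y)) (len (smash x y) - 1 + 1),
    eqq (len x) (len u + len v) ⟹ eqq (smash x y) (pad (smash u y) (half (smash v y))),
    eqq (smash 1 1) (1 + 1),
    eqq (msp x 0) x,
    eqq (msp x (i + 1)) (half (msp x i)),
    le (len x) i ⟹ eqq (part x i j) 0,
    le y x ⟹ eqq (x - y + y) x ]

/-- `BASIC`. The equality axioms, also those for the predicate constants in `X`, hold in every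
structure. -/
def BASIC : (LBA X).Theory :=
  {σ | ∃ φ ∈ bussAxioms X ++ newAxioms X ++ furtherAxioms X, σ = closure φ}

variable {X}

/-- `A(0) ∧ ∀ y < |x| (A(y) → A(y + 1)) → A(|x|)`, where the variable `0` of `A` is the induction
variable and the others are parameters. In the result the variable `0` is `x`. -/
def lind {n : ℕ} (A : (LBA X).Formula (Fin (n + 1))) : (LBA X).Formula (Fin (n + 1)) :=
  let param : Fin n → (LBA X).Term (Fin (n + 1)) := fun i => Term.var i.succ
  let y : (LBA X).Term (Option (Fin (n + 1))) := Term.var none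
  (A.subst (Fin.cons 0 param) ⊓
      allV (lt y (up (len (Term.var 0))) ⟹
        (A.subst (Fin.cons y fun i => up (param i)) ⟹
          A.subst (Fin.cons (y + 1) fun i => up (param i))))) ⟹
    A.subst (Fin.cons (len (Term.var 0)) param)

variable (X)

/-- The bit extensionality axiom. -/
def bitExt : (LBA X).Formula (Fin 2) :=
  let x : (LBA X).Term (Fin 2) := Term.var 0
  let y : (LBA X).Term (Fin 2) := Term.var 1
  let i : (LBA X).Term (Option (Fin 2)) := Term.var none
  (eqq (len x) (len y) ⊓
      allV (lt i (up (len x)) ⟹ eqq (bit i (up x)) (bit i (up y)))) ⟹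
    eqq x y

/-- The theory `Σ₀ᵇ-LIND` in the language `L_BA(X)`. -/
def Sigma0LIND : (LBA X).Theory :=
  BASIC X ∪
    {σ | ∃ (n : ℕ) (A : (LBA X).Formula (Fin (n + 1))), IsSigma0 A ∧ σ = closure (lind A)} ∪
    {closure (bitExt X)}

end Base

/-! ### Inductively defined predicates and the theory `AID` -/

/-- Boolean propositional formulae in atoms from `ι`. -/
inductive BoolForm (ι : Type) : Type
  | atom : ι → BoolForm ι
  | top : BoolForm ι
  | bot : BoolForm ι
  | neg : BoolForm ι → BoolForm ι
  | and : BoolForm ι → BoolForm ι → BoolForm ι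
  | or : BoolForm ι → BoolForm ι → BoolForm ι

/-- The truth value of a boolean formula under a valuation. -/
def BoolForm.eval {ι : Type} (v : ι → Prop) : BoolForm ι → Prop
  | atom a => v a
  | top => True
  | bot => False
  | neg φ => ¬ φ.eval v
  | and φ ψ => φ.eval v ∧ ψ.eval v
  | or φ ψ => φ.eval v ∨ ψ.eval v

/-- Simultaneous replacement of the atoms of a boolean formula by formulae. -/
def BoolForm.inst {ι α : Type} {X : ℕ → Type} (v : ι → (LBA X).Formula α) :
    BoolForm ι → (LBA X).Formula α
  | atom a => v a
  | top => ⊤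
  | bot => ⊥
  | neg φ => ∼(φ.inst v)
  | and φ ψ => φ.inst v ⊓ ψ.inst v
  | or φ ψ => φ.inst v ⊔ ψ.inst v

/-- The items `ℓ, B, D₁, …, D_m, I` of an inductive definition with `n` parameters `x₁, …, x_n`. The
variables of `B` and `D_j` are `x₁, …, x_n` and, in the last place, `p`. -/
structure IndDef (n : ℕ) : Type where
  /-- the coefficients of the linear form `ℓ` -/
  coeff : Fin n → ℕ
  /-- the constant of the linear form `ℓ` -/
  const : ℕ
  B : LBase.Formula (Fin (n + 1))
  B_sigma0 : IsSigma0 B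
  m : ℕ
  D : Fin m → LBase.Formula (Fin (n + 1))
  D_sigma0 : ∀ j, IsSigma0 (D j)
  /-- the atoms are `d₁, …, d_m` and then `p₀ = false`, `p₁ = true` -/
  I : BoolForm (Fin m ⊕ Bool)

/-- An `(n + 1)`-ary predicate constant for each inductive definition with `n` parameters. -/
inductive IndPred : ℕ → Type
  | mk {n : ℕ} (d : IndDef n) : IndPred (n + 1)

/-- The language of `AID`. -/
abbrev LAID : Language := LBA IndPred

/-- The inclusion of `L_BA` in the language of `AID`. -/
def incl : LBase →ᴸ LAID where
  onFunction := fun _ f => f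
  onRelation := fun _ R => Sum.map id Empty.elim R

section AID

variable {n : ℕ} (d : IndDef n)

/-- The parameter `x_i` and the variable `p`. -/
def xv (i : Fin n) : LAID.Term (Fin (n + 1)) := Term.var i.castSucc
def pv : LAID.Term (Fin (n + 1)) := Term.var (Fin.last n)

/-- The term `ℓ‖x₁, …, x_n‖ = ∑ c_i ‖x_i‖ + c`, where `‖x‖ = ||x||`. -/
def ellTerm : LAID.Term (Fin (n + 1)) :=
  ((List.finRange n).map fun i => times (d.coeff i) (len (len (xv i)))).foldr (· + ·)
    (times d.const 1)

/-- The atomic formula `A(x₁, …, x_n, t)`. -/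
def indAtom (t : LAID.Term (Fin (n + 1))) : LAID.Formula (Fin (n + 1)) :=
  Relations.formula (L := LAID) (n := n + 1) (Sum.inr (IndPred.mk d)) (Fin.snoc xv t)

/-- `A(x, p) → 0 ≠ |p| ≤ ℓ‖x‖` -/
def axA0 : LAID.Formula (Fin (n + 1)) :=
  indAtom d pv ⟹ (ne 0 (len pv) ⊓ le (len pv) (ellTerm d))

/-- `0 ≠ |p| = ℓ‖x‖ → [A(x, p) ↔ B(x, p)]` -/
def axA1 : LAID.Formula (Fin (n + 1)) :=
  (ne 0 (len pv) ⊓ eqq (len pv) (ellTerm d)) ⟹ (indAtom d pv ⇔ incl.onFormula d.B)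

/-- `0 ≠ |p| < ℓ‖x‖ → [A(x, p) ↔ I(D₁(x, p), …, D_m(x, p), A(x, 2p), A(x, 2p + 1))]` -/
def axA2 : LAID.Formula (Fin (n + 1)) :=
  (ne 0 (len pv) ⊓ lt (len pv) (ellTerm d)) ⟹
    (indAtom d pv ⇔
      d.I.inst (Sum.elim (fun j => incl.onFormula (d.D j))
        (fun b => indAtom d (if b then pv + pv + 1 else pv + pv))))

/-- The theory `AID`. -/
def AID : LAID.Theory :=
  Sigma0LIND IndPred ∪
    {σ | ∃ (n : ℕ) (d : IndDef n),
      σ = closure (axA0 d) ∨ σ = closure (axA1 d) ∨ σ = closure (axA2 d)}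

end AID

/-! ### The standard model -/

/-- The standard interpretation of the function symbols. -/
def stdFun : ∀ {n : ℕ}, BAFunc n → (Fin n → ℕ) → ℕ
  | _, .zero, _ => 0
  | _, .one, _ => 1
  | _, .add, v => v 0 + v 1
  | _, .half, v => v 0 / 2
  | _, .len, v => (v 0).size
  | _, .smash, v => 2 ^ ((v 0).size * (v 1).size)
  | _, .pad, v => v 0 * 2 ^ (v 1).size
  | _, .sub, v => v 0 - v 1
  | _, .part, v => v 0 / 2 ^ v 1 % 2 ^ (v 2 - v 1)

/-- The standard interpretation of `≤`. -/
def stdLe : ∀ {n : ℕ}, BARel n → (Fin n → ℕ) → Prop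
  | _, .le, v => v 0 ≤ v 1

/-- The standard model of `L_BA`. -/
instance stdBase : LBase.Structure ℕ where
  funMap := stdFun
  RelMap := fun R v => Sum.elim (fun R => stdLe R v) Empty.elim R

/-- The value `ℓ‖x₁, …, x_n‖`. -/
def IndDef.ell {n : ℕ} (d : IndDef n) (x : Fin n → ℕ) : ℕ :=
  ∑ i, d.coeff i * (x i).size.size + d.const

/-- The truth value at the node `p` of the tree of an inductive definition, if the leaves are `h`
levels above `p`. -/
def IndDef.value {n : ℕ} (d : IndDef n) (x : Fin n → ℕ) : ℕ → ℕ → Prop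
  | 0, p => d.B.Realize (Fin.snoc x p : Fin (n + 1) → ℕ)
  | h + 1, p => d.I.eval (Sum.elim
      (fun j => (d.D j).Realize (Fin.snoc x p : Fin (n + 1) → ℕ))
      (fun b => d.value x h (if b then 2 * p + 1 else 2 * p)))

/-- The standard interpretation of the inductively defined predicate of `d`. -/
def IndDef.holds {n : ℕ} (d : IndDef n) (x : Fin n → ℕ) (p : ℕ) : Prop :=
  0 ≠ p.size ∧ p.size ≤ d.ell x ∧ d.value x (d.ell x - p.size) p

/-- The standard interpretation of the predicate constants. -/
def stdInd : ∀ {n : ℕ}, IndPred n → (Fin n → ℕ) → Prop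
  | _, .mk d, v => d.holds (Fin.init v) (v (Fin.last _))

/-- The standard model of the language of `AID`. -/
instance stdAID : LAID.Structure ℕ where
  funMap := stdFun
  RelMap := fun R v => Sum.elim (fun R => stdLe R v) (fun A => stdInd A v) R

/-! ### Bitdefinable functions -/

/-- A polynomial (with natural coefficients) in the lengths `|x₁|, …, |x_n|`, written as a sum of
monomials; a monomial is the list of its factors. -/
abbrev LenPoly (n : ℕ) : Type := List (List (Fin n))

/-- The value of a polynomial, where `l i` is the length of the `i`-th variable. -/
def LenPoly.eval {n : ℕ} (P : LenPoly n) (l : Fin n → ℕ) : ℕ :=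
  (P.map fun M => (M.map l).prod).sum

/-- A term whose length is the value of the monomial `M` at the lengths of the terms `a i`. This uses
`|⌊(s # t) / 2⌋| = |s| * |t|`. -/
def monoTerm {X : ℕ → Type} {α : Type} {n : ℕ} (M : List (Fin n)) (a : Fin n → (LBA X).Term α) :
    (LBA X).Term α :=
  M.foldr (fun i t => half (smash (a i) t)) 1

/-- The term `P(|a₁|, …, |a_n|)`. -/
def LenPoly.term {X : ℕ → Type} {α : Type} {n : ℕ} (P : LenPoly n)
    (a : Fin n → (LBA X).Term α) : (LBA X).Term α :=
  (P.map fun M => len (monoTerm M a)).foldr (· + ·) 0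

/-- The function `F` is of polynomial growth rate, as witnessed by the bound `P` for the length of
its values, and its bitgraph is defined in the standard model by the `Σ₀ᵇ`-formula `A(i, x)` in the
language of `AID`. The variable `0` of `A` is `i`. -/
structure BitDefines {n : ℕ} (A : LAID.Formula (Fin (n + 1))) (P : LenPoly n)
    (F : (Fin n → ℕ) → ℕ) : Prop where
  sigma0 : IsSigma0 A
  growth : ∀ x, (F x).size ≤ P.eval fun i => (x i).size
  bitgraph : ∀ (x : Fin n → ℕ) (i : ℕ),
    A.Realize (Fin.cons i x : Fin (n + 1) → ℕ) ↔ (F x).testBit i = true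

section Sets

variable {β : Type} {n : ℕ}

/-- The formula `i < P(|a₁|, …, |a_n|) ∧ A(i, a₁, …, a_n)`, where `i` is the variable `none`. It
says that `i` belongs to the set `{i < P|a| : A(i, a)}`. -/
def bitSet (A : LAID.Formula (Fin (n + 1))) (P : LenPoly n) (a : Fin n → LAID.Term β) :
    LAID.Formula (Option β) :=
  lt (Term.var none) (up (P.term a)) ⊓ A.subst (Fin.cons (Term.var none) fun i => up (a i))

/-- The formula `t = {i < P|a| : A(i, a)}`, i.e. `|t| ≤ P|a|` and for all `i < P|a|`,
`Bit(i, t) = 1` iff `A(i, a)`. -/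
def isBitSet (t : LAID.Term β) (A : LAID.Formula (Fin (n + 1))) (P : LenPoly n)
    (a : Fin n → LAID.Term β) : LAID.Formula β :=
  le (len t) (P.term a) ⊓
    allV (lt (Term.var none) (up (P.term a)) ⟹
      (eqq (bit (Term.var none) (up t)) 1 ⇔
        A.subst (Fin.cons (Term.var none) fun i => up (a i))))

/-- The `i`-th digit (`i` is the variable `none`) of the sum of the numbers whose binary digits are
given by `U` and `V`: it is the exclusive or of `U(i)`, `V(i)` and the carry into position `i`, and
there is a carry iff for some `j < i` both `U(j)` and `V(j)` hold, and exactly one of `U(k)`, `V(k)`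
for every `k` strictly between `j` and `i`. -/
def sumBit (U V : LAID.Formula (Option β)) : LAID.Formula (Option β) :=
  let j₁ : LAID.Term (Option (Option β)) := Term.var none
  let i₁ : LAID.Term (Option (Option β)) := Term.var (some none)
  let k₂ : LAID.Term (Option (Option (Option β))) := Term.var none
  let at₁ : LAID.Formula (Option β) → LAID.Formula (Option (Option β)) :=
    fun W => W.relabel (Option.map some)
  let at₂ : LAID.Formula (Option β) → LAID.Formula (Option (Option (Option β))) :=
    fun W => W.relabel (Option.map fun b => some (some b))
  let carry : LAID.Formula (Option β) :=
    exV (lt j₁ i₁ ⊓ (at₁ U ⊓ at₁ V) ⊓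
      allV ((lt (up j₁) k₂ ⊓ lt k₂ (up i₁)) ⟹ xor (at₂ U) (at₂ V)))
  xor (xor U V) carry

end Sets

/-- The function `g(x, y) = ∑_{i < |x|} f(i, y)`; the variable `0` is `x`, the others are `y`. -/
def vectorSum {k : ℕ} (f : (Fin (k + 1) → ℕ) → ℕ) (v : Fin (k + 1) → ℕ) : ℕ :=
  ∑ i ∈ Finset.range (v 0).size, f (Fin.cons i (Fin.tail v))

section Recursion

variable {k : ℕ} (Af Ag : LAID.Formula (Fin (k + 2))) (P Q : LenPoly (k + 1))

/-- `g(0, y) = 0`: no `i` belongs to `g(0, y)`. -/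
def sumZero : LAID.Formula (Option (Fin k)) :=
  ∼(bitSet Ag Q (Fin.cons 0 fun i => Term.var i))

/-- `x ≠ 0 → g(x, y) = g(⌊x/2⌋, y) + f(|x| - 1, y)`, digit by digit. -/
def sumStep : LAID.Formula (Option (Fin (k + 1))) :=
  let x : LAID.Term (Fin (k + 1)) := Term.var 0
  let y : Fin k → LAID.Term (Fin (k + 1)) := fun i => Term.var i.succ
  ne (up x) 0 ⟹
    (bitSet Ag Q (Fin.cons x y) ⇔
      sumBit (bitSet Ag Q (Fin.cons (half x) y)) (bitSet Af P (Fin.cons (len x - 1) y)))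

/-- `w = g(0, y) → w = 0`, for the number `w`, which is the variable `none`. -/
def sumZeroNum : LAID.Formula (Option (Fin k)) :=
  isBitSet (Term.var none) Ag Q (Fin.cons 0 fun i => Term.var (some i)) ⟹
    eqq (Term.var none) 0

/-- `x ≠ 0 ∧ w = g(x, y) ∧ u = g(⌊x/2⌋, y) ∧ v = f(|x| - 1, y) → w = u + v`, for numbers `u`, `v`,
`w`. -/
def sumStepNum : LAID.Formula (Fin (k + 1) ⊕ Fin 3) :=
  let x : LAID.Term (Fin (k + 1) ⊕ Fin 3) := Term.var (Sum.inl 0)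
  let y : Fin k → LAID.Term (Fin (k + 1) ⊕ Fin 3) := fun i => Term.var (Sum.inl i.succ)
  let u : LAID.Term (Fin (k + 1) ⊕ Fin 3) := Term.var (Sum.inr 0)
  let v : LAID.Term (Fin (k + 1) ⊕ Fin 3) := Term.var (Sum.inr 1)
  let w : LAID.Term (Fin (k + 1) ⊕ Fin 3) := Term.var (Sum.inr 2)
  (ne x 0 ⊓ isBitSet w Ag Q (Fin.cons x y) ⊓ isBitSet u Ag Q (Fin.cons (half x) y) ⊓
      isBitSet v Af P (Fin.cons (len x - 1) y)) ⟹
    eqq w (u + v)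

end Recursion

end BoundedArith

/-!
Why the sum is definable. Adding up `|x|` numbers one after the other, or by a tree of ordinary
additions, is not possible with the tools of `AID`: an inductive definition only evaluates a boolean
tree whose height is linear in `‖x‖`. Carry-save adders have bounded depth: a sum of three numbers is
the sum of their digitwise parity and of twice their digitwise majority (`DSet.add_add_eq`), so a
pair of two numbers can represent the total at every node of a binary tree of height `‖x‖` over the
summands, and each output digit of an adder depends on a bounded number of input digits (`gate`). Only
at the root the two numbers have to be added properly, which a `Σ₀ᵇ`-formula does.

Evaluation by inductive definitions. In an inductively defined predicate a node has two children and a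
fixed truth function, while an adder reads eight input digits. One adder is therefore simulated by
twelve levels of the tree: eight disjunctions guess the inputs, three conjunctions choose one of them,
and the last level computes the adder and checks the guess at the chosen input (`blockFun`,
`Mod.block_gate`). The input digit of a carry output is taken one place lower. The number of such shifts
on the way from the root is bounded by `2 ‖x‖`, and it is counted by a `Σ₀ᵇ`-formula (`Mod.cnt`), which
lists partial sums in two stages so that the list has length `O(‖x‖)`. The leaves have to evaluate an
arbitrary `Σ₀ᵇ`-formula with inductively defined predicates. This is possible since such a formula is
itself equivalent to one inductively defined predicate: trees can be put on top of trees, sharply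
bounded quantifiers being trees of conjunctions (`exists_comp`, `exists_normal`, `exists_tree`).

Proof of the recursion in a model of `AID`. Definable sets of digits below `|w|` form a commutative
monoid under digitwise addition with carries (`Mod.DSet`); induction up to a length suffices for this.
The value at a node of the tree depends only on the path through the binary tree and on the position
of the digit, not on the guesses above it (`SumTree.invariant`). Hence the total at a node is the sum
of the totals at its children (`SumTree.total_node`). By induction from the leaves to the root, adding
one summand changes the total at the root by that summand (`SumTree.total_succ`), and the total does not
depend on the height of the tree (`SumTree.total_unique`). With the bound for the length given by the
sum of `|x|` and the bound for the summands, digitwise addition modulo a large power of two is the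
addition of sets of digits, and for elements of the model it agrees with `+`, by bit extensionality.

Since `ℕ` is a model of `AID` (`models_AID`), the recursion equations also show that in the standard model
the formula defines the digits of the true sum.
-/

namespace BoundedArith

/-! ### Closure properties of `Σ₀ᵇ`-formulae -/

section Quantifiers

variable {X Y : ℕ → Type} {α β : Type}

namespace IsSigma0

theorem not {n : ℕ} {φ : (LBA X).BoundedFormula α n} (h : IsSigma0 φ) : IsSigma0 φ.not :=
  imp h falsum

theorem top {n : ℕ} : IsSigma0 (⊤ : (LBA X).BoundedFormula α n) := imp falsum falsum

theorem bot {n : ℕ} : IsSigma0 (⊥ : (LBA X).BoundedFormula α n) := falsum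

theorem and {n : ℕ} {φ ψ : (LBA X).BoundedFormula α n} (h : IsSigma0 φ) (h' : IsSigma0 ψ) :
    IsSigma0 (φ ⊓ ψ) := (imp h h'.not).not

theorem or {n : ℕ} {φ ψ : (LBA X).BoundedFormula α n} (h : IsSigma0 φ) (h' : IsSigma0 ψ) :
    IsSigma0 (φ ⊔ ψ) := imp h.not h'

theorem iff {n : ℕ} {φ ψ : (LBA X).BoundedFormula α n} (h : IsSigma0 φ) (h' : IsSigma0 ψ) :
    IsSigma0 (φ.iff ψ) := (imp h h').and (imp h' h)

theorem le (s t : (LBA X).Term α) : IsSigma0 (le s t) := rel _ _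

theorem lt (s t : (LBA X).Term α) : IsSigma0 (lt s t) := (le t s).not

theorem eqq (s t : (LBA X).Term α) : IsSigma0 (eqq s t) := equal _ _

theorem ne (s t : (LBA X).Term α) : IsSigma0 (ne s t) := (eqq s t).not

/-- A map of atomic formulae that respects the bounds of quantifiers preserves `Σ₀ᵇ`-formulae. -/
theorem mapTermRel {k n : ℕ} {φ : (LBA X).BoundedFormula α n}
    {ft : ∀ n, (LBA X).Term (α ⊕ Fin n) → (LBA Y).Term (β ⊕ Fin (k + n))}
    {fr : ∀ n, (LBA X).Relations n → (LBA Y).Relations n}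
    {h : ∀ n, (LBA Y).BoundedFormula β (k + (n + 1)) → (LBA Y).BoundedFormula β (k + n + 1)}
    (hh : ∀ n φ, h n φ = φ)
    (hr : fr 2 (Sum.inl BARel.le) = Sum.inl BARel.le)
    (hv : ∀ n, ft (n + 1) (Term.var (Sum.inr (Fin.last n))) = Term.var (Sum.inr (Fin.last (k + n))))
    (hl : ∀ n (t : (LBA X).Term (α ⊕ Fin n)), ∃ s : (LBA Y).Term (β ⊕ Fin (k + n)),
      ft (n + 1) (len (t.relabel (Sum.map id Fin.castSucc))) = len (s.relabel (Sum.map id Fin.castSucc)))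
    (hφ : IsSigma0 φ) : IsSigma0 (φ.mapTermRel ft fr h) := by
  induction hφ with
  | falsum => exact falsum
  | equal s t => exact equal _ _
  | rel R ts => exact rel _ _
  | imp _ _ h₁ h₂ => exact imp h₁ h₂
  | @ball n t φ _ ih =>
    obtain ⟨s, hs⟩ := hl _ t
    have : (((Relations.boundedFormula (L := LBA X) (n := 2) (Sum.inl BARel.le)
          ![Term.var (Sum.inr (Fin.last n)),
            len (t.relabel (Sum.map id Fin.castSucc))]).imp φ).all).mapTermRel ft fr h =
        ((Relations.boundedFormula (L := LBA Y) (n := 2) (Sum.inl BARel.le)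
          ![Term.var (Sum.inr (Fin.last (k + n))),
            len (s.relabel (Sum.map id Fin.castSucc))]).imp (φ.mapTermRel ft fr h)).all := by
      simp only [BoundedFormula.mapTermRel, hh, Relations.boundedFormula, hr]
      congr 3
      funext i
      refine Fin.cases ?_ (fun i => ?_) i
      · exact hv n
      · rw [Subsingleton.elim i 0]
        exact hs
    rw [this]
    exact ball s ih

theorem relabel {k n : ℕ} {φ : (LBA X).BoundedFormula α n} (g : α → β ⊕ Fin k)
    (hφ : IsSigma0 φ) : IsSigma0 (φ.relabel g) := by
  refine mapTermRel (fun n φ => BoundedFormula.castLE_rfl _ _) rfl (fun n => ?_) (fun n t => ?_) hφ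
  · simp only [Term.relabel, BoundedFormula.relabelAux]
    rfl
  · refine ⟨t.relabel (BoundedFormula.relabelAux g n), ?_⟩
    have e : ∀ (γ δ : Type) (f : γ → δ) (t : (LBA X).Term γ), (len t).relabel f = len (t.relabel f) :=
      fun γ δ f t => by
        simp only [len, Term.relabel]
        congr 1
        funext i
        rw [Subsingleton.elim i 0]; rfl
    rw [e, Term.relabel_relabel, Term.relabel_relabel]
    congr 2
    funext x
    rcases x with x | x
    · simp only [BoundedFormula.relabelAux, Function.comp_apply, Sum.map_inl]
      simp only [id]
      generalize g x = y
      rcases y with y | y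
      · rfl
      · rfl
    · rfl

theorem formula_relabel {φ : (LBA X).Formula α} (g : α → β) (hφ : IsSigma0 φ) :
    IsSigma0 (Formula.relabel g φ) := relabel _ hφ

theorem subst {n : ℕ} {φ : (LBA X).BoundedFormula α n} (f : α → (LBA X).Term β)
    (hφ : IsSigma0 φ) : IsSigma0 (φ.subst f) := by
  induction hφ with
  | falsum => exact falsum
  | equal s t => exact equal _ _
  | rel R ts => exact rel _ _
  | imp _ _ h₁ h₂ => exact imp h₁ h₂
  | @ball n t φ _ ih =>
    have : (((Relations.boundedFormula (L := LBA X) (n := 2) (Sum.inl BARel.le)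
          ![Term.var (Sum.inr (Fin.last n)),
            len (t.relabel (Sum.map id Fin.castSucc))]).imp φ).all).subst f =
        ((Relations.boundedFormula (L := LBA X) (n := 2) (Sum.inl BARel.le)
          ![Term.var (Sum.inr (Fin.last n)),
            len ((t.subst (Sum.elim (Term.relabel Sum.inl ∘ f) (Term.var ∘ Sum.inr))).relabel
              (Sum.map id Fin.castSucc))]).imp (φ.subst f)).all := by
      simp only [BoundedFormula.subst, BoundedFormula.mapTermRel, Relations.boundedFormula, id]
      congr 3
      funext i
      refine Fin.cases ?_ (fun i => ?_) i
      · rfl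
      · rw [Subsingleton.elim i 0]
        simp only [Matrix.cons_val_succ, Matrix.cons_val_zero, len, Term.subst]
        congr 1
        funext i
        rw [Subsingleton.elim i 0]
        simp only [Matrix.cons_val_zero]
        clear ih
        induction t with
        | var x =>
          rcases x with x | x
          · simp only [Term.relabel, Term.subst, Term.relabel_relabel, Sum.map_inl, Sum.elim_inl,
              Function.comp_apply, id]
            rfl
          · rfl
        | func F ts ih =>
          simp only [Term.relabel, Term.subst]
          congr 1
          funext i
          exact ih i
    rw [this]
    exact ball _ ih

theorem onFormula {n : ℕ} {φ : LBase.BoundedFormula α n} (hφ : IsSigma0 φ) :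
    IsSigma0 (incl.onBoundedFormula φ : LAID.BoundedFormula α n) := by
  induction hφ with
  | falsum => exact falsum
  | equal s t => exact equal _ _
  | rel R ts => exact rel _ _
  | imp _ _ h₁ h₂ => exact imp h₁ h₂
  | @ball n t φ _ ih =>
    have e : ∀ (n m : ℕ) (g : α ⊕ Fin n → α ⊕ Fin m) (t : LBase.Term (α ⊕ Fin n)),
        incl.onTerm (t.relabel g) = (incl.onTerm t).relabel g := by
      intro n m g t
      induction t with
      | var x => rfl
      | func F ts ih =>
        simp only [Term.relabel, LHom.onTerm]
        congr 1
        funext i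
        exact ih i
    have : incl.onBoundedFormula (((Relations.boundedFormula (L := LBase) (n := 2) (Sum.inl BARel.le)
          ![Term.var (Sum.inr (Fin.last n)),
            len (t.relabel (Sum.map id Fin.castSucc))]).imp φ).all) =
        ((Relations.boundedFormula (L := LAID) (n := 2) (Sum.inl BARel.le)
          ![Term.var (Sum.inr (Fin.last n)),
            len ((incl.onTerm t).relabel (Sum.map id Fin.castSucc))]).imp
              (incl.onBoundedFormula φ)).all := by
      simp only [LHom.onBoundedFormula, Relations.boundedFormula]
      congr 3
      funext i
      refine Fin.cases ?_ (fun i => ?_) i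
      · rfl
      · rw [Subsingleton.elim i 0, ← e]
        simp only [Function.comp_apply, Matrix.cons_val_succ, Matrix.cons_val_zero, len, LHom.onTerm]
        congr 1
        funext i
        rw [Subsingleton.elim i 0]
        rfl
    rw [this]
    exact ball _ ih

end IsSigma0

/-- The sharply bounded quantification `∀ z ≤ |t|` of the variable `none`. -/
def allLe (t : (LBA X).Term α) (φ : (LBA X).Formula (Option α)) : (LBA X).Formula α :=
  allV (le (Term.var none) (len (up t)) ⟹ φ)

/-- The sharply bounded quantification `∃ z ≤ |t|` of the variable `none`. -/
def exLe (t : (LBA X).Term α) (φ : (LBA X).Formula (Option α)) : (LBA X).Formula α :=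
  ∼(allLe t ∼φ)

theorem IsSigma0.allLe {t : (LBA X).Term α} {φ : (LBA X).Formula (Option α)} (h : IsSigma0 φ) :
    IsSigma0 (allLe t φ) := by
  have := (h.relabel (k := 1) (fun o : Option α => o.elim (Sum.inr 0) Sum.inl)).ball
    (t.relabel Sum.inl)
  unfold BoundedArith.allLe allV
  convert this using 1
  simp only [BoundedFormula.relabel_imp]
  congr 2
  unfold BoundedArith.le Relations.formula Relations.boundedFormula
  simp only [BoundedFormula.relabel, BoundedFormula.mapTermRel]
  congr 1
  funext i
  refine Fin.cases ?_ (fun i => ?_) i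
  · rfl
  · rw [Subsingleton.elim i 0]
    simp only [Matrix.cons_val_succ, Matrix.cons_val_zero, len, up, Term.relabel]
    congr 1
    funext i
    rw [Subsingleton.elim i 0]
    simp only [Matrix.cons_val_zero, Term.relabel_relabel]
    rfl

theorem IsSigma0.exLe {t : (LBA X).Term α} {φ : (LBA X).Formula (Option α)} (h : IsSigma0 φ) :
    IsSigma0 (exLe t φ) := h.not.allLe.not

end Quantifiers

end BoundedArith

namespace BoundedArith

/-! ### Models of `AID` -/

/-- A model of `AID`, with its structure. -/
class AIDModel (M : Type) extends Language.Structure LAID M where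
  models : M ⊨ AID

theorem realize_closure {X : ℕ → Type} {M : Type} [(LBA X).Structure M] {n : ℕ}
    (φ : (LBA X).Formula (Fin n)) : M ⊨ closure φ ↔ ∀ v : Fin n → M, φ.Realize v := by
  unfold closure Sentence.Realize
  refine BoundedFormula.realize_alls.trans (forall_congr' fun v => ?_)
  rw [BoundedFormula.realize_relabel, Formula.Realize]
  refine iff_of_eq (congrArg₂ _ ?_ (Subsingleton.elim _ _))
  funext i
  simp

namespace Mod

variable {M : Type} [AIDModel M]

instance : Zero M := ⟨Structure.funMap (L := LAID) BAFunc.zero Fin.elim0⟩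
instance : One M := ⟨Structure.funMap (L := LAID) BAFunc.one Fin.elim0⟩
instance : Add M := ⟨fun x y => Structure.funMap (L := LAID) BAFunc.add ![x, y]⟩
instance : Sub M := ⟨fun x y => Structure.funMap (L := LAID) BAFunc.sub ![x, y]⟩
instance : LE M := ⟨fun x y => Structure.RelMap (L := LAID) (n := 2) (Sum.inl BARel.le) ![x, y]⟩

/-- `⌊x / 2⌋` in a model. -/
def half (x : M) : M := Structure.funMap (L := LAID) BAFunc.half ![x]
/-- The length `|x|` in a model. -/
def len (x : M) : M := Structure.funMap (L := LAID) BAFunc.len ![x]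
/-- `x # y` in a model. -/
def smash (x y : M) : M := Structure.funMap (L := LAID) BAFunc.smash ![x, y]
/-- `x * 2 ^ |y|` in a model. -/
def pad (x y : M) : M := Structure.funMap (L := LAID) BAFunc.pad ![x, y]
/-- `x[i, j)` in a model. -/
def part (x i j : M) : M := Structure.funMap (L := LAID) BAFunc.part ![x, i, j]
/-- The binary digit of `x` at `i`, an element of the model. -/
def bit (i x : M) : M := part x i (i + 1)
/-- The most significant part of `x` from `i` on. -/
def msp (x i : M) : M := part x i (len x)
/-- The interpretation of the inductively defined predicate of `d`. -/
def ind {n : ℕ} (d : IndDef n) (x : Fin n → M) (p : M) : Prop :=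
  Structure.RelMap (L := LAID) (n := n + 1) (Sum.inr (IndPred.mk d)) (Fin.snoc x p)

end Mod

/-- A structure for `L_BA(X)` on a model of `AID` with the same functions and the same order. -/
class Compat (X : ℕ → Type) (M : Type) [AIDModel M] [(LBA X).Structure M] : Prop where
  fun_eq : ∀ {n : ℕ} (f : BAFunc n) (v : Fin n → M),
    Structure.funMap (L := LBA X) f v = Structure.funMap (L := LAID) f v
  le_iff : ∀ v : Fin 2 → M, Structure.RelMap (L := LBA X) (n := 2) (Sum.inl BARel.le) v ↔
    Structure.RelMap (L := LAID) (n := 2) (Sum.inl BARel.le) v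

section Realize

variable {X : ℕ → Type} {M : Type} [AIDModel M] {α β : Type}

instance : Compat IndPred M := ⟨fun _ _ => rfl, fun _ => Iff.rfl⟩

/-- The `L_BA`-reduct of a model. -/
instance reductBase : LBase.Structure M := incl.reduct M

instance : (incl : LBase →ᴸ LAID).IsExpansionOn M := inferInstance

instance : Compat (fun _ => Empty) M := ⟨fun _ _ => rfl, fun _ => Iff.rfl⟩

variable [(LBA X).Structure M] [Compat X M]

@[simp] theorem realize_zero (v : α → M) : (0 : (LBA X).Term α).realize v = 0 := by
  refine (Compat.fun_eq (X := X) BAFunc.zero _).trans ?_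
  exact congrArg _ (Subsingleton.elim _ _)

@[simp] theorem realize_one (v : α → M) : (1 : (LBA X).Term α).realize v = 1 := by
  refine (Compat.fun_eq (X := X) BAFunc.one _).trans ?_
  exact congrArg _ (Subsingleton.elim _ _)

theorem realize_fun₁ (f : BAFunc 1) (t : (LBA X).Term α) (v : α → M) :
    (Term.func (L := LBA X) f ![t]).realize v = Structure.funMap (L := LAID) f ![t.realize v] := by
  refine (Compat.fun_eq (X := X) f _).trans (congrArg _ ?_)
  funext i
  rw [Subsingleton.elim i 0]
  rfl

theorem realize_fun₂ (f : BAFunc 2) (s t : (LBA X).Term α) (v : α → M) :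
    (Term.func (L := LBA X) f ![s, t]).realize v =
      Structure.funMap (L := LAID) f ![s.realize v, t.realize v] := by
  refine (Compat.fun_eq (X := X) f _).trans (congrArg _ ?_)
  funext i
  refine Fin.cases rfl (fun i => ?_) i
  rw [Subsingleton.elim i 0]
  rfl

@[simp] theorem realize_add (s t : (LBA X).Term α) (v : α → M) :
    (s + t).realize v = s.realize v + t.realize v := realize_fun₂ _ _ _ _

@[simp] theorem realize_sub (s t : (LBA X).Term α) (v : α → M) :
    (s - t).realize v = s.realize v - t.realize v := realize_fun₂ _ _ _ _

@[simp] theorem realize_half (t : (LBA X).Term α) (v : α → M) :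
    (half t).realize v = Mod.half (t.realize v) := realize_fun₁ _ _ _

@[simp] theorem realize_len (t : (LBA X).Term α) (v : α → M) :
    (len t).realize v = Mod.len (t.realize v) := realize_fun₁ _ _ _

@[simp] theorem realize_smash (s t : (LBA X).Term α) (v : α → M) :
    (smash s t).realize v = Mod.smash (s.realize v) (t.realize v) := realize_fun₂ _ _ _ _

@[simp] theorem realize_pad (s t : (LBA X).Term α) (v : α → M) :
    (pad s t).realize v = Mod.pad (s.realize v) (t.realize v) := realize_fun₂ _ _ _ _

@[simp] theorem realize_part (s t u : (LBA X).Term α) (v : α → M) :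
    (part s t u).realize v = Mod.part (s.realize v) (t.realize v) (u.realize v) := by
  refine (Compat.fun_eq (X := X) BAFunc.part _).trans (congrArg _ ?_)
  funext i
  refine Fin.cases rfl (fun i => ?_) i
  refine Fin.cases rfl (fun i => ?_) i
  rw [Subsingleton.elim i 0]
  rfl

@[simp] theorem realize_bit (s t : (LBA X).Term α) (v : α → M) :
    (bit s t).realize v = Mod.bit (s.realize v) (t.realize v) := by
  simp [bit, Mod.bit]

@[simp] theorem realize_msp (s t : (LBA X).Term α) (v : α → M) :
    (msp s t).realize v = Mod.msp (s.realize v) (t.realize v) := by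
  simp [msp, Mod.msp]

omit [AIDModel M] [Compat X M] in
@[simp] theorem realize_up (t : (LBA X).Term α) (v : Option α → M) :
    (up t).realize v = t.realize (fun a => v (some a)) := by
  simp [up, Function.comp_def]

@[simp] theorem realize_le (s t : (LBA X).Term α) (v : α → M) :
    (le s t).Realize v ↔ s.realize v ≤ t.realize v := by
  unfold le
  rw [Formula.realize_rel]
  refine (Compat.le_iff (X := X) _).trans (iff_of_eq (congrArg _ ?_))
  funext i
  refine Fin.cases rfl (fun i => ?_) i
  rw [Subsingleton.elim i 0]
  rfl

@[simp] theorem realize_lt' (s t : (LBA X).Term α) (v : α → M) :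
    (lt s t).Realize v ↔ ¬ t.realize v ≤ s.realize v := by
  unfold lt
  rw [Formula.realize_not, realize_le]

omit [AIDModel M] [Compat X M] in
@[simp] theorem realize_eqq (s t : (LBA X).Term α) (v : α → M) :
    (eqq s t).Realize v ↔ s.realize v = t.realize v := Formula.realize_equal

omit [AIDModel M] [Compat X M] in
@[simp] theorem realize_ne (s t : (LBA X).Term α) (v : α → M) :
    (ne s t).Realize v ↔ s.realize v ≠ t.realize v := by
  unfold ne
  rw [Formula.realize_not, realize_eqq]

omit [AIDModel M] [Compat X M] in
@[simp] theorem realize_xor (φ ψ : (LBA X).Formula α) (v : α → M) :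
    (xor φ ψ).Realize v ↔ Xor (φ.Realize v) (ψ.Realize v) := by
  unfold xor
  rw [Formula.realize_not, Formula.realize_iff]
  simp only [xor_iff_not_iff]

omit [AIDModel M] [Compat X M] in
@[simp] theorem realize_allV (φ : (LBA X).Formula (Option α)) (v : α → M) :
    (allV φ).Realize v ↔ ∀ a : M, φ.Realize (fun o => o.elim a v) := by
  unfold allV
  rw [Formula.Realize, BoundedFormula.realize_all]
  refine forall_congr' fun a => ?_
  rw [BoundedFormula.realize_relabel, Formula.Realize]
  refine iff_of_eq (congrArg₂ _ ?_ (Subsingleton.elim _ _))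
  funext o
  cases o
  · simp [Fin.snoc]
  · rfl

omit [AIDModel M] [Compat X M] in
@[simp] theorem realize_exV (φ : (LBA X).Formula (Option α)) (v : α → M) :
    (exV φ).Realize v ↔ ∃ a : M, φ.Realize (fun o => o.elim a v) := by
  unfold exV
  rw [Formula.realize_not, realize_allV]
  simp only [Formula.realize_not, not_forall, not_not]

@[simp] theorem realize_allLe (t : (LBA X).Term α) (φ : (LBA X).Formula (Option α)) (v : α → M) :
    (allLe t φ).Realize v ↔
      ∀ a : M, a ≤ Mod.len (t.realize v) → φ.Realize (fun o => o.elim a v) := by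
  unfold allLe
  rw [realize_allV]
  refine forall_congr' fun a => ?_
  rw [Formula.realize_imp, realize_le]
  simp

@[simp] theorem realize_exLe (t : (LBA X).Term α) (φ : (LBA X).Formula (Option α)) (v : α → M) :
    (exLe t φ).Realize v ↔
      ∃ a : M, a ≤ Mod.len (t.realize v) ∧ φ.Realize (fun o => o.elim a v) := by
  unfold exLe
  rw [Formula.realize_not, realize_allLe]
  simp only [Formula.realize_not, not_forall, not_not, exists_prop]

omit [AIDModel M] [Compat X M] in
@[simp] theorem realize_formula_subst (φ : (LBA X).Formula α) (f : α → (LBA X).Term β) (v : β → M) :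
    Formula.Realize (BoundedFormula.subst φ f) v ↔ φ.Realize (fun a => (f a).realize v) := by
  unfold Formula.Realize
  rw [BoundedFormula.realize_subst]

omit [AIDModel M] [Compat X M] in
@[simp] theorem realize_and (φ ψ : (LBA X).Formula α) (v : α → M) :
    (φ ⊓ ψ).Realize v ↔ φ.Realize v ∧ ψ.Realize v := Formula.realize_inf

omit [AIDModel M] [Compat X M] in
@[simp] theorem realize_or (φ ψ : (LBA X).Formula α) (v : α → M) :
    (φ ⊔ ψ).Realize v ↔ φ.Realize v ∨ ψ.Realize v := Formula.realize_sup

omit [AIDModel M] [Compat X M] in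
@[simp] theorem realize_imp' (φ ψ : (LBA X).Formula α) (v : α → M) :
    Formula.Realize (φ ⟹ ψ) v ↔ (φ.Realize v → ψ.Realize v) := Formula.realize_imp

omit [AIDModel M] [Compat X M] in
@[simp] theorem realize_iff' (φ ψ : (LBA X).Formula α) (v : α → M) :
    Formula.Realize (φ ⇔ ψ) v ↔ (φ.Realize v ↔ ψ.Realize v) := Formula.realize_iff

end Realize

end BoundedArith

namespace BoundedArith

namespace Mod

variable {M : Type} [AIDModel M]

/-! ### The ordered monoid of a model -/

theorem realize_basic {φ : LAID.Formula (Fin 4)}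
    (h : φ ∈ bussAxioms IndPred ++ newAxioms IndPred ++ furtherAxioms IndPred) (v : Fin 4 → M) :
    φ.Realize v :=
  (realize_closure φ).1 ((AIDModel.models (M := M)).realize_of_mem _
    (Or.inl (Or.inl (Or.inl ⟨φ, h, rfl⟩)))) v

theorem buss (x y z : M) :
    (y ≤ x → y ≤ x + 1) ∧ x ≠ x + 1 ∧ 0 ≤ x ∧ (x ≤ y ∧ x ≠ y ↔ x + 1 ≤ y) ∧
    (x ≠ 0 → x + x ≠ 0) ∧ (y ≤ x ∨ x ≤ y) ∧ (x ≤ y ∧ y ≤ x → x = y) ∧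
    (x ≤ y ∧ y ≤ z → x ≤ z) ∧ len (0 : M) = 0 ∧
    (x ≠ 0 → len (x + x) = len x + 1 ∧ len (x + x + 1) = len x + 1) ∧ len (1 : M) = 1 ∧
    (x ≤ y → len x ≤ len y) ∧ smash 0 y = 1 ∧
    (x ≠ 0 → smash 1 (x + x) = smash 1 x + smash 1 x ∧
      smash 1 (x + x + 1) = smash 1 x + smash 1 x) ∧
    smash x y = smash y x ∧ (len x = len y → smash x z = smash y z) ∧ x ≤ x + y ∧
    (x ≤ y ∧ x ≠ y → x + x + 1 ≤ y + y ∧ x + x + 1 ≠ y + y) ∧ x + y = y + x ∧ x + 0 = x ∧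
    x + (y + 1) = x + y + 1 ∧ x + y + z = x + (y + z) ∧ (x + y ≤ x + z ↔ y ≤ z) ∧
    (x ≠ 0 → len x = len (half x) + 1) ∧ (x = half y ↔ x + x = y ∨ x + x + 1 = y) := by
  have h : ∀ φ ∈ bussAxioms IndPred, φ.Realize ![x, y, z, 0] := fun φ hφ =>
    realize_basic (by simp [hφ]) _
  simpa [bussAxioms, vx, vy, vz] using h

theorem basic_new (x y i j : M) :
    (j ≤ i → part x i j = 0) ∧ (¬ j ≤ i → part x (i + 1) (j + 1) = part (half x) i j) ∧
    (part (x + x) 0 (j + 1) = part x 0 j + part x 0 j ∧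
      part (x + x + 1) 0 (j + 1) = part x 0 j + part x 0 j + 1) ∧
    pad x 0 = x ∧ (y ≠ 0 → pad x y = pad x (half y) + pad x (half y)) ∧
    (x ≤ y → x - y = 0) ∧ (y ≤ x → x + 1 - y = x - y + 1) := by
  have h : ∀ φ ∈ newAxioms IndPred, φ.Realize ![x, y, i, j] := fun φ hφ =>
    realize_basic (by simp [hφ]) _
  simpa [newAxioms, vx, vy, vz, vw] using h

theorem basic_further (x y u v : M) :
    len (smash x y) = len (smash x y) - 1 + 1 ∧
    (len x = len u + len v → smash x y = pad (smash u y) (half (smash v y))) ∧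
    smash 1 1 = (1 : M) + 1 ∧ msp x 0 = x ∧ msp x (u + 1) = half (msp x u) ∧
    (len x ≤ u → part x u v = 0) ∧ (y ≤ x → x - y + y = x) := by
  have h : ∀ φ ∈ furtherAxioms IndPred, φ.Realize ![x, y, u, v] := fun φ hφ =>
    realize_basic (by simp [hφ]) _
  simpa [furtherAxioms, vx, vy, vz, vw] using h

open Classical in
noncomputable instance : LinearOrder M where
  le_refl x := ((buss x x 0).2.2.2.2.2.1).elim id id
  le_trans x y z h h' := (buss x y z).2.2.2.2.2.2.2.1 ⟨h, h'⟩
  le_antisymm x y h h' := (buss x y 0).2.2.2.2.2.2.1 ⟨h, h'⟩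
  le_total x y := ((buss y x 0).2.2.2.2.2.1)
  toDecidableLE := Classical.decRel _

instance : AddCommMonoid M where
  add_assoc x y z := (buss x y z).2.2.2.2.2.2.2.2.2.2.2.2.2.2.2.2.2.2.2.2.2.1
  add_comm x y := (buss x y 0).2.2.2.2.2.2.2.2.2.2.2.2.2.2.2.2.2.2.1
  add_zero x := (buss x 0 0).2.2.2.2.2.2.2.2.2.2.2.2.2.2.2.2.2.2.2.1
  zero_add x := ((buss 0 x 0).2.2.2.2.2.2.2.2.2.2.2.2.2.2.2.2.2.2.1).trans
    (buss x 0 0).2.2.2.2.2.2.2.2.2.2.2.2.2.2.2.2.2.2.2.1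
  nsmul := nsmulRec

theorem add_le_add_iff (x y z : M) : x + y ≤ x + z ↔ y ≤ z :=
  (buss x y z).2.2.2.2.2.2.2.2.2.2.2.2.2.2.2.2.2.2.2.2.2.2.1

instance : IsOrderedCancelAddMonoid M where
  add_le_add_left x y h z := by
    rw [add_comm x, add_comm y]; exact (add_le_add_iff z x y).2 h
  le_of_add_le_add_left z x y h := (add_le_add_iff z x y).1 h

instance : CanonicallyOrderedAdd M where
  exists_add_of_le {x y} h := ⟨y - x, by rw [add_comm]; exact ((basic_further y x 0 0).2.2.2.2.2.2 h).symm⟩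
  le_add_self x y := by
    rw [add_comm]
    exact (buss x y 0).2.2.2.2.2.2.2.2.2.2.2.2.2.2.2.2.1
  le_self_add x y := (buss x y 0).2.2.2.2.2.2.2.2.2.2.2.2.2.2.2.2.1

instance : OrderedSub M where
  tsub_le_iff_right x y z := by
    rcases le_total y x with h | h
    · conv_rhs => rw [← (basic_further x y 0 0).2.2.2.2.2.2 h, add_comm, add_comm z, add_le_add_iff]
    · rw [(basic_new x y 0 0).2.2.2.2.2.1 h]
      exact ⟨fun _ => h.trans (by simp), fun _ => zero_le⟩

noncomputable instance : AddMonoidWithOne M where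
  natCast n := nsmulRec n 1
  natCast_zero := rfl
  natCast_succ _ := rfl

instance : SuccAddOrder M where
  succ x := x + 1
  le_succ x := le_self_add
  max_of_succ_le {x} h := by
    exact absurd ((buss x x 0).2.2.2.1.2 h).2 (by simp)
  succ_le_of_lt {x y} h := (buss x y 0).2.2.2.1.1 ⟨h.le, h.ne⟩
  succ_eq_add_one x := rfl

instance : NeZero (1 : M) := ⟨fun h => (buss (0 : M) 0 0).2.1 (by rw [h, add_zero])⟩
instance : NoMaxOrder M := ⟨fun x => ⟨x + 1, lt_of_le_of_ne le_self_add (buss x x x).2.1⟩⟩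


/-! ### Definability with parameters, and induction -/

/-- The function `f` on a model is the value of a term with parameters. -/
@[fun_prop]
def TDef {n : ℕ} (f : (Fin n → M) → M) : Prop :=
  ∃ t : LAID.Term (M ⊕ Fin n), ∀ v, t.realize (Sum.elim id v) = f v

/-- The predicate `P` on a model is definable by a `Σ₀ᵇ`-formula with parameters. -/
@[fun_prop]
def SDef {n : ℕ} (P : (Fin n → M) → Prop) : Prop :=
  ∃ φ : LAID.Formula (M ⊕ Fin n), IsSigma0 φ ∧ ∀ v, φ.Realize (Sum.elim id v) ↔ P v

section Closure

variable {n : ℕ}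

theorem TDef.const (a : M) : TDef fun _ : Fin n → M => a :=
  ⟨Term.var (Sum.inl a), fun _ => rfl⟩

theorem TDef.var (i : Fin n) : TDef fun v : Fin n → M => v i :=
  ⟨Term.var (Sum.inr i), fun _ => rfl⟩

variable {f g h : (Fin n → M) → M} {P Q : (Fin n → M) → Prop}

theorem TDef.add (hf : TDef f) (hg : TDef g) : TDef fun v => f v + g v :=
  let ⟨s, hs⟩ := hf; let ⟨t, ht⟩ := hg
  ⟨s + t, fun v => by simp [hs, ht]⟩

theorem TDef.sub (hf : TDef f) (hg : TDef g) : TDef fun v => f v - g v :=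
  let ⟨s, hs⟩ := hf; let ⟨t, ht⟩ := hg
  ⟨s - t, fun v => by simp [hs, ht]⟩

theorem TDef.half (hf : TDef f) : TDef fun v => half (f v) :=
  let ⟨s, hs⟩ := hf
  ⟨BoundedArith.half s, fun v => by simp [hs]⟩

theorem TDef.len (hf : TDef f) : TDef fun v => len (f v) :=
  let ⟨s, hs⟩ := hf
  ⟨BoundedArith.len s, fun v => by simp [hs]⟩

theorem TDef.smash (hf : TDef f) (hg : TDef g) : TDef fun v => smash (f v) (g v) :=
  let ⟨s, hs⟩ := hf; let ⟨t, ht⟩ := hg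
  ⟨BoundedArith.smash s t, fun v => by simp [hs, ht]⟩

theorem TDef.pad (hf : TDef f) (hg : TDef g) : TDef fun v => pad (f v) (g v) :=
  let ⟨s, hs⟩ := hf; let ⟨t, ht⟩ := hg
  ⟨BoundedArith.pad s t, fun v => by simp [hs, ht]⟩

theorem TDef.part (hf : TDef f) (hg : TDef g) (hh : TDef h) :
    TDef fun v => part (f v) (g v) (h v) :=
  let ⟨s, hs⟩ := hf; let ⟨t, ht⟩ := hg; let ⟨u, hu⟩ := hh
  ⟨BoundedArith.part s t u, fun v => by simp [hs, ht, hu]⟩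

theorem TDef.bit (hf : TDef f) (hg : TDef g) : TDef fun v => bit (f v) (g v) :=
  let ⟨s, hs⟩ := hf; let ⟨t, ht⟩ := hg
  ⟨BoundedArith.bit s t, fun v => by simp [hs, ht]⟩

theorem TDef.msp (hf : TDef f) (hg : TDef g) : TDef fun v => msp (f v) (g v) :=
  let ⟨s, hs⟩ := hf; let ⟨t, ht⟩ := hg
  ⟨BoundedArith.msp s t, fun v => by simp [hs, ht]⟩

theorem SDef.le (hf : TDef f) (hg : TDef g) : SDef fun v => f v ≤ g v :=
  let ⟨s, hs⟩ := hf; let ⟨t, ht⟩ := hg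
  ⟨BoundedArith.le s t, IsSigma0.le _ _, fun v => by simp [hs, ht]⟩

theorem SDef.eq (hf : TDef f) (hg : TDef g) : SDef fun v => f v = g v :=
  let ⟨s, hs⟩ := hf; let ⟨t, ht⟩ := hg
  ⟨BoundedArith.eqq s t, IsSigma0.eqq _ _, fun v => by simp [hs, ht]⟩

theorem SDef.lt (hf : TDef f) (hg : TDef g) : SDef fun v => f v < g v :=
  let ⟨s, hs⟩ := hf; let ⟨t, ht⟩ := hg
  ⟨BoundedArith.lt s t, IsSigma0.lt _ _, fun v => by simp [hs, ht]⟩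

theorem SDef.not (hP : SDef P) : SDef fun v => ¬ P v :=
  let ⟨φ, s, hs⟩ := hP
  ⟨∼φ, s.not, fun v => by simp [hs, Formula.realize_not]⟩

theorem SDef.and (hP : SDef P) (hQ : SDef Q) : SDef fun v => P v ∧ Q v :=
  let ⟨φ, s, hs⟩ := hP; let ⟨ψ, t, ht⟩ := hQ
  ⟨φ ⊓ ψ, s.and t, fun v => by simp [hs, ht]⟩

theorem SDef.or (hP : SDef P) (hQ : SDef Q) : SDef fun v => P v ∨ Q v :=
  let ⟨φ, s, hs⟩ := hP; let ⟨ψ, t, ht⟩ := hQ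
  ⟨φ ⊔ ψ, s.or t, fun v => by simp [hs, ht]⟩

theorem SDef.imp (hP : SDef P) (hQ : SDef Q) : SDef fun v => P v → Q v :=
  let ⟨φ, s, hs⟩ := hP; let ⟨ψ, t, ht⟩ := hQ
  ⟨φ ⟹ ψ, s.imp t, fun v => by simp [hs, ht]⟩

theorem SDef.iff (hP : SDef P) (hQ : SDef Q) : SDef fun v => (P v ↔ Q v) :=
  let ⟨φ, s, hs⟩ := hP; let ⟨ψ, t, ht⟩ := hQ
  ⟨φ ⇔ ψ, s.iff t, fun v => by simp [hs, ht]⟩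

theorem SDef.const (p : Prop) : SDef fun _ : Fin n → M => p := by
  by_cases h : p
  · exact ⟨⊤, IsSigma0.top, fun v => by simp [h, Formula.realize_top]⟩
  · exact ⟨⊥, IsSigma0.bot, fun v => by simp [h, Formula.realize_bot]⟩

/-- Sharply bounded universal quantification. The new variable is the variable `0`. -/
theorem SDef.all {P : (Fin n → M) → M → Prop} (hf : TDef f)
    (hP : SDef fun v : Fin (n + 1) → M => P (fun i => v i.succ) (v 0)) :
    SDef fun v => ∀ z, z ≤ Mod.len (f v) → P v z := by
  obtain ⟨s, hs⟩ := hf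
  obtain ⟨φ, t, ht⟩ := hP
  refine ⟨allLe s (φ.relabel (Sum.elim (fun a => some (Sum.inl a))
    (Fin.cases none fun i => some (Sum.inr i)))), (t.formula_relabel _).allLe, fun v => ?_⟩
  rw [realize_allLe, hs]
  refine forall_congr' fun z => imp_congr_right fun _ => ?_
  rw [Formula.realize_relabel]
  refine Iff.trans ?_ (ht (Fin.cons z v))
  refine iff_of_eq (congrArg _ (funext fun x => ?_))
  rcases x with x | x
  · rfl
  · refine Fin.cases ?_ (fun i => ?_) x <;> rfl

theorem SDef.ex {P : (Fin n → M) → M → Prop} (hf : TDef f)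
    (hP : SDef fun v : Fin (n + 1) → M => P (fun i => v i.succ) (v 0)) :
    SDef fun v => ∃ z, z ≤ Mod.len (f v) ∧ P v z := by
  have := (SDef.all (P := fun v z => ¬ P v z) hf hP.not).not
  simpa using this

theorem SDef.congr (hP : SDef P) (h : ∀ v, P v ↔ Q v) : SDef Q :=
  let ⟨φ, s, hs⟩ := hP
  ⟨φ, s, fun v => (hs v).trans (h v)⟩

theorem SDef.realize {m : ℕ} {φ : LAID.Formula (Fin m)} (hφ : IsSigma0 φ)
    {f : Fin m → (Fin n → M) → M} (hf : ∀ i, TDef (f i)) : SDef fun v => φ.Realize fun i => f i v := by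
  choose t ht using hf
  exact ⟨φ.subst t, hφ.subst t, fun v => by
    rw [realize_formula_subst]; simp only [ht]⟩

/-- Definable predicates are closed under the substitution of terms. -/
theorem SDef.comp {m : ℕ} {P : (Fin m → M) → Prop} (hP : SDef P) (f : Fin m → (Fin n → M) → M)
    (hf : ∀ i, TDef (f i)) : SDef fun v => P fun i => f i v := by
  obtain ⟨φ, s, hs⟩ := hP
  choose t ht using hf
  refine ⟨φ.subst (Sum.elim (fun a => Term.var (Sum.inl a)) t), s.subst _, fun v => ?_⟩
  rw [realize_formula_subst]
  refine Iff.trans ?_ (hs _)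
  refine iff_of_eq (congrArg _ (funext fun x => ?_))
  rcases x with x | x
  · rfl
  · exact ht x v

theorem SDef.comp₁ {P : M → Prop} (hP : SDef fun v : Fin 1 → M => P (v 0)) (hf : TDef f) :
    SDef fun v => P (f v) := hP.comp (fun _ => f) fun _ => hf

theorem SDef.comp₂ {P : M → M → Prop} (hP : SDef fun v : Fin 2 → M => P (v 0) (v 1))
    (hf : TDef f) (hg : TDef g) : SDef fun v => P (f v) (g v) :=
  hP.comp ![f, g] fun i => by fin_cases i <;> assumption

theorem SDef.comp₃ {P : M → M → M → Prop} (hP : SDef fun v : Fin 3 → M => P (v 0) (v 1) (v 2))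
    (hf : TDef f) (hg : TDef g) (hh : TDef h) : SDef fun v => P (f v) (g v) (h v) :=
  hP.comp ![f, g, h] fun i => by fin_cases i <;> assumption

theorem SDef.forall_finite {ι : Type} [Finite ι] {P : ι → (Fin n → M) → Prop}
    (h : ∀ i, SDef (P i)) : SDef fun v => ∀ i, P i v := by
  cases nonempty_fintype ι
  have : ∀ s : Finset ι, SDef fun v => ∀ i ∈ s, P i v := by
    classical
    intro s
    induction s using Finset.induction_on with
    | empty => exact (SDef.const True).congr fun v => by simp
    | insert a s _ ih => exact ((h a).and ih).congr fun v => by simp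
  exact (this Finset.univ).congr fun v => by simp

theorem SDef.exists_finite {ι : Type} [Finite ι] {P : ι → (Fin n → M) → Prop}
    (h : ∀ i, SDef (P i)) : SDef fun v => ∃ i, P i v :=
  (SDef.forall_finite fun i => (h i).not).not.congr fun v => by simp

attribute [fun_prop] TDef.const TDef.var TDef.add TDef.sub TDef.half TDef.len TDef.smash TDef.pad
  TDef.part TDef.bit TDef.msp SDef.le SDef.eq SDef.lt SDef.not SDef.and SDef.or SDef.imp SDef.iff
  SDef.const SDef.all SDef.ex

end Closure

/-- In a formula with parameters only finitely many parameters occur. -/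
theorem SDef.exists_params {P : M → Prop} (hP : SDef fun v : Fin 1 → M => P (v 0)) :
    ∃ (m : ℕ) (c : Fin m → M) (φ : LAID.Formula (Fin (m + 1))), IsSigma0 φ ∧
      ∀ z, φ.Realize (Fin.cons z c : Fin (m + 1) → M) ↔ P z := by
  classical
  obtain ⟨φ, hφ, h⟩ := hP
  let s : Finset M := φ.freeVarFinset.preimage Sum.inl Sum.inl_injective.injOn
  let e := s.equivFin
  let g : M ⊕ Fin 1 → Fin (s.card + 1) :=
    Sum.elim (fun a => if h : a ∈ s then (e ⟨a, h⟩).succ else 0) fun _ => 0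
  refine ⟨s.card, fun i => (e.symm i : M), Formula.relabel g φ, hφ.formula_relabel g, fun z => ?_⟩
  rw [Formula.realize_relabel]
  refine Iff.trans ?_ (h fun _ => z)
  unfold Formula.Realize
  set w := (Fin.cons z fun i => (e.symm i : M) : Fin (s.card + 1) → M) ∘ g
  rw [← BoundedFormula.realize_restrictFreeVar (f := fun a : φ.freeVarFinset => (a : M ⊕ Fin 1))
      (v := w) w fun _ => rfl,
    ← BoundedFormula.realize_restrictFreeVar (f := fun a : φ.freeVarFinset => (a : M ⊕ Fin 1))
      (v := w) (Sum.elim id fun _ => z)]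
  rintro ⟨a | i, ha⟩
  · have : a ∈ s := by simpa [s] using ha
    simp [w, g, this]
  · simp [w, g]

theorem lind_length {P : M → Prop} (hP : SDef fun v : Fin 1 → M => P (v 0)) (x : M) (h0 : P 0)
    (hs : ∀ y, y < len x → P y → P (y + 1)) : P (len x) := by
  obtain ⟨m, c, φ, hφ, h⟩ := hP.exists_params
  have := (realize_closure (lind φ)).1 ((AIDModel.models (M := M)).realize_of_mem _
    (Or.inl (Or.inl (Or.inr ⟨m, φ, hφ, rfl⟩)))) (Fin.cons x c)
  have e : ∀ (γ : Type) (t : LAID.Term γ) (f : Fin m → LAID.Term γ) (v : γ → M),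
      (fun a => ((Fin.cons t f : Fin (m + 1) → LAID.Term γ) a).realize v) =
        (Fin.cons (t.realize v) fun i => (f i).realize v : Fin (m + 1) → M) := by
    intro γ t f v
    funext a
    refine Fin.cases ?_ (fun i => ?_) a <;> simp
  simp only [lind, realize_imp', realize_and, realize_formula_subst, realize_allV, e, realize_lt',
    realize_up, realize_len, realize_zero, realize_add, realize_one, Term.realize_var,
    Fin.cons_zero, Fin.cons_succ, Option.elim, h, not_le] at this
  exact this ⟨h0, hs⟩

/-- Induction up to a length for `Σ₀ᵇ`-definable predicates. -/
theorem length_induction {P : M → Prop} (hP : SDef fun v : Fin 1 → M => P (v 0)) (x : M) (h0 : P 0)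
    (hs : ∀ y, y < len x → P y → P (y + 1)) (y : M) (hy : y ≤ len x) : P y := by
  have h := lind_length (P := fun i => (i ≤ y ∧ P i) ∨ (y < i ∧ P y)) ?_ x (Or.inl ⟨zero_le, h0⟩) ?_
  · rcases h with ⟨h, h'⟩ | ⟨_, h⟩
    · rwa [le_antisymm hy h]
    · exact h
  · exact (SDef.and (by fun_prop) hP).or (by fun_prop)
  · rintro i hi (⟨h, h'⟩ | ⟨h, h'⟩)
    · rcases eq_or_lt_of_le h with rfl | h
      · exact Or.inr ⟨Order.lt_add_one_iff.2 le_rfl, h'⟩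
      · exact Or.inl ⟨Order.add_one_le_iff.2 h, hs i hi h'⟩
    · exact Or.inr ⟨h.trans (Order.lt_add_one_iff.2 le_rfl), h'⟩



/-! ### Halves and lengths -/

theorem lt_iff (x y : M) : x < y ↔ x + 1 ≤ y := Order.add_one_le_iff.symm

theorem ne_zero_iff (x : M) : x ≠ 0 ↔ 1 ≤ x := by
  rw [← pos_iff_ne_zero, lt_iff, zero_add]

theorem one_ne_zero' : (1 : M) ≠ 0 := NeZero.ne 1

theorem add_one_ne_zero' (x : M) : x + 1 ≠ 0 := by
  rw [ne_zero_iff]; exact le_add_self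

theorem half_eq_iff (x y : M) : x = half y ↔ x + x = y ∨ x + x + 1 = y :=
  (buss x y 0).2.2.2.2.2.2.2.2.2.2.2.2.2.2.2.2.2.2.2.2.2.2.2.2

@[simp] theorem half_double (x : M) : half (x + x) = x := ((half_eq_iff _ _).2 (Or.inl rfl)).symm
@[simp] theorem half_double_add_one (x : M) : half (x + x + 1) = x :=
  ((half_eq_iff _ _).2 (Or.inr rfl)).symm

theorem half_cases (x : M) : x = half x + half x ∨ x = half x + half x + 1 := by
  rcases (half_eq_iff (half x) x).1 rfl with h | h
  · exact Or.inl h.symm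
  · exact Or.inr h.symm

@[simp] theorem half_zero : half (0 : M) = 0 := by
  simpa using half_double (0 : M)
@[simp] theorem half_one : half (1 : M) = 0 := by
  simpa using half_double_add_one (0 : M)

theorem zero_lt_one' : (0 : M) < 1 := by rw [lt_iff, zero_add]

theorem half_le (x : M) : half x ≤ x := by
  have := zero_le (a := half x)
  have := zero_lt_one' (M := M)
  rcases half_cases x with h | h <;> grind

@[simp] theorem len_zero : len (0 : M) = 0 := (buss (0 : M) 0 0).2.2.2.2.2.2.2.2.1
@[simp] theorem len_one : len (1 : M) = 1 := (buss (0 : M) 0 0).2.2.2.2.2.2.2.2.2.2.1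

theorem len_mono {x y : M} (h : x ≤ y) : len x ≤ len y :=
  (buss x y 0).2.2.2.2.2.2.2.2.2.2.2.1 h

theorem len_half {x : M} (h : x ≠ 0) : len x = len (half x) + 1 :=
  (buss x 0 0).2.2.2.2.2.2.2.2.2.2.2.2.2.2.2.2.2.2.2.2.2.2.2.1 h

theorem len_double {x : M} (h : x ≠ 0) : len (x + x) = len x + 1 :=
  ((buss x 0 0).2.2.2.2.2.2.2.2.2.1 h).1

@[simp] theorem len_double_add_one (x : M) : len (x + x + 1) = len x + 1 := by
  rw [len_half (add_one_ne_zero' _), half_double_add_one]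

@[simp] theorem len_eq_zero {x : M} : len x = 0 ↔ x = 0 := by
  refine ⟨fun h => by_contra fun h' => ?_, fun h => by simp [h]⟩
  rw [len_half h'] at h
  exact add_one_ne_zero' _ h

theorem eq_one_of_len_eq_one {x : M} (h : len x = 1) : x = 1 := by
  have hx : x ≠ 0 := by rintro rfl; rw [len_zero] at h; exact one_ne_zero' h.symm
  rw [len_half hx] at h
  have : half x = 0 := by
    rw [← len_eq_zero]
    have := zero_le (a := len (half x))
    grind
  rcases half_cases x with h | h <;> rw [this] at h
  · simp at h; exact absurd h hx
  · simpa using h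

/-! ### Most significant parts and induction on notation -/

@[simp] theorem msp_zero (x : M) : msp x 0 = x := (basic_further x 0 0 0).2.2.2.1
theorem msp_succ (x i : M) : msp x (i + 1) = half (msp x i) := (basic_further x 0 i 0).2.2.2.2.1

theorem part_of_le (x : M) {i j : M} (h : j ≤ i) : part x i j = 0 := (basic_new x 0 i j).1 h
theorem part_of_len_le {x i : M} (j : M) (h : len x ≤ i) : part x i j = 0 :=
  (basic_further x 0 i j).2.2.2.2.2.1 h
theorem part_succ_succ (x : M) {i j : M} (h : i < j) :
    part x (i + 1) (j + 1) = part (half x) i j := (basic_new x 0 i j).2.1 (not_le.2 h)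
theorem part_double (x j : M) : part (x + x) 0 (j + 1) = part x 0 j + part x 0 j :=
  (basic_new x 0 0 j).2.2.1.1
theorem part_double_add_one (x j : M) :
    part (x + x + 1) 0 (j + 1) = part x 0 j + part x 0 j + 1 := (basic_new x 0 0 j).2.2.1.2

theorem msp_of_len_le {x i : M} (h : len x ≤ i) : msp x i = 0 := part_of_len_le _ h

@[simp] theorem zero_msp (i : M) : msp 0 i = 0 := msp_of_len_le (by simp)

theorem sub_add_one_sub {x y : M} (h : y < x) : x - y = x - (y + 1) + 1 := by
  have h1 := tsub_add_cancel_of_le ((lt_iff _ _).1 h)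
  have h2 := tsub_add_cancel_of_le h.le
  grind

/-- Induction on notation, for `Σ₀ᵇ`-definable predicates. -/
theorem notation_induction {P : M → Prop} (hP : SDef fun v : Fin 1 → M => P (v 0)) (h0 : P 0)
    (hs : ∀ y, y ≠ 0 → P (half y) → P y) (x : M) : P x := by
  have := length_induction (P := fun i => P (msp x (len x - i))) (hP.comp₁ (by fun_prop)) x ?_ ?_
    (len x) le_rfl
  · simpa using this
  · simpa [msp_of_len_le] using h0
  · intro i hi ih
    rw [sub_add_one_sub hi, msp_succ] at ih
    by_cases h : msp x (len x - (i + 1)) = 0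
    · rwa [h]
    · exact hs _ h ih

theorem len_msp (x i : M) : len (msp x i) = len x - i := by
  rcases le_total (len x) i with h | h
  · rw [msp_of_len_le h, len_zero, tsub_eq_zero_of_le h]
  · refine length_induction (P := fun i => len (msp x i) = len x - i) (by fun_prop) x ?_ ?_ i h
    · simp
    · intro i hi ih
      have h1 := sub_add_one_sub hi
      rw [h1] at ih
      have : msp x i ≠ 0 := by
        rw [ne_eq, ← len_eq_zero, ih]; exact add_one_ne_zero' _
      rw [len_half this] at ih
      rw [msp_succ]
      grind

theorem half_msp (x i : M) : msp (half x) i = half (msp x i) := by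
  by_cases hx : x = 0
  · simp [hx]
  rcases le_total (len x) i with h | h
  · rw [msp_of_len_le h, msp_of_len_le ((len_mono (half_le x)).trans h), half_zero]
  · refine length_induction (P := fun i => msp (half x) i = half (msp x i)) (by fun_prop) x ?_ ?_ i h
    · simp
    · intro i hi ih
      rw [msp_succ, ih, msp_succ]

theorem len_le_self (x : M) : len x ≤ x := by
  refine notation_induction (P := fun x => len x ≤ x) (by fun_prop) (by simp) ?_ x
  intro y hy ih
  rw [len_half hy]
  have := zero_le (a := half y)
  by_cases h : half y = 0
  · rw [h, len_zero, zero_add]; exact (ne_zero_iff y).1 hy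
  · rw [← ne_eq] at h; rw [ne_zero_iff] at h
    rcases half_cases y with h' | h' <;> grind


/-! ### Multiplication by powers of two -/

@[simp] theorem pad_zero (x : M) : pad x 0 = x := (basic_new x 0 0 0).2.2.2.1

theorem pad_half (x : M) {y : M} (h : y ≠ 0) : pad x y = pad x (half y) + pad x (half y) :=
  (basic_new x y 0 0).2.2.2.2.1 h

theorem pad_congr (x : M) {y z : M} (h : len y = len z) : pad x y = pad x z := by
  have := length_induction (P := fun i => pad x (msp y (len y - i)) = pad x (msp z (len z - i)))
    (by fun_prop) y ?_ ?_ (len y) le_rfl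
  · conv_rhs at this => rw [h]
    simpa using this
  · simp [msp_of_len_le]
  · intro i hi ih
    have hne : ∀ u : M, i < len u → msp u (len u - (i + 1)) ≠ 0 := by
      intro u hu h0
      have := len_msp u (len u - (i + 1))
      rw [h0, len_zero, tsub_tsub_cancel_of_le ((lt_iff _ _).1 hu)] at this
      exact add_one_ne_zero' _ this.symm
    rw [pad_half _ (hne y hi), pad_half _ (hne z (h ▸ hi)), ← msp_succ, ← msp_succ,
      ← sub_add_one_sub hi, ← sub_add_one_sub (h ▸ hi), ih]

theorem pad_succ (x : M) {y z : M} (h : len z = len y + 1) : pad x z = pad x y + pad x y := by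
  have hz : z ≠ 0 := by
    rintro rfl
    rw [len_zero] at h
    exact add_one_ne_zero' _ h.symm
  rw [len_half hz] at h
  rw [pad_half x hz, pad_congr x (add_right_cancel h)]

@[simp] theorem pad_one (x : M) : pad x 1 = x + x := by
  rw [pad_succ x (y := 0) (by simp), pad_zero]

theorem add_pad (x y z : M) : pad (x + y) z = pad x z + pad y z := by
  refine notation_induction (P := fun z => pad (x + y) z = pad x z + pad y z) (by fun_prop)
    (by simp) (fun z hz ih => ?_) z
  rw [pad_half _ hz, pad_half _ hz, pad_half _ hz, ih]
  abel

@[simp] theorem zero_pad (z : M) : pad 0 z = 0 := by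
  have := add_pad (0 : M) 0 z
  rw [add_zero] at this
  exact (add_eq_left.1 this.symm)

theorem pad_mono_left {x y : M} (z : M) (h : x ≤ y) : pad x z ≤ pad y z := by
  obtain ⟨u, rfl⟩ := exists_add_of_le h
  rw [add_pad]
  exact le_self_add

theorem le_pad (x y : M) : x ≤ pad x y := by
  refine notation_induction (P := fun y => x ≤ pad x y) (by fun_prop) (by simp) (fun z hz ih => ?_) y
  rw [pad_half _ hz]
  exact ih.trans le_self_add

theorem len_pad {x : M} (h : x ≠ 0) (y : M) : len (pad x y) = len x + len y := by
  refine notation_induction (P := fun y => len (pad x y) = len x + len y) (by fun_prop)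
    (by simp) (fun z hz ih => ?_) y
  have : pad x (half z) ≠ 0 := fun h' => h (le_zero_iff.1 (h' ▸ le_pad x (half z)))
  rw [pad_half _ hz, len_double this, ih, len_half hz, add_assoc]

theorem pad_pad (x y z w : M) (h : len w = len y + len z) : pad (pad x y) z = pad x w := by
  have := length_induction
    (P := fun i => pad (pad x y) (msp z (len z - i)) = pad x (msp w (len z - i)))
    (by fun_prop) z ?_ ?_ (len z) le_rfl
  · simpa using this
  · rw [tsub_zero, msp_of_len_le le_rfl, pad_zero]
    refine pad_congr _ ?_
    rw [len_msp, h, add_tsub_cancel_right]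
  · intro i hi ih
    rw [sub_add_one_sub hi] at ih
    have h1 : len (msp w (len z - (i + 1))) = len y + (i + 1) := by
      rw [len_msp, h, add_tsub_assoc_of_le tsub_le_self,
        tsub_tsub_cancel_of_le ((lt_iff _ _).1 hi)]
    have h2 : len (msp z (len z - (i + 1))) = i + 1 := by
      rw [len_msp, tsub_tsub_cancel_of_le ((lt_iff _ _).1 hi)]
    rw [pad_half (y := msp z (len z - (i + 1))), pad_half (y := msp w (len z - (i + 1))),
      ← msp_succ, ← msp_succ, ih]
    · rw [ne_eq, ← len_eq_zero, h1, ← add_assoc]; exact add_one_ne_zero' _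
    · rw [ne_eq, ← len_eq_zero, h2]; exact add_one_ne_zero' _

theorem lt_pad_one (x : M) : x < pad 1 x := by
  refine notation_induction (P := fun x => x < pad 1 x) (by fun_prop)
    (by simp) (fun z hz ih => ?_) x
  rw [pad_half _ hz]
  rw [lt_iff] at ih ⊢
  have := zero_lt_one' (M := M)
  rcases half_cases z with h | h <;> grind

theorem pad_one_le {x : M} (h : x ≠ 0) : pad 1 x ≤ x + x := by
  refine notation_induction (P := fun x => x ≠ (0 : M) → pad 1 x ≤ x + x) (by fun_prop)
    (fun h => absurd rfl h) (fun z hz ih _ => ?_) x h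
  rw [pad_half _ hz]
  by_cases h0 : half z = (0 : M)
  · rw [h0, pad_zero]
    rw [ne_zero_iff] at hz
    exact add_le_add hz hz
  · have := ih h0
    rcases half_cases z with h | h
    · grind
    · have := zero_lt_one' (M := M)
      grind

theorem one_le_pad_one (y : M) : 1 ≤ pad 1 y := le_pad 1 y

theorem pad_mono_right (x : M) {y z : M} (h : len y ≤ len z) : pad x y ≤ pad x z := by
  have h1 : len (msp z (len z - len y)) = len y := by
    rw [len_msp, tsub_tsub_cancel_of_le h]
  rw [← pad_congr x h1]
  refine length_induction (P := fun i => pad x (msp z i) ≤ pad x z) (by fun_prop) z (by simp) ?_ _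
    tsub_le_self
  intro i hi ih
  refine le_trans ?_ ih
  rw [msp_succ]
  by_cases h : msp z i = 0
  · simp [h]
  · rw [pad_half x h]; exact le_self_add

theorem len_le_iff (x y : M) : len x ≤ len y ↔ x < pad 1 y := by
  refine ⟨fun h => (lt_pad_one x).trans_le (pad_mono_right 1 h), fun h => ?_⟩
  by_contra h'
  rw [not_le, lt_iff] at h'
  have hx : x ≠ 0 := by
    rintro rfl
    rw [len_zero] at h'
    exact add_one_ne_zero' _ (le_zero_iff.1 h')
  have h1 := pad_one_le hx
  have h2 : pad 1 y + pad 1 y ≤ pad 1 x := by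
    rw [← pad_succ 1 (z := pad 1 y) (y := y)
      (by rw [len_pad one_ne_zero', len_one, add_comm])]
    exact pad_mono_right 1 (by rwa [len_pad one_ne_zero', len_one, add_comm])
  rw [lt_iff] at h
  have := zero_lt_one' (M := M)
  grind

/-! ### Binary digits -/

theorem half_add_bit (x : M) : x = half x + half x + bit 0 x := by
  unfold bit
  rcases half_cases x with h | h
  · conv_rhs => rw [h]
    rw [part_double, part_of_le _ le_rfl]
    simpa using h
  · conv_rhs => rw [h]
    rw [part_double_add_one, part_of_le _ le_rfl]
    simpa using h

@[simp] theorem bit_zero_double (x : M) : bit 0 (x + x) = 0 := by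
  unfold bit; rw [part_double, part_of_le _ le_rfl, add_zero]
@[simp] theorem bit_zero_double_add_one (x : M) : bit 0 (x + x + 1) = 1 := by
  unfold bit; rw [part_double_add_one, part_of_le _ le_rfl]; simp

theorem bit_zero_cases (x : M) : bit 0 x = 0 ∨ bit 0 x = 1 := by
  rcases half_cases x with h | h
  · left; rw [h]; simp
  · right; rw [h]; simp

theorem bit_add_one (i x : M) : bit (i + 1) x = bit i (half x) :=
  part_succ_succ x (Order.lt_add_one_iff.2 le_rfl)

theorem bit_of_len_le {i x : M} (h : len x ≤ i) : bit i x = 0 := part_of_len_le _ h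

@[simp] theorem bit_zero_right (i : M) : bit i 0 = 0 := bit_of_len_le (by simp)

theorem half_msp_sub {x n i : M} (h : i < n) : half (msp x (n - (i + 1))) = msp x (n - i) := by
  rw [← msp_succ, ← sub_add_one_sub h]

theorem bit_eq (i x : M) : bit i x = bit 0 (msp x i) := by
  rcases le_total (len x) i with h | h
  · rw [bit_of_len_le h, msp_of_len_le h, bit_zero_right]
  · have := length_induction (P := fun j => j ≤ i → bit j (msp x (i - j)) = bit 0 (msp x i))
      (by fun_prop) x ?_ ?_ i h le_rfl
    · simpa using this
    · simp
    · intro j _ ih hj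
      rw [bit_add_one, half_msp_sub ((lt_iff _ _).2 hj)]
      exact ih (le_self_add.trans hj)

theorem bit_cases (i x : M) : bit i x = 0 ∨ bit i x = 1 := by
  rw [bit_eq]; exact bit_zero_cases _

theorem bit_len_sub_one {x : M} (h : x ≠ 0) : bit (len x - 1) x = 1 := by
  have : len (msp x (len x - 1)) = 1 := by
    rw [len_msp, tsub_tsub_cancel_of_le]
    rw [← ne_zero_iff, ne_eq, len_eq_zero]
    exact h
  rw [bit_eq, eq_one_of_len_eq_one this]
  simpa using bit_zero_double_add_one (0 : M)

theorem eq_of_bit_of_len {x y : M} (h : len x = len y) (h' : ∀ i < len x, bit i x = bit i y) :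
    x = y := by
  have := (realize_closure (bitExt IndPred)).1 ((AIDModel.models (M := M)).realize_of_mem _
    (Or.inl (Or.inr rfl))) ![x, y]
  simp only [bitExt, realize_imp', realize_and, realize_eqq, realize_allV, realize_lt', realize_bit,
    realize_up, realize_len, Term.realize_var, Option.elim, Matrix.cons_val_zero,
    Matrix.cons_val_one, not_le] at this
  exact this ⟨h, h'⟩

/-- Numbers with the same binary digits are equal. -/
theorem eq_of_bit {x y : M} (h : ∀ i, i < len x ∨ i < len y → (bit i x = 1 ↔ bit i y = 1)) :
    x = y := by
  have h' : ∀ i, bit i x = bit i y := by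
    intro i
    by_cases hi : i < len x ∨ i < len y
    · have := h i hi
      rcases bit_cases i x with h1 | h1 <;> rcases bit_cases i y with h2 | h2 <;>
        simp_all
    · push Not at hi
      rw [bit_of_len_le hi.1, bit_of_len_le hi.2]
  have key : ∀ u v : M, (∀ i, bit i u = bit i v) → len u ≤ len v := by
    intro u v huv
    by_contra hlt
    have hu : u ≠ 0 := by
      rintro rfl
      exact hlt (by simp)
    have h1 : len v ≤ len u - 1 := by
      rw [not_le, lt_iff] at hlt
      exact le_tsub_of_add_le_right hlt
    have := bit_len_sub_one hu
    rw [huv, bit_of_len_le h1] at this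
    exact one_ne_zero' this.symm
  exact eq_of_bit_of_len (le_antisymm (key x y h') (key y x fun i => (h' i).symm)) fun i _ => h' i

/-! ### Division by powers of two -/

theorem bit_lt (x : M) : bit 0 x ≤ 1 := by
  rcases bit_zero_cases x with h | h <;> rw [h]
  exact zero_le

/-- The remainder of `x` modulo `2 ^ k` is `x[0, k)`. -/
theorem part_zero_add_one (x k : M) :
    part x 0 (k + 1) = part (half x) 0 k + part (half x) 0 k + bit 0 x := by
  rcases half_cases x with h | h
  · conv_lhs => rw [h]
    conv_rhs => rw [h]
    rw [part_double]; simp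
  · conv_lhs => rw [h]
    conv_rhs => rw [h]
    rw [part_double_add_one]; simp

theorem pad_add_part (x y : M) :
    pad (msp x (len y)) y + part x 0 (len y) = x ∧ part x 0 (len y) < pad 1 y := by
  have := length_induction (P := fun i =>
    pad (msp x (len y)) (msp y (len y - i)) + part (msp x (len y - i)) 0 i = msp x (len y - i) ∧
      part (msp x (len y - i)) 0 i < pad 1 (msp y (len y - i))) (by fun_prop) y ?_ ?_ (len y) le_rfl
  · simpa using this
  · rw [tsub_zero, msp_of_len_le (x := y) le_rfl, pad_zero, part_of_le _ le_rfl, pad_zero]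
    exact ⟨add_zero _, zero_lt_one'⟩
  · intro i hi ih
    have h1 : msp y (len y - (i + 1)) ≠ 0 := by
      rw [ne_eq, ← len_eq_zero, len_msp, tsub_tsub_cancel_of_le ((lt_iff _ _).1 hi)]
      exact add_one_ne_zero' _
    rw [pad_half _ h1, pad_half _ h1, half_msp_sub hi, part_zero_add_one, half_msp_sub hi]
    have h2 := half_add_bit (msp x (len y - (i + 1)))
    rw [half_msp_sub hi] at h2
    have h3 := bit_lt (msp x (len y - (i + 1)))
    obtain ⟨ih1, ih2⟩ := ih
    rw [lt_iff] at ih2 ⊢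
    constructor
    · grind
    · grind

theorem pad_add_unique {a b a' b' y : M} (h : pad a y + b = pad a' y + b') (hb : b < pad 1 y)
    (hb' : b' < pad 1 y) : a = a' ∧ b = b' := by
  have key : ∀ a b a' b' : M, pad a y + b = pad a' y + b' → b < pad 1 y → a' ≤ a := by
    intro a b a' b' h hb
    by_contra hlt
    rw [not_le, lt_iff] at hlt
    have := pad_mono_left y hlt
    rw [add_pad] at this
    have := zero_le (a := b')
    grind
  have : a = a' := le_antisymm (key _ _ _ _ h.symm hb') (key _ _ _ _ h hb)
  subst this
  exact ⟨rfl, add_left_cancel h⟩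

theorem msp_pad_add {a b y : M} (hb : b < pad 1 y) :
    msp (pad a y + b) (len y) = a ∧ part (pad a y + b) 0 (len y) = b :=
  have h := pad_add_part (pad a y + b) y
  pad_add_unique h.1 h.2 hb


/-! ### Concatenation of numbers -/

theorem half_double_add (u b : M) : half (u + u + b) = u + half b := by
  symm
  rw [half_eq_iff]
  rcases half_cases b with h | h
  · left; grind
  · right; grind

theorem bit_zero_double_add (u b : M) : bit 0 (u + u + b) = bit 0 b := by
  rcases half_cases b with h | h
  · conv_lhs => rw [h, show u + u + (half b + half b) = (u + half b) + (u + half b) by abel]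
    conv_rhs => rw [h]
    simp
  · conv_lhs => rw [h, show u + u + (half b + half b + 1) = (u + half b) + (u + half b) + 1 by abel]
    conv_rhs => rw [h]
    simp

theorem msp_ne_zero {y i : M} (h : i < len y) : msp y i ≠ 0 := by
  rw [ne_eq, ← len_eq_zero, len_msp, tsub_eq_zero_iff_le, not_le]
  exact h

/-- Shifting a sum of which one term is divisible by a power of two. -/
theorem msp_pad_add_of_le (a b : M) {y i : M} (h : i ≤ len y) :
    msp (pad a y + b) i = pad a (msp y i) + msp b i := by
  refine length_induction (P := fun i => msp (pad a y + b) i = pad a (msp y i) + msp b i)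
    (by fun_prop) y (by simp) ?_ i h
  intro i hi ih
  rw [msp_succ, ih, pad_half _ (msp_ne_zero hi), half_double_add, msp_succ, msp_succ]

theorem bit_pad_add_of_lt (a b : M) {y i : M} (h : i < len y) :
    bit i (pad a y + b) = bit i b := by
  rw [bit_eq, msp_pad_add_of_le a b h.le, pad_half _ (msp_ne_zero h), bit_zero_double_add, ← bit_eq]

theorem msp_msp (x i j : M) : msp (msp x i) j = msp x (i + j) := by
  rcases le_total (len x) j with h | h
  · rw [msp_of_len_le, msp_of_len_le]
    · exact h.trans le_add_self
    · rw [len_msp]; exact tsub_le_self.trans h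
  · refine length_induction (P := fun j => msp (msp x i) j = msp x (i + j)) (by fun_prop) x
      (by simp) ?_ j h
    intro j _ ih
    rw [msp_succ, ih, ← add_assoc, msp_succ]

theorem bit_msp (x i j : M) : bit j (msp x i) = bit (i + j) x := by
  rw [bit_eq, msp_msp, ← bit_eq]

theorem bit_add_pad_add {a b y : M} (hb : b < pad 1 y) (i : M) :
    bit (len y + i) (pad a y + b) = bit i a := by
  rw [← bit_msp, (msp_pad_add hb).1]

theorem exists_len_eq {k x : M} (h : k ≤ len x) : ∃ y, len y = k :=
  ⟨msp x (len x - k), by rw [len_msp, tsub_tsub_cancel_of_le h]⟩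

theorem bit_part_of_lt {i k y : M} (x : M) (hk : k ≤ len y) (h : i < k) :
    bit i (part x 0 k) = bit i x := by
  obtain ⟨z, rfl⟩ := exists_len_eq hk
  conv_rhs => rw [← (pad_add_part x z).1]
  rw [bit_pad_add_of_lt _ _ h]

theorem len_part_le {k y : M} (x : M) (hk : k ≤ len y) : len (part x 0 k) ≤ k := by
  obtain ⟨z, rfl⟩ := exists_len_eq hk
  rw [len_le_iff]
  exact (pad_add_part x z).2

theorem part_zero_eq_self {x k y : M} (hk : k ≤ len y) (h : len x ≤ k) : part x 0 k = x := by
  refine eq_of_bit fun i hi => ?_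
  have hi : i < k := by
    rcases hi with hi | hi
    · exact hi.trans_le (len_part_le x hk)
    · exact hi.trans_le h
  rw [bit_part_of_lt x hk hi]

/-- The remainder modulo `2 ^ k` does not depend on multiples of higher powers of two. -/
theorem part_pad_add {y k : M} (a b : M) (h : k ≤ len y) :
    part (pad a y + b) 0 k = part b 0 k := by
  refine eq_of_bit fun i hi => ?_
  have hi : i < k := by
    rcases hi with hi | hi
    · exact hi.trans_le (len_part_le _ h)
    · exact hi.trans_le (len_part_le _ h)
  rw [bit_part_of_lt _ h hi, bit_part_of_lt _ h hi, bit_pad_add_of_lt _ _ (hi.trans_le h)]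

/-! ### Products of lengths -/

theorem smash_comm (x y : M) : smash x y = smash y x :=
  (buss x y 0).2.2.2.2.2.2.2.2.2.2.2.2.2.2.1

theorem smash_ne_zero (x y : M) : smash x y ≠ 0 := by
  rw [ne_eq, ← len_eq_zero, (basic_further x y 0 0).1]
  exact add_one_ne_zero' _

@[simp] theorem zero_smash (y : M) : smash 0 y = 1 := (buss (0 : M) y 0).2.2.2.2.2.2.2.2.2.2.2.2.1

/-- The product `|x| * |y|` of lengths. -/
def lmul (x y : M) : M := len (half (smash x y))

theorem lmul_comm (x y : M) : lmul x y = lmul y x := by unfold lmul; rw [smash_comm]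

@[simp] theorem zero_lmul (y : M) : lmul 0 y = 0 := by simp [lmul]

theorem lmul_add {x u v : M} (y : M) (h : len x = len u + len v) :
    lmul x y = lmul u y + lmul v y := by
  have h1 := (basic_further x y u v).2.1 h
  have h2 := len_pad (smash_ne_zero u y) (half (smash v y))
  rw [← h1, len_half (smash_ne_zero x y), len_half (smash_ne_zero u y)] at h2
  unfold lmul
  grind

theorem lmul_congr {x x' : M} (y : M) (h : len x = len x') : lmul x y = lmul x' y := by
  have := lmul_add (x := x) (u := x') (v := 0) y (by simpa using h)
  simpa using this

theorem one_smash (y : M) (hy : y ≠ 0) : smash 1 y = smash 1 (half y) + smash 1 (half y) := by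
  rcases half_cases y with h | h
  · have h0 : half y ≠ 0 := fun h0 => hy (by rw [h, h0, add_zero])
    have := ((buss (half y) 0 0).2.2.2.2.2.2.2.2.2.2.2.2.2.1 h0).1
    rwa [← h] at this
  · by_cases h0 : half y = 0
    · rw [h0, zero_add, zero_add] at h
      have h1 : smash (1 : M) 0 = 1 := by rw [smash_comm, zero_smash]
      rw [h0, h1, h]
      exact (basic_further (0 : M) 0 0 0).2.2.1
    · have := ((buss (half y) 0 0).2.2.2.2.2.2.2.2.2.2.2.2.2.1 h0).2
      rwa [← h] at this

@[simp] theorem one_lmul (y : M) : lmul 1 y = len y := by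
  have : len (smash 1 y) = len y + 1 := by
    refine notation_induction (P := fun y => len (smash (1 : M) y) = len y + 1) (by fun_prop)
      (by rw [smash_comm]; simp) (fun y hy ih => ?_) y
    rw [one_smash y hy, len_double (smash_ne_zero _ _), ih, len_half hy]
  unfold lmul
  rw [len_half (smash_ne_zero _ _)] at this
  exact add_right_cancel this

theorem lmul_succ {x x' : M} (y : M) (h : len x' = len x + 1) : lmul x' y = lmul x y + len y := by
  rw [lmul_add (u := x) (v := 1) y (by simpa using h), one_lmul]

theorem TDef.lmul {n : ℕ} {f g : (Fin n → M) → M} (hf : TDef f) (hg : TDef g) :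
    TDef fun v => lmul (f v) (g v) := by
  unfold Mod.lmul
  fun_prop

attribute [fun_prop] TDef.lmul

theorem pad_len_le {u v : M} (h0 : len v ≠ 0) :
    Mod.pad (len u) (len v) ≤ lmul v u + lmul v u := by
  -- The product of `len u` and `c` for `c ≤ len v`.
  set m : M → M := fun c => lmul (msp v (len v - c)) u with hm
  have hadd : ∀ c c', c + c' ≤ len v → m (c + c') = m c + m c' := by
    intro c c' h
    refine lmul_add u ?_
    rw [len_msp, len_msp, len_msp, tsub_tsub_cancel_of_le h,
      tsub_tsub_cancel_of_le (le_self_add.trans h), tsub_tsub_cancel_of_le (le_add_self.trans h)]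
  have h1 : 1 ≤ len v → m 1 = len u := by
    intro h
    rw [hm]
    simp only
    rw [lmul_congr (x' := 1), one_lmul]
    rw [len_msp, tsub_tsub_cancel_of_le h, len_one]
  have key : len v ≤ len v → len v ≠ (0 : M) → Mod.pad (len u) (len v) ≤ m (len v) + m (len v) := by
    refine notation_induction
      (P := fun c => c ≤ len v → c ≠ (0 : M) → Mod.pad (len u) c ≤ m c + m c)
      (by simp only [hm]; fun_prop) (fun _ h => absurd rfl h) ?_ (len v)
    intro c hc ih hle _
    have hle' := (half_le c).trans hle
    rw [pad_half _ hc]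
    by_cases hz : half c = (0 : M)
    · have : c = 1 := by
        rcases half_cases c with h | h
        · rw [hz, add_zero] at h; exact absurd h hc
        · rwa [hz, add_zero, zero_add] at h
      rw [hz, pad_zero, this, h1 (this ▸ hle)]
    · have ih := ih hle' hz
      have hh : m (half c) + m (half c) ≤ m c := by
        rcases half_cases c with h | h
        · rw [← hadd _ _ (h ▸ hle), ← h]
        · have h2 : half c + half c ≤ len v := by
            refine le_trans ?_ hle
            conv_rhs => rw [h]
            exact le_self_add
          have h3 := hadd (half c + half c) 1 (h ▸ hle)
          rw [← h, hadd _ _ h2] at h3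
          rw [h3]
          exact le_self_add
      exact (add_le_add ih ih).trans (add_le_add hh hh)
  have := key le_rfl h0
  simpa [hm] using this

/-! ### Small numbers -/

/-- A number below a length. -/
def Small (a : M) : Prop := ∃ w : M, a ≤ len w

theorem Small.of_le {a b : M} (hb : Small b) (h : a ≤ b) : Small a :=
  let ⟨w, hw⟩ := hb
  ⟨w, h.trans hw⟩

theorem small_len (x : M) : Small (len x) := ⟨x, le_rfl⟩

theorem Small.add {a b : M} (ha : Small a) (hb : Small b) : Small (a + b) := by
  obtain ⟨x, hx⟩ := ha
  obtain ⟨y, hy⟩ := hb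
  by_cases h : x = 0
  · refine ⟨y, ?_⟩
    rw [h, len_zero] at hx
    rwa [le_zero_iff.1 hx, zero_add]
  · exact ⟨pad x y, by rw [len_pad h]; exact add_le_add hx hy⟩

theorem small_zero : Small (0 : M) := ⟨0, by simp⟩
theorem small_one : Small (1 : M) := ⟨1, by simp⟩

theorem Small.pad {a b : M} (ha : Small a) (hb : Small b) : Small (pad a b) := by
  obtain ⟨u, hu⟩ := ha
  obtain ⟨v, hv⟩ := hb
  suffices h : Small (Mod.pad (len u) (len v)) from
    h.of_le ((pad_mono_left _ hu).trans (pad_mono_right _ (len_mono hv)))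
  by_cases h0 : len v = 0
  · rw [h0, pad_zero]
    exact small_len u
  · exact ((small_len _).add (small_len _)).of_le (pad_len_le h0)

/-- A number below the length of a length: the exponents of two in small numbers. -/
def Tiny (a : M) : Prop := ∃ b : M, Small b ∧ a ≤ len b

theorem Tiny.of_le {a b : M} (hb : Tiny b) (h : a ≤ b) : Tiny a :=
  let ⟨w, hw, hw'⟩ := hb
  ⟨w, hw, h.trans hw'⟩

theorem Tiny.add {a b : M} (ha : Tiny a) (hb : Tiny b) : Tiny (a + b) := by
  obtain ⟨x, hx, hx'⟩ := ha
  obtain ⟨y, hy, hy'⟩ := hb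
  by_cases h : x = 0
  · refine ⟨y, hy, ?_⟩
    rw [h, len_zero] at hx'
    rwa [le_zero_iff.1 hx', zero_add]
  · exact ⟨_, hx.pad hy, by rw [len_pad h]; exact add_le_add hx' hy'⟩

theorem Small.tiny_len {a : M} (h : Small a) : Tiny (len a) := ⟨a, h, le_rfl⟩

theorem tiny_zero : Tiny (0 : M) := ⟨0, small_zero, by simp⟩
theorem tiny_one : Tiny (1 : M) := ⟨1, small_one, by simp⟩

theorem Tiny.small_pad {y : M} (h : Tiny (len y)) : Small (Mod.pad 1 y) := by
  obtain ⟨b, hb, hb'⟩ := h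
  exact (small_one.pad hb).of_le (pad_mono_right _ hb')

theorem Tiny.exists_len {a : M} (h : Tiny a) : ∃ y, len y = a :=
  let ⟨_, _, h⟩ := h
  exists_len_eq h

theorem Tiny.small {a : M} (h : Tiny a) : Small a :=
  let ⟨b, _, h⟩ := h
  ⟨b, h⟩

theorem Tiny.nsmul {a : M} (h : Tiny a) (n : ℕ) : Tiny (n • a) := by
  induction n with
  | zero => rw [zero_nsmul]; exact tiny_zero
  | succ n ih => rw [succ_nsmul]; exact ih.add h

/-- All numbers of at most a given tiny length are below one length. -/
theorem Tiny.exists_bound {a : M} (h : Tiny a) : ∃ w : M, ∀ p, len p ≤ a → p ≤ len w := by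
  obtain ⟨y, rfl⟩ := h.exists_len
  obtain ⟨w, hw⟩ := h.small_pad
  exact ⟨w, fun p hp => ((len_le_iff p y).1 hp).le.trans hw⟩

/-- Comprehension for sets of tiny numbers. -/
theorem exists_bits {P : M → Prop} (hP : SDef fun v : Fin 1 → M => P (v 0)) {a : M} (ha : Tiny a) :
    ∃ z, len z ≤ a ∧ ∀ i, i < a → (bit i z = 1 ↔ P i) := by
  obtain ⟨y, rfl⟩ := ha.exists_len
  obtain ⟨w, hw⟩ := ha.exists_bound
  have := length_induction (P := fun k => ∃ z, z ≤ len w ∧ (len z ≤ k ∧ ∀ i, i ≤ len y → i < k →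
    (bit i z = 1 ↔ P i))) ?_ y ?_ ?_ (len y) le_rfl
  · obtain ⟨z, _, hz, h⟩ := this
    exact ⟨z, hz, fun i hi => h i hi.le hi⟩
  · refine SDef.ex (by fun_prop) (SDef.and (by fun_prop) (SDef.all (by fun_prop)
      (SDef.imp (by fun_prop) (SDef.iff (by fun_prop) (hP.comp₁ (by fun_prop))))))
  · exact ⟨0, zero_le, by simp, fun i _ hi => absurd hi (not_lt.2 zero_le)⟩
  · rintro k hk ⟨z, _, hz, h⟩
    obtain ⟨u, hu⟩ := exists_len_eq hk.le
    obtain ⟨b, hb, hbP⟩ : ∃ b : M, (b = 0 ∨ b = 1) ∧ (b = 1 ↔ P k) := by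
      by_cases h : P k
      · exact ⟨1, Or.inr rfl, by simp [h]⟩
      · exact ⟨0, Or.inl rfl, by simp [h]⟩
    have hz' : z < Mod.pad 1 u := by rw [← len_le_iff, hu]; exact hz
    have hbit : bit k (Mod.pad b u + z) = b := by
      have := bit_add_pad_add hz' (a := b) 0
      rw [add_zero, hu] at this
      rw [this]
      rcases hb with rfl | rfl
      · simp
      · simpa using bit_zero_double_add_one (0 : M)
    have hlen : len (Mod.pad b u + z) ≤ k + 1 := by
      obtain ⟨u', hu'⟩ := exists_len_eq ((lt_iff _ _).1 hk)
      rw [← hu', len_le_iff, pad_succ 1 (y := u) (by rw [hu', hu])]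
      have : Mod.pad b u ≤ Mod.pad 1 u := pad_mono_left u (by rcases hb with rfl | rfl <;> simp)
      exact add_lt_add_of_le_of_lt this hz'
    refine ⟨_, hw _ (hlen.trans ((lt_iff _ _).1 hk)), hlen, fun i hi hi' => ?_⟩
    rcases eq_or_lt_of_le (Order.lt_add_one_iff.1 hi') with rfl | hlt
    · rw [hbit, hbP]
    · rw [bit_pad_add_of_lt _ _ (hu ▸ hlt)]
      exact h i hi hlt


/-! ### Addition of definable sets of digits -/

theorem SDef.xor {n : ℕ} {P Q : (Fin n → M) → Prop} (hP : SDef P) (hQ : SDef Q) :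
    SDef fun v => Xor (P v) (Q v) := by
  simp only [Xor]
  exact (hP.and hQ.not).or (hQ.and hP.not)

attribute [fun_prop] SDef.xor

/-- The carry into position `i ≤ |w|` in the addition of `U` and `V`. -/
def carry (w : M) (U V : M → Prop) (i : M) : Prop :=
  ∃ j, j ≤ len w ∧ j < i ∧ (U j ∧ V j) ∧ ∀ k, k ≤ len w → j < k → k < i → Xor (U k) (V k)

/-- The sum of the digit sets `U` and `V`, modulo `2 ^ |w|`. -/
def dsum (w : M) (U V : M → Prop) (i : M) : Prop :=
  i < len w ∧ Xor (Xor (U i) (V i)) (carry w U V i)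

/-- Multiplication by two, modulo `2 ^ |w|`. -/
def dshift (w : M) (U : M → Prop) (i : M) : Prop := i < len w ∧ i ≠ 0 ∧ U (i - 1)

/-- The majority of three truth values. -/
def maj (a b c : Prop) : Prop := (a ∧ b) ∨ (b ∧ c) ∨ (a ∧ c)

theorem carry_zero (w : M) (U V : M → Prop) : ¬ carry w U V 0 := by
  rintro ⟨j, _, hj, _⟩
  exact not_lt.2 zero_le hj

theorem carry_succ {w i : M} (U V : M → Prop) (hi : i ≤ len w) :
    carry w U V (i + 1) ↔ maj (U i) (V i) (carry w U V i) := by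
  constructor
  · rintro ⟨j, hj, hji, hUV, h⟩
    rcases eq_or_lt_of_le (Order.lt_add_one_iff.1 hji) with rfl | hlt
    · exact Or.inl hUV
    · have hx := h i hi hlt (Order.lt_add_one_iff.2 le_rfl)
      have hc : carry w U V i := ⟨j, hj, hlt, hUV, fun k hk h1 h2 =>
        h k hk h1 (h2.trans (Order.lt_add_one_iff.2 le_rfl))⟩
      rcases hx with hx | hx
      · exact Or.inr (Or.inr ⟨hx.1, hc⟩)
      · exact Or.inr (Or.inl ⟨hx.1, hc⟩)
  · intro h
    by_cases hUV : U i ∧ V i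
    · exact ⟨i, hi, Order.lt_add_one_iff.2 le_rfl, hUV, fun k _ h1 h2 =>
        absurd (Order.lt_add_one_iff.1 h2) (not_le.2 h1)⟩
    · have hx : Xor (U i) (V i) ∧ carry w U V i := by
        unfold maj at h
        unfold Xor
        tauto
      obtain ⟨hx, j, hj, hji, hj', h⟩ := hx
      refine ⟨j, hj, hji.trans (Order.lt_add_one_iff.2 le_rfl), hj', fun k hk h1 h2 => ?_⟩
      rcases eq_or_lt_of_le (Order.lt_add_one_iff.1 h2) with rfl | hlt
      · exact hx
      · exact h k hk h1 hlt

section Families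

variable {n : ℕ} {w : M} {U V : (Fin n → M) → M → Prop} {f : (Fin n → M) → M}

theorem SDef.comp_snd (hU : SDef fun v : Fin (n + 1) → M => U (fun i => v i.succ) (v 0))
    (hf : TDef f) : SDef fun v => U v (f v) :=
  hU.comp (Fin.cons f fun i v => v i) (Fin.cases hf fun i => TDef.var i)

/-- The same with further variables in front. -/
theorem SDef.comp_lift {m : ℕ} (hU : SDef fun v : Fin (n + 1) → M => U (fun i => v i.succ) (v 0))
    (g : Fin n → (Fin m → M) → M) (hg : ∀ i, TDef (g i)) {f : (Fin m → M) → M} (hf : TDef f) :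
    SDef fun v => U (fun i => g i v) (f v) :=
  hU.comp (Fin.cons f g) (Fin.cases hf hg)

theorem SDef.carry (hU : SDef fun v : Fin (n + 1) → M => U (fun i => v i.succ) (v 0))
    (hV : SDef fun v : Fin (n + 1) → M => V (fun i => v i.succ) (v 0)) (hf : TDef f) :
    SDef fun v => carry w (U v) (V v) (f v) := by
  have hf1 : TDef fun v : Fin (n + 1) → M => f fun i => v i.succ := by
    obtain ⟨t, ht⟩ := hf
    refine ⟨t.relabel (Sum.map id Fin.succ), fun v => ?_⟩
    rw [Term.realize_relabel]
    refine Eq.trans ?_ (ht _)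
    congr 1
    funext x
    rcases x with x | x <;> rfl
  have hf2 : TDef fun v : Fin (n + 2) → M => f fun i => v i.succ.succ := by
    obtain ⟨t, ht⟩ := hf
    refine ⟨t.relabel (Sum.map id fun i => i.succ.succ), fun v => ?_⟩
    rw [Term.realize_relabel]
    refine Eq.trans ?_ (ht _)
    congr 1
    funext x
    rcases x with x | x <;> rfl
  unfold Mod.carry
  refine SDef.ex (by fun_prop) (SDef.and (SDef.lt (by fun_prop) hf1) (SDef.and
    (SDef.and hU hV) (SDef.all (by fun_prop) (SDef.imp (by fun_prop) (SDef.imp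
      (SDef.lt (by fun_prop) hf2) (SDef.xor ?_ ?_))))))
  · exact hU.comp_lift (fun i v => v i.succ.succ) (fun i => TDef.var _) (TDef.var 0)
  · exact hV.comp_lift (fun i v => v i.succ.succ) (fun i => TDef.var _) (TDef.var 0)

theorem SDef.dsum (hU : SDef fun v : Fin (n + 1) → M => U (fun i => v i.succ) (v 0))
    (hV : SDef fun v : Fin (n + 1) → M => V (fun i => v i.succ) (v 0)) (hf : TDef f) :
    SDef fun v => dsum w (U v) (V v) (f v) :=
  SDef.and (by fun_prop) (((hU.comp_snd hf).xor (hV.comp_snd hf)).xor (hU.carry hV hf))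

theorem SDef.dshift (hU : SDef fun v : Fin (n + 1) → M => U (fun i => v i.succ) (v 0))
    (hf : TDef f) : SDef fun v => dshift w (U v) (f v) :=
  SDef.and (by fun_prop) (SDef.and (by fun_prop) (hU.comp_snd (f := fun v => f v - 1) (by fun_prop)))

theorem SDef.maj {P Q R : (Fin n → M) → Prop} (hP : SDef P) (hQ : SDef Q) (hR : SDef R) :
    SDef fun v => maj (P v) (Q v) (R v) :=
  (hP.and hQ).or ((hQ.and hR).or (hP.and hR))

end Families

/-- Sets of digits below `|w|` that are definable with parameters. They represent numbers modulo
`2 ^ |w|`, but need not be the sets of digits of elements of the model. -/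
@[ext] structure DSet (w : M) where
  mem : M → Prop
  sdef : SDef fun v : Fin 1 → M => mem (v 0)
  lt : ∀ i, mem i → i < len w

namespace DSet

variable {w : M}

theorem ext_iff_lt {U V : DSet w} (h : ∀ i, i < len w → (U.mem i ↔ V.mem i)) : U = V := by
  ext i
  exact ⟨fun hi => (h i (U.lt i hi)).1 hi, fun hi => (h i (V.lt i hi)).2 hi⟩

theorem sdef' (U : DSet w) {n : ℕ} : SDef fun v : Fin (n + 1) → M => U.mem (v 0) :=
  U.sdef.comp₁ (TDef.var 0)

instance : Zero (DSet w) := ⟨⟨fun _ => False, SDef.const _, fun _ h => h.elim⟩⟩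

instance : Add (DSet w) := ⟨fun U V => ⟨dsum w U.mem V.mem,
  SDef.dsum (U := fun _ => U.mem) (V := fun _ => V.mem) U.sdef' V.sdef' (TDef.var 0),
  fun _ h => h.1⟩⟩

/-- Multiplication by two. -/
def shift (U : DSet w) : DSet w :=
  ⟨dshift w U.mem, SDef.dshift (U := fun _ => U.mem) U.sdef' (TDef.var 0), fun _ h => h.1⟩

/-- The sum of three sets of digits without the carries. -/
def xor3 (U V W : DSet w) : DSet w :=
  ⟨fun i => Xor (Xor (U.mem i) (V.mem i)) (W.mem i), (U.sdef.xor V.sdef).xor W.sdef,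
    fun i h => by
      by_contra hi
      have h1 := fun h => hi (U.lt i h)
      have h2 := fun h => hi (V.lt i h)
      have h3 := fun h => hi (W.lt i h)
      unfold Xor at h
      tauto⟩

/-- The carries in the sum of three sets of digits. -/
def maj3 (U V W : DSet w) : DSet w :=
  ⟨fun i => maj (U.mem i) (V.mem i) (W.mem i), SDef.maj U.sdef V.sdef W.sdef,
    fun i h => by
      rcases h with h | h | h
      · exact U.lt i h.1
      · exact V.lt i h.1
      · exact U.lt i h.1⟩

theorem add_mem (U V : DSet w) (i : M) : (U + V).mem i ↔ dsum w U.mem V.mem i := Iff.rfl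
theorem zero_mem (i : M) : ¬ (0 : DSet w).mem i := id

theorem carry_comm (U V : M → Prop) (i : M) : carry w U V i ↔ carry w V U i := by
  unfold carry
  simp only [and_comm (a := U _), xor_comm]

theorem add_comm' (U V : DSet w) : U + V = V + U := by
  ext i
  rw [add_mem, add_mem, dsum, dsum, carry_comm, xor_comm (U.mem i)]

theorem zero_add' (U : DSet w) : 0 + U = U := by
  refine ext_iff_lt fun i hi => ?_
  have : ¬ carry w (0 : DSet w).mem U.mem i := fun ⟨j, _, _, h, _⟩ => h.1
  rw [add_mem, dsum]
  have h0 := zero_mem (w := w) i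
  simp [hi, this, h0, Xor]

/-- The carry-save adder: a sum of three numbers is a sum of two numbers whose digits depend on a
bounded number of digits of the summands. -/
theorem add_add_eq (U V W : DSet w) : U + V + W = xor3 U V W + shift (maj3 U V W) := by
  -- On both sides the two carries into each position add up to the same number.
  have key : ∀ i, i ≤ len w → i < len w →
      ((carry w U.mem V.mem i ∧ carry w (U + V).mem W.mem i ↔
        (shift (maj3 U V W)).mem i ∧ carry w (xor3 U V W).mem (shift (maj3 U V W)).mem i) ∧
      (carry w U.mem V.mem i ∨ carry w (U + V).mem W.mem i ↔
        (shift (maj3 U V W)).mem i ∨ carry w (xor3 U V W).mem (shift (maj3 U V W)).mem i)) := by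
    refine length_induction (P := fun i => i < len w →
      ((carry w U.mem V.mem i ∧ carry w (U + V).mem W.mem i ↔
        (shift (maj3 U V W)).mem i ∧ carry w (xor3 U V W).mem (shift (maj3 U V W)).mem i) ∧
      (carry w U.mem V.mem i ∨ carry w (U + V).mem W.mem i ↔
        (shift (maj3 U V W)).mem i ∨ carry w (xor3 U V W).mem (shift (maj3 U V W)).mem i)))
      ?_ w ?_ ?_
    · have h1 : SDef fun v : Fin 1 → M => carry w U.mem V.mem (v 0) :=
        SDef.carry (U := fun _ => U.mem) (V := fun _ => V.mem) U.sdef' V.sdef' (TDef.var 0)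
      have h2 : SDef fun v : Fin 1 → M => carry w (U + V).mem W.mem (v 0) :=
        SDef.carry (U := fun _ => (U + V).mem) (V := fun _ => W.mem) (U + V).sdef' W.sdef'
          (TDef.var 0)
      have h3 : SDef fun v : Fin 1 → M => carry w (xor3 U V W).mem (shift (maj3 U V W)).mem (v 0) :=
        SDef.carry (U := fun _ => (xor3 U V W).mem) (V := fun _ => (shift (maj3 U V W)).mem)
          (xor3 U V W).sdef' (shift (maj3 U V W)).sdef' (TDef.var 0)
      have h4 := (shift (maj3 U V W)).sdef
      exact SDef.imp (by fun_prop) (((h1.and h2).iff (h4.and h3)).and ((h1.or h2).iff (h4.or h3)))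
    · intro _
      have : ¬ (shift (maj3 U V W)).mem 0 := fun h => h.2.1 rfl
      simp [carry_zero, this]
    · intro i hi ih hi'
      obtain ⟨ih1, ih2⟩ := ih hi
      have hs : (shift (maj3 U V W)).mem (i + 1) ↔ maj (U.mem i) (V.mem i) (W.mem i) := by
        refine ⟨fun h => ?_, fun h => ⟨hi', add_one_ne_zero' i, ?_⟩⟩
        · have := h.2.2
          rwa [add_tsub_cancel_right] at this
        · rwa [add_tsub_cancel_right]
      rw [carry_succ _ _ hi.le, carry_succ _ _ hi.le, carry_succ _ _ hi.le, hs]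
      have ha : (U + V).mem i ↔ Xor (Xor (U.mem i) (V.mem i)) (carry w U.mem V.mem i) :=
        ⟨fun h => h.2, fun h => ⟨hi, h⟩⟩
      have hx : (xor3 U V W).mem i ↔ Xor (Xor (U.mem i) (V.mem i)) (W.mem i) := Iff.rfl
      rw [ha, hx]
      generalize carry w U.mem V.mem i = k1 at *
      generalize carry w (U + V).mem W.mem i = k2 at *
      generalize carry w (xor3 U V W).mem (shift (maj3 U V W)).mem i = k3 at *
      generalize (shift (maj3 U V W)).mem i = y at *
      generalize U.mem i = u
      generalize V.mem i = v
      generalize W.mem i = x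
      clear ha hx hs
      unfold maj Xor
      by_cases u <;> by_cases v <;> by_cases x <;> by_cases k1 <;> by_cases k2 <;>
        by_cases y <;> by_cases k3 <;> simp_all
  refine ext_iff_lt fun i hi => ?_
  obtain ⟨h1, h2⟩ := key i hi.le hi
  have ha : (U + V).mem i ↔ Xor (Xor (U.mem i) (V.mem i)) (carry w U.mem V.mem i) :=
    ⟨fun h => h.2, fun h => ⟨hi, h⟩⟩
  have hx : (xor3 U V W).mem i ↔ Xor (Xor (U.mem i) (V.mem i)) (W.mem i) := Iff.rfl
  rw [add_mem, add_mem, dsum, dsum, ha, hx]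
  generalize carry w U.mem V.mem i = k1 at *
  generalize carry w (U + V).mem W.mem i = k2 at *
  generalize carry w (xor3 U V W).mem (shift (maj3 U V W)).mem i = k3 at *
  generalize (shift (maj3 U V W)).mem i = y at *
  generalize U.mem i = u at *
  generalize V.mem i = v at *
  generalize W.mem i = x at *
  clear ha hx key
  unfold Xor
  by_cases u <;> by_cases v <;> by_cases x <;> by_cases k1 <;> by_cases k2 <;>
    by_cases y <;> by_cases k3 <;> simp_all

theorem xor3_rotate (U V W : DSet w) : xor3 U V W = xor3 V W U := by
  ext i
  show Xor (Xor _ _) _ ↔ Xor (Xor _ _) _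
  unfold Xor
  tauto

theorem maj3_rotate (U V W : DSet w) : maj3 U V W = maj3 V W U := by
  ext i
  show maj _ _ _ ↔ maj _ _ _
  unfold maj
  tauto

instance : AddCommMonoid (DSet w) where
  add_assoc U V W := by
    rw [add_comm' U (V + W), add_add_eq U V W, add_add_eq V W U, xor3_rotate U V W,
      maj3_rotate U V W]
  zero_add := zero_add'
  add_zero U := by rw [add_comm', zero_add']
  add_comm := add_comm'
  nsmul := nsmulRec

/-- The set of digits of `u`, cut off at `|w|`. -/
def dig (w u : M) : DSet w := ⟨fun i => i < len w ∧ bit i u = 1, by fun_prop, fun _ h => h.1⟩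

theorem dig_zero : dig w 0 = 0 := by
  ext i
  have := zero_mem (w := w) i
  simp [dig, this, one_ne_zero'.symm]

/-- Addition in the model is addition of sets of digits. -/
theorem dig_add (u v : M) : dig w (u + v) = dig w u + dig w v := by
  open Classical in
  have key : ∀ i, i ≤ len w →
      (carry w (dig w u).mem (dig w v).mem i → msp (u + v) i = msp u i + msp v i + 1) ∧
      (¬ carry w (dig w u).mem (dig w v).mem i → msp (u + v) i = msp u i + msp v i) := by
    refine length_induction (P := fun i =>
      (carry w (dig w u).mem (dig w v).mem i → msp (u + v) i = msp u i + msp v i + 1) ∧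
      (¬ carry w (dig w u).mem (dig w v).mem i → msp (u + v) i = msp u i + msp v i)) ?_ w ?_ ?_
    · have h1 : SDef fun x : Fin 1 → M => carry w (dig w u).mem (dig w v).mem (x 0) :=
        SDef.carry (U := fun _ => (dig w u).mem) (V := fun _ => (dig w v).mem) (dig w u).sdef'
          (dig w v).sdef' (TDef.var 0)
      exact SDef.and (SDef.imp h1 (by fun_prop)) (SDef.imp h1.not (by fun_prop))
    · simp [carry_zero]
    · rintro i hi ⟨ih1, ih2⟩
      rw [carry_succ _ _ hi.le]
      have hu : (dig w u).mem i ↔ bit i u = 1 := ⟨fun h => h.2, fun h => ⟨hi, h⟩⟩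
      have hv : (dig w v).mem i ↔ bit i v = 1 := ⟨fun h => h.2, fun h => ⟨hi, h⟩⟩
      rw [hu, hv, bit_eq i u, bit_eq i v, msp_succ, msp_succ, msp_succ]
      have eu := half_add_bit (msp u i)
      have ev := half_add_bit (msp v i)
      have e0 := one_ne_zero' (M := M)
      have hd : ∀ a b : M, msp (u + v) i = a + a + b → half (msp (u + v) i) = a + half b := by
        intro a b h; rw [h, half_double_add]
      have h11 : half (1 + 1 : M) = 1 := half_double 1
      have h111 : half (1 + 1 + 1 : M) = 1 := half_double_add_one 1
      by_cases hc : carry w (dig w u).mem (dig w v).mem i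
      · have h := ih1 hc
        have := hd (half (msp u i) + half (msp v i)) (bit 0 (msp u i) + bit 0 (msp v i) + 1)
          (by rw [h]; conv_lhs => rw [eu, ev]
              abel)
        rcases bit_zero_cases (msp u i) with h1 | h1 <;>
          rcases bit_zero_cases (msp v i) with h2 | h2 <;>
          simp [maj, h1, h2, hc, this, e0.symm, h11, h111]
      · have h := ih2 hc
        have := hd (half (msp u i) + half (msp v i)) (bit 0 (msp u i) + bit 0 (msp v i))
          (by rw [h]; conv_lhs => rw [eu, ev]
              abel)
        rcases bit_zero_cases (msp u i) with h1 | h1 <;>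
          rcases bit_zero_cases (msp v i) with h2 | h2 <;>
          simp [maj, h1, h2, hc, this, e0.symm, h11]
  refine ext_iff_lt fun i hi => ?_
  obtain ⟨h1, h2⟩ := key i hi.le
  have hu : (dig w u).mem i ↔ bit i u = 1 := ⟨fun h => h.2, fun h => ⟨hi, h⟩⟩
  have hv : (dig w v).mem i ↔ bit i v = 1 := ⟨fun h => h.2, fun h => ⟨hi, h⟩⟩
  have huv : (dig w (u + v)).mem i ↔ bit i (u + v) = 1 := ⟨fun h => h.2, fun h => ⟨hi, h⟩⟩
  rw [add_mem, dsum, hu, hv, huv, bit_eq i u, bit_eq i v, bit_eq]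
  have eu := half_add_bit (msp u i)
  have ev := half_add_bit (msp v i)
  have e0 := one_ne_zero' (M := M)
  have hd : ∀ a b : M, msp (u + v) i = a + a + b → bit 0 (msp (u + v) i) = bit 0 b := by
    intro a b h; rw [h, bit_zero_double_add]
  have h00 : bit 0 (1 : M) = 1 := by simpa using bit_zero_double_add_one (0 : M)
  have h11 : bit 0 (1 + 1 : M) = 0 := bit_zero_double 1
  have h111 : bit 0 (1 + 1 + 1 : M) = 1 := bit_zero_double_add_one 1
  by_cases hc : carry w (dig w u).mem (dig w v).mem i
  · have h := h1 hc
    have := hd (half (msp u i) + half (msp v i)) (bit 0 (msp u i) + bit 0 (msp v i) + 1)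
      (by rw [h]; conv_lhs => rw [eu, ev]
          abel)
    rcases bit_zero_cases (msp u i) with h1 | h1 <;>
      rcases bit_zero_cases (msp v i) with h2 | h2 <;>
      simp [Xor, h1, h2, hc, this, e0.symm, h00, h11, h111, hi]
  · have h := h2 hc
    have := hd (half (msp u i) + half (msp v i)) (bit 0 (msp u i) + bit 0 (msp v i))
      (by rw [h]; conv_lhs => rw [eu, ev]
          abel)
    rcases bit_zero_cases (msp u i) with h1 | h1 <;>
      rcases bit_zero_cases (msp v i) with h2 | h2 <;>
      simp [Xor, h1, h2, hc, this, e0.symm, h00, h11, hi]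

theorem eq_of_dig {u v : M} (hu : len u ≤ len w) (hv : len v ≤ len w) (h : dig w u = dig w v) :
    u = v := by
  refine eq_of_bit fun i hi => ?_
  have hi : i < len w := by
    rcases hi with hi | hi
    · exact hi.trans_le hu
    · exact hi.trans_le hv
  have := congrArg (fun U => DSet.mem U i) h
  simpa [dig, hi] using this

end DSet


/-! ### Growth of terms -/

theorem len_add_le (a b : M) : len (a + b) ≤ len a + len b := by
  wlog h : len b ≤ len a generalizing a b
  · rw [add_comm a, add_comm (len a)]
    exact this b a (le_of_not_ge h)
  by_cases hb : b = 0
  · simp [hb]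
  have ha : a ≠ 0 := fun ha => hb (by simpa [ha] using h)
  have e : len a + len b = len (pad a b) := (len_pad ha b).symm
  rw [e, len_le_iff]
  have h1 : b < pad 1 a := (len_le_iff b a).1 h
  have h2 : pad 1 a + pad 1 a = pad 1 (a + a) := (pad_succ 1 (len_double ha)).symm
  have h3 : len (a + a) ≤ len (pad a b) := by
    rw [len_double ha, ← e]
    refine add_le_add_right ?_ _
    exact (ne_zero_iff _).1 (by simpa using hb)
  exact (add_lt_add (lt_pad_one a) h1).trans_le (h2.le.trans (pad_mono_right 1 h3))

theorem part_eq_part_zero (x i e : M) (hi : i ≤ len x) (he : 0 < e) :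
    part x i (i + e) = part (msp x i) 0 e := by
  have := length_induction
    (P := fun k => k ≤ i → part (msp x (i - k)) k (k + e) = part (msp x i) 0 e)
    (by fun_prop) x (by simp) ?_ i hi le_rfl
  · simpa using this
  intro k _ ih hk
  rw [← ih (le_self_add.trans hk), add_right_comm, part_succ_succ _ (lt_add_of_pos_right k he),
    half_msp_sub ((lt_iff _ _).2 hk)]

theorem part_zero_of_len_le (x e : M) (h : len x ≤ e) : part x 0 e = x := by
  have := length_induction
    (P := fun k => k ≤ len x → part (msp x (len x - k)) 0 (e - (len x - k)) = msp x (len x - k))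
    (by fun_prop) x ?_ ?_ (len x) le_rfl le_rfl
  · simpa using this
  · intro _
    rw [tsub_zero, msp_of_len_le le_rfl]
    exact part_of_len_le _ (by simp)
  · intro k _ ih hk
    have ih := ih (le_self_add.trans hk)
    have hlt := (lt_iff _ _).2 hk
    have hh := half_msp_sub (x := x) hlt
    have e1 : e - (len x - (k + 1)) = e - (len x - k) + 1 := by
      rw [sub_add_one_sub hlt]
      refine sub_add_one_sub (((lt_iff _ _).2 ?_).trans_le h)
      rw [← sub_add_one_sub hlt]
      exact tsub_le_self
    have h2 := half_add_bit (msp x (len x - (k + 1)))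
    rw [hh] at h2
    rw [e1]
    generalize msp x (len x - (k + 1)) = u at *
    rcases bit_zero_cases u with hb | hb
    · rw [hb, add_zero] at h2
      rw [h2, part_double, ih]
    · rw [hb] at h2
      rw [h2, part_double_add_one, ih]

theorem msp_le (x i : M) : msp x i ≤ x := by
  rcases le_total (len x) i with h | h
  · rw [msp_of_len_le h]; exact zero_le
  · refine length_induction (P := fun i => msp x i ≤ x) (by fun_prop) x (by simp) ?_ i h
    intro i _ ih
    rw [msp_succ]
    exact (half_le _).trans ih

theorem part_le_self (x i j : M) : part x i j ≤ x := by
  rcases le_or_gt j i with h | h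
  · rw [part_of_le x h]; exact zero_le
  rcases le_total (len x) i with h' | h'
  · rw [part_of_len_le j h']; exact zero_le
  obtain ⟨e, rfl⟩ := exists_add_of_le h.le
  have he : 0 < e := by simpa using h
  rw [part_eq_part_zero x i e h' he]
  refine le_trans ?_ (msp_le x i)
  generalize msp x i = z
  rcases le_total (len z) e with h | h
  · rw [part_zero_of_len_le z e h]
  · obtain ⟨y, rfl⟩ := exists_len_eq h
    conv_rhs => rw [← (pad_add_part z y).1]
    exact le_add_self

theorem lmul_le (x y : M) : lmul x y + len y ≤ pad (len y) (len x) := by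
  set m : M → M := fun c => lmul (msp x (len x - c)) y with hm
  have hadd : ∀ c c', c + c' ≤ len x → m (c + c') = m c + m c' := by
    intro c c' h
    refine lmul_add y ?_
    rw [len_msp, len_msp, len_msp, tsub_tsub_cancel_of_le h,
      tsub_tsub_cancel_of_le (le_self_add.trans h), tsub_tsub_cancel_of_le (le_add_self.trans h)]
  have h1 : 1 ≤ len x → m 1 = len y := by
    intro h
    rw [hm]
    simp only
    rw [lmul_congr (x' := 1), one_lmul]
    rw [len_msp, tsub_tsub_cancel_of_le h, len_one]
  have key : len x ≤ len x → m (len x) + len y ≤ pad (len y) (len x) := by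
    refine notation_induction
      (P := fun c => c ≤ len x → m c + len y ≤ pad (len y) c)
      (by simp only [hm]; fun_prop) ?_ ?_ (len x)
    · intro _
      simp [hm, msp_of_len_le]
    intro c hc ih hle
    have ih := ih ((half_le c).trans hle)
    rw [pad_half _ hc]
    refine le_trans ?_ (add_le_add ih ih)
    rcases half_cases c with h | h
    · have : m c = m (half c) + m (half c) := by
        rw [← hadd _ _ (h ▸ hle), ← h]
      rw [this]
      exact (le_self_add (b := len y)).trans (le_of_eq (by abel))
    · have h2 : half c + half c ≤ len x := by
        refine le_trans ?_ hle
        conv_rhs => rw [h]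
        exact le_self_add
      have h3 := hadd (half c + half c) 1 (h ▸ hle)
      rw [← h, hadd _ _ h2, h1] at h3
      · rw [h3]
        exact le_of_eq (by abel)
      · refine le_trans ?_ hle
        rw [h]
        exact le_add_self
  have := key le_rfl
  simpa [hm] using this

/-- A bound for the values of linear forms in `‖x‖`. -/
def weight {n : ℕ} (x : Fin n → M) : M := ∑ i, len (len (x i)) + 1

theorem weight_snoc {n : ℕ} (x : Fin n → M) (q : M) :
    weight (Fin.snoc x q : Fin (n + 1) → M) = weight x + len (len q) := by
  unfold weight
  rw [Fin.sum_univ_castSucc]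
  simp only [Fin.snoc_castSucc, Fin.snoc_last]
  abel

theorem one_le_weight {n : ℕ} (x : Fin n → M) : 1 ≤ weight x := le_add_self

theorem tiny_weight {n : ℕ} (x : Fin n → M) : Tiny (weight x) := by
  refine Tiny.add ?_ tiny_one
  have : ∀ s : Finset (Fin n), Tiny (∑ i ∈ s, len (len (x i))) := by
    intro s
    induction s using Finset.induction_on with
    | empty => simpa using tiny_zero
    | insert a s h ih => rw [Finset.sum_insert h]; exact (small_len _).tiny_len.add ih
  exact this _

theorem len_len_le_weight {n : ℕ} (x : Fin n → M) (i : Fin n) : len (len (x i)) ≤ weight x :=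
  (Finset.single_le_sum (f := fun i => len (len (x i))) (fun _ _ => zero_le)
    (Finset.mem_univ i)).trans le_self_add

theorem len_len_part_le (x i j : M) : len (len (part x i j)) ≤ len (len x) :=
  len_mono (len_mono (part_le_self x i j))

theorem len_len_smash_le (x y : M) : len (len (smash x y)) ≤ len (len x) + len (len y) + 1 := by
  rw [len_half (smash_ne_zero x y)]
  refine (len_add_le _ _).trans (add_le_add ?_ (by simp))
  show len (lmul x y) ≤ _
  refine (len_mono (le_self_add.trans (lmul_le x y))).trans ?_
  by_cases h : len y = 0
  · simp [h]
  · rw [len_pad h, add_comm]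

theorem len_len_pad_le (x y : M) : len (len (pad x y)) ≤ len (len x) + len (len y) := by
  by_cases h : x = 0
  · simp [h]
  · rw [len_pad h]; exact len_add_le _ _

theorem len_len_add_le (x y : M) : len (len (x + y)) ≤ len (len x) + len (len y) :=
  (len_mono (len_add_le x y)).trans (len_add_le _ _)

theorem len_len_funMap_le {l : ℕ} (f : BAFunc l) (a : Fin l → M) :
    len (len (Structure.funMap (L := LAID) f a)) ≤ ∑ i, len (len (a i)) + 1 := by
  have e1 : ∀ a : Fin 1 → M, a = ![a 0] := fun a => by
    funext i; rw [Subsingleton.elim i 0]; rfl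
  have e2 : ∀ a : Fin 2 → M, a = ![a 0, a 1] := fun a => by
    funext i; fin_cases i <;> rfl
  have e3 : ∀ a : Fin 3 → M, a = ![a 0, a 1, a 2] := fun a => by
    funext i; fin_cases i <;> rfl
  cases f with
  | zero =>
    have : Structure.funMap (L := LAID) BAFunc.zero a = (0 : M) :=
      congrArg _ (Subsingleton.elim _ _)
    rw [this]; simp
  | one =>
    have : Structure.funMap (L := LAID) BAFunc.one a = (1 : M) :=
      congrArg _ (Subsingleton.elim _ _)
    rw [this]; simp
  | add =>
    rw [e2 a, Fin.sum_univ_two]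
    exact (len_len_add_le _ _).trans le_self_add
  | half =>
    rw [e1 a, Fin.sum_univ_one]
    exact (len_mono (len_mono (half_le _))).trans le_self_add
  | len =>
    rw [e1 a, Fin.sum_univ_one]
    exact (len_mono (len_mono (len_le_self _))).trans le_self_add
  | smash =>
    rw [e2 a, Fin.sum_univ_two]
    exact len_len_smash_le _ _
  | pad =>
    rw [e2 a, Fin.sum_univ_two]
    exact (len_len_pad_le _ _).trans le_self_add
  | sub =>
    rw [e2 a, Fin.sum_univ_two]
    exact (len_mono (len_mono (tsub_le_self (a := a 0) (b := a 1)))).trans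
      (le_self_add.trans le_self_add)
  | part =>
    rw [e3 a, Fin.sum_univ_three]
    exact (len_len_part_le _ _ _).trans (le_self_add.trans (le_self_add.trans le_self_add))

end Mod

open BoundedArith.Mod

/-- The length of the length of a term grows linearly, provably. -/
theorem exists_term_bound {n : ℕ} (t : LBase.Term (Fin n)) : ∃ K : ℕ,
    ∀ (M : Type) [AIDModel M] (x : Fin n → M), Mod.len (Mod.len (t.realize x)) ≤ K • weight x := by
  induction t with
  | var i => exact ⟨1, fun M _ x => by rw [one_nsmul]; exact len_len_le_weight x i⟩
  | @func l f ts ih =>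
    choose K hK using ih
    refine ⟨∑ i, K i + 1, fun M _ x => ?_⟩
    have hs : ∑ i, Mod.len (Mod.len ((ts i).realize x)) + 1 ≤ (∑ i, K i + 1) • weight x := by
      rw [add_nsmul, one_nsmul, Finset.sum_smul]
      exact add_le_add (Finset.sum_le_sum fun i _ => hK i M x) (one_le_weight x)
    refine le_trans ?_ hs
    exact len_len_funMap_le f _

end BoundedArith

namespace BoundedArith

open BoundedArith.Mod

/-! ### Construction of inductive definitions -/

/-- Terms contain no predicates. -/
def toBase {X : ℕ → Type} {α : Type} : (LBA X).Term α → LBase.Term α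
  | .var a => .var a
  | .func f ts => .func f fun i => toBase (ts i)

theorem realize_toBase {X : ℕ → Type} {M : Type} [AIDModel M] [(LBA X).Structure M] [Compat X M]
    {α : Type} (t : (LBA X).Term α) (v : α → M) : (toBase t).realize v = t.realize v := by
  induction t with
  | var a => rfl
  | func f ts ih =>
    refine ((Compat.fun_eq (X := X) f _).trans (congrArg _ (funext fun i => ?_))).symm
    exact (ih i).symm

namespace BoolForm

variable {ι : Type}

theorem realize_inst {X : ℕ → Type} {M α : Type} [(LBA X).Structure M] (a : ι → (LBA X).Formula α)
    (v : α → M) (φ : BoolForm ι) : (φ.inst a).Realize v ↔ φ.eval fun i => (a i).Realize v := by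
  induction φ with
  | atom i => rfl
  | top => exact iff_of_true (Formula.realize_top.2 trivial) trivial
  | bot => exact iff_of_false (fun h => Formula.realize_bot.1 h) id
  | neg φ ih => exact Formula.realize_not.trans (not_congr ih)
  | and φ ψ h₁ h₂ => exact Formula.realize_inf.trans (and_congr h₁ h₂)
  | or φ ψ h₁ h₂ => exact Formula.realize_sup.trans (or_congr h₁ h₂)

/-- Every truth function of finitely many arguments is given by a boolean formula. -/
theorem exists_eval [Finite ι] (F : (ι → Prop) → Prop) :
    ∃ φ : BoolForm ι, ∀ v, φ.eval v ↔ F v := by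
  classical
  cases nonempty_fintype ι
  -- Disjunctive normal form: atoms outside of `s` are fixed.
  have : ∀ (s : Finset ι) (u : ι → Prop),
      ∃ φ : BoolForm ι, ∀ v, φ.eval v ↔ F fun i => if i ∈ s then v i else u i := by
    intro s
    induction s using Finset.induction_on with
    | empty =>
      intro u
      by_cases h : F u
      · exact ⟨top, fun v => by simp [eval, h]⟩
      · exact ⟨bot, fun v => by simp [eval, h]⟩
    | insert a s ha ih =>
      intro u
      obtain ⟨φ, hφ⟩ := ih (Function.update u a True)
      obtain ⟨ψ, hψ⟩ := ih (Function.update u a False)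
      refine ⟨or (and (atom a) φ) (and (neg (atom a)) ψ), fun v => ?_⟩
      simp only [eval, hφ, hψ]
      by_cases h : v a
      · simp only [h, true_and, not_true, false_and, or_false]
        refine iff_of_eq (congrArg F (funext fun i => ?_))
        by_cases hi : i = a
        · subst hi; simp [ha, h]
        · simp [hi]
      · simp only [h, not_false_eq_true, true_and, false_and, false_or]
        refine iff_of_eq (congrArg F (funext fun i => ?_))
        by_cases hi : i = a
        · subst hi; simp [ha, h]
        · simp [hi]
  obtain ⟨φ, hφ⟩ := this Finset.univ fun _ => False
  exact ⟨φ, fun v => by simpa using hφ v⟩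

end BoolForm

namespace Mod

variable {M : Type} [AIDModel M] {n : ℕ}

/-- The value of the linear form of `d`. -/
noncomputable def ell (d : IndDef n) (x : Fin n → M) : M := ∑ i, d.coeff i • len (len (x i)) + d.const • 1

theorem realize_times {α : Type} (c : ℕ) (t : LAID.Term α) (v : α → M) :
    (times c t).realize v = c • t.realize v := by
  induction c with
  | zero => rw [zero_nsmul]; exact realize_zero v
  | succ c ih => rw [succ_nsmul, ← ih]; exact realize_add _ _ _

theorem realize_ellTerm (d : IndDef n) (v : Fin (n + 1) → M) :
    (ellTerm d).realize v = ell d (Fin.init v) := by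
  have : ∀ l : List (Fin n),
      ((l.map fun i => times (d.coeff i) (BoundedArith.len (BoundedArith.len (xv i)))).foldr (· + ·)
        (times d.const 1)).realize v =
      (l.map fun i => d.coeff i • len (len (v i.castSucc))).sum + d.const • 1 := by
    intro l
    induction l with
    | nil => simp [realize_times]
    | cons a l ih =>
      simp only [List.map_cons, List.foldr_cons, realize_add, ih, List.sum_cons, realize_times,
        realize_len, add_assoc]
      rfl
  rw [ellTerm, this, ell]
  congr 1

theorem ell_le (d : IndDef n) (x : Fin n → M) :
    ell d x ≤ (∑ i, d.coeff i + d.const) • weight x := by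
  rw [add_smul, Finset.sum_smul]
  exact add_le_add (Finset.sum_le_sum fun i _ => nsmul_le_nsmul_right (len_len_le_weight x i) _)
    (nsmul_le_nsmul_right (one_le_weight x) _)

theorem realize_ind (d : IndDef n) {φ : LAID.Formula (Fin (n + 1))}
    (h : φ = axA0 d ∨ φ = axA1 d ∨ φ = axA2 d) (v : Fin (n + 1) → M) : φ.Realize v :=
  (realize_closure φ).1 ((AIDModel.models (M := M)).realize_of_mem _
    (Or.inr ⟨n, d, h.imp (congrArg _) (Or.imp (congrArg _) (congrArg _))⟩)) v

theorem realize_indAtom (d : IndDef n) (t : LAID.Term (Fin (n + 1))) (x : Fin n → M) (p : M) :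
    (indAtom d t).Realize (Fin.snoc x p : Fin (n + 1) → M) ↔
      ind d x (t.realize (Fin.snoc x p : Fin (n + 1) → M)) := by
  unfold indAtom ind
  rw [Formula.realize_rel]
  refine iff_of_eq (congrArg _ (funext fun i => ?_))
  refine Fin.lastCases ?_ (fun i => ?_) i
  · simp
  · simp [xv]

theorem ind_le (d : IndDef n) (x : Fin n → M) (p : M) (h : ind d x p) :
    p ≠ 0 ∧ len p ≤ ell d x := by
  have := realize_ind d (Or.inl rfl) (Fin.snoc x p : Fin (n + 1) → M)
  simp only [axA0, realize_imp', realize_indAtom, realize_and, realize_ne, realize_le, realize_len,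
    realize_ellTerm, realize_zero, pv, Term.realize_var, Fin.snoc_last, Fin.init_snoc] at this
  obtain ⟨h1, h2⟩ := this h
  exact ⟨fun h => h1 (by simp [h]), h2⟩

theorem ind_leaf (d : IndDef n) (x : Fin n → M) {p : M} (h0 : p ≠ 0) (h : len p = ell d x) :
    ind d x p ↔ d.B.Realize (Fin.snoc x p : Fin (n + 1) → M) := by
  have := realize_ind d (Or.inr (Or.inl rfl)) (Fin.snoc x p : Fin (n + 1) → M)
  simp only [axA1, realize_imp', realize_iff', realize_indAtom, realize_and, realize_ne,
    realize_eqq, realize_len, realize_ellTerm, realize_zero, pv, Term.realize_var, Fin.snoc_last,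
    Fin.init_snoc, LHom.realize_onFormula] at this
  exact this ⟨fun h => h0 (by simpa using h.symm), h⟩

theorem ind_node (d : IndDef n) (x : Fin n → M) {p : M} (h0 : p ≠ 0) (h : len p < ell d x) :
    ind d x p ↔ d.I.eval (Sum.elim (fun j => (d.D j).Realize (Fin.snoc x p : Fin (n + 1) → M))
      fun b => ind d x (if b then p + p + 1 else p + p)) := by
  have := realize_ind d (Or.inr (Or.inr rfl)) (Fin.snoc x p : Fin (n + 1) → M)
  simp only [axA2, realize_imp', realize_iff', realize_indAtom, realize_and, realize_ne,
    realize_lt', realize_len, realize_ellTerm, realize_zero, pv, Term.realize_var, Fin.snoc_last,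
    Fin.init_snoc, BoolForm.realize_inst, not_le] at this
  rw [this ⟨fun h => h0 (by simpa using h.symm), h⟩]
  refine iff_of_eq (congrArg (fun u => d.I.eval u) (funext fun i => ?_))
  rcases i with j | b
  · exact propext (LHom.realize_onFormula _ _)
  · refine propext ((realize_indAtom d _ x p).trans ?_)
    cases b <;> simp

/-- The two children of a node. -/
def child (q : M) (b : Bool) : M := if b then q + q + 1 else q + q

theorem len_child {q : M} (h : q ≠ 0) (b : Bool) : len (child q b) = len q + 1 := by
  cases b
  · exact len_double h
  · exact len_double_add_one q

theorem child_ne_zero {q : M} (h : q ≠ 0) (b : Bool) : child q b ≠ 0 := by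
  rw [ne_eq, ← len_eq_zero, len_child h]; exact add_one_ne_zero' _

theorem half_child (q : M) (b : Bool) : half (child q b) = q := by
  cases b
  · exact half_double q
  · exact half_double_add_one q

end Mod

/-- There is an inductively defined predicate with a tree of height `K • weight x`, with an
arbitrary truth function at the nodes and with false leaves. -/
theorem exists_indDef {n : ℕ} {ι : Type} [Finite ι] (D : ι → LBase.Formula (Fin (n + 1)))
    (hD : ∀ i, IsSigma0 (D i)) (F : (ι → Prop) → (Bool → Prop) → Prop) (K : ℕ) :
    ∃ d : IndDef n, ∀ (M : Type) [AIDModel M] (x : Fin n → M) (p : M),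
      (ind d x p → p ≠ 0 ∧ Mod.len p < K • weight x) ∧
      (p ≠ 0 → Mod.len p < K • weight x → (ind d x p ↔
        F (fun i => (D i).Realize (Fin.snoc x p : Fin (n + 1) → M))
          fun b => ind d x (child p b))) := by
  obtain ⟨m, ⟨e⟩⟩ := Finite.exists_equiv_fin ι
  obtain ⟨I, hI⟩ := BoolForm.exists_eval fun v : Fin m ⊕ Bool → Prop =>
    F (fun i => v (Sum.inl (e i))) fun b => v (Sum.inr b)
  let d : IndDef n := ⟨fun _ => K, K, ⊥, IsSigma0.bot, m, fun j => D (e.symm j), fun _ => hD _, I⟩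
  have hd : ∀ (M : Type) [AIDModel M] (x : Fin n → M), ell d x = K • weight x := by
    intro M _ x
    rw [ell, weight, smul_add, Finset.smul_sum]
  refine ⟨d, fun M _ x p => ⟨fun h => ?_, fun h0 h => ?_⟩⟩
  · obtain ⟨h0, h1⟩ := ind_le d x p h
    refine ⟨h0, lt_of_le_of_ne (hd M x ▸ h1) fun he => ?_⟩
    exact Formula.realize_bot.1 ((ind_leaf d x h0 (he.trans (hd M x).symm)).1 h)
  · rw [ind_node d x h0 (h.trans_eq (hd M x).symm), hI]
    simp [d, child]

end BoundedArith

namespace BoundedArith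

open BoundedArith.Mod

/-! ### Trees on top of trees -/

namespace Mod

variable {M : Type} [AIDModel M]

theorem SDef.ind {n m : ℕ} (d : IndDef m) {f : Fin m → (Fin n → M) → M} {g : (Fin n → M) → M}
    (hf : ∀ i, TDef (f i)) (hg : TDef g) : SDef fun v => ind d (fun i => f i v) (g v) := by
  choose t ht using hf
  obtain ⟨s, hs⟩ := hg
  refine ⟨Relations.formula (L := LAID) (n := m + 1) (Sum.inr (IndPred.mk d)) (Fin.snoc t s),
    IsSigma0.rel _ _, fun v => ?_⟩
  rw [Formula.realize_rel]
  refine iff_of_eq (congrArg _ (funext fun i => ?_))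
  refine Fin.lastCases ?_ (fun i => ?_) i
  · simp [hs]
  · simp [ht]

theorem SDef.realizeBase {n m : ℕ} {φ : LBase.Formula (Fin m)} (hφ : IsSigma0 φ)
    {f : Fin m → (Fin n → M) → M} (hf : ∀ i, TDef (f i)) :
    SDef fun v => φ.Realize fun i => f i v :=
  (SDef.realize (φ := incl.onFormula φ) hφ.onFormula hf).congr fun v => by
    rw [LHom.realize_onFormula]

theorem TDef.realizeBase {n m : ℕ} (t : LBase.Term (Fin m))
    {f : Fin m → (Fin n → M) → M} (hf : ∀ i, TDef (f i)) :
    TDef fun v => t.realize fun i => f i v := by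
  choose s hs using hf
  refine ⟨(incl.onTerm t).subst s, fun v => ?_⟩
  rw [Term.realize_subst, LHom.realize_onTerm]
  simp only [hs]

theorem TDef.snoc {n m : ℕ} (x : Fin m → M) {f : (Fin n → M) → M} (hf : TDef f) (i : Fin (m + 1)) :
    TDef fun v => (Fin.snoc x (f v) : Fin (m + 1) → M) i := by
  refine Fin.lastCases ?_ (fun i => ?_) i
  · simpa using hf
  · simpa using TDef.const (x i)

/-- The ancestor of `q` of length `k`. -/
def anc (q k : M) : M := msp q (len q - k)

/-- If a tree with root `s` is put on top of the node of length `k` below `q`, then this is the node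
of that tree at the place of `q`. -/
def sim (s q k : M) : M := pad s (msp q k) + part q 0 (len q - k)

theorem anc_self {q k : M} (h : len q = k) : anc q k = q := by
  rw [anc, h, tsub_self, msp_zero]

theorem len_anc {q k : M} (h : k ≤ len q) : len (anc q k) = k := by
  rw [anc, len_msp, tsub_tsub_cancel_of_le h]

theorem len_child_sub {q k : M} (hq : q ≠ 0) (h : k ≤ len q) (b : Bool) :
    len (child q b) - k = len q - k + 1 := by
  rw [len_child hq]
  exact tsub_add_eq_add_tsub h |>.symm

theorem anc_child {q k : M} (hq : q ≠ 0) (h : k ≤ len q) (b : Bool) :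
    anc (child q b) k = anc q k := by
  rw [anc, len_child_sub hq h, msp_succ, ← half_msp, half_child]
  rfl

theorem sim_self {s q k : M} (h : len q = k) : sim s q k = s := by
  rw [sim, h, tsub_self, msp_of_len_le h.le, pad_zero, part_of_le _ le_rfl, add_zero]

theorem sim_child {s q k : M} (hq : q ≠ 0) (h : k ≤ len q) (b : Bool) :
    sim s (child q b) k = child (sim s q k) b := by
  have e : pad s (msp (child q b) k) = pad s (msp q k) + pad s (msp q k) :=
    pad_succ s (by rw [len_msp, len_msp, len_child_sub hq h])
  rw [sim, len_child_sub hq h, e]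
  cases b
  · simp only [child, Bool.false_eq_true, if_false, part_double, sim]
    abel
  · simp only [child, if_true, part_double_add_one, sim]
    abel

theorem len_sim {s q k : M} (hs : s ≠ 0) : len (sim s q k) = len s + (len q - k) := by
  have hy : len (msp q k) = len q - k := len_msp q k
  have hr : part q 0 (len q - k) < pad 1 (msp q k) := by
    rw [← len_le_iff, hy]
    exact len_part_le q hy.ge
  have h := len_msp (sim s q k) (len (msp q k))
  have h1 : msp (sim s q k) (len (msp q k)) = s := (msp_pad_add hr).1
  rw [h1, hy] at h
  have : len q - k ≤ len (sim s q k) := by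
    by_contra hlt
    rw [tsub_eq_zero_of_le (not_le.1 hlt).le] at h
    exact hs (len_eq_zero.1 h)
  rw [h, tsub_add_cancel_of_le this]

theorem sim_ne_zero {s q k : M} (hs : s ≠ 0) : sim s q k ≠ 0 := by
  intro h
  have := len_sim (q := q) (k := k) hs
  rw [h, len_zero] at this
  exact hs (len_eq_zero.1 (add_eq_zero.1 this.symm).1)

end Mod

/-- The substitution of `u` for the last variable. -/
def lastTo {n m : ℕ} (f : Fin n → LBase.Term (Fin m)) (u : LBase.Term (Fin m)) :
    Fin (n + 1) → LBase.Term (Fin m) := Fin.snoc f u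

theorem realize_lastTo {M : Type} [AIDModel M] {n m : ℕ} (f : Fin n → LBase.Term (Fin m))
    (u : LBase.Term (Fin m)) (v : Fin m → M) :
    (fun a => (lastTo f u a).realize v) = Fin.snoc (fun i => (f i).realize v) (u.realize v) := by
  funext i
  refine Fin.lastCases ?_ (fun i => ?_) i <;> simp [lastTo]

section Composition

variable {n N : ℕ} (T : LBase.Term (Fin n)) (d : Bool → IndDef N) (c : LBase.Formula (Fin (n + 1)))
  (t : Fin N → LBase.Term (Fin (n + 1))) (s : LBase.Term (Fin (n + 1)))

/-- The height `T` of the tree below, as a term in its parameters and the node `q`. -/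
def compTop : LBase.Term (Fin (n + 1)) := T.relabel Fin.castSucc

/-- The substitution of the ancestor of `q` at the height `T` for the node. -/
def compSub : Fin (n + 1) → LBase.Term (Fin (n + 1)) :=
  lastTo (fun i => Term.var i.castSucc)
    (msp (Term.var (Fin.last n)) (len (Term.var (Fin.last n)) - compTop T))

/-- The parameters of the tree that hangs at the ancestor of `q` at the height `T`. -/
def compParam (i : Fin N) : LBase.Term (Fin (n + 1)) :=
  (t i).subst (compSub T)

/-- The node of the hanging tree that corresponds to `q`: the digits of its root `s`, followed by the
digits of `q` below the height `T`. -/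
def compNode : LBase.Term (Fin (n + 1)) :=
  pad (s.subst (compSub T)) (msp (Term.var (Fin.last n)) (compTop T)) +
    part (Term.var (Fin.last n)) 0 (len (Term.var (Fin.last n)) - compTop T)

/-- `T ≤ |q|`, the tree of `d b` is the one above `q`, and its root is not `0`. -/
def compGuard (b : Bool) : LBase.Formula (Fin (n + 1)) :=
  le (compTop T) (len (Term.var (Fin.last n))) ⊓
    ((if b then c.subst (compSub T) else ∼(c.subst (compSub T))) ⊓ ne (s.subst (compSub T)) 0)

/-- The height of the tree of `d b` for the parameters `compParam`. -/
def compEll (b : Bool) : LBase.Term (Fin (n + 1)) :=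
  (toBase (ellTerm (d b))).subst (lastTo (compParam T t) 0)

/-- The formulae by which the nodes of the composed tree are evaluated. -/
def compD {ι : Type} (D : ι → LBase.Formula (Fin (n + 1))) :
    (ι ⊕ (Σ b, Fin (d b).m)) ⊕ (Unit ⊕ Bool × Bool) → LBase.Formula (Fin (n + 1))
  | .inl (.inl i) => D i
  | .inl (.inr j) => ((d j.1).D j.2).subst (lastTo (compParam T t) (compNode T s))
  | .inr (.inl _) => lt (len (Term.var (Fin.last n))) (compTop T)
  | .inr (.inr (b, false)) =>
    compGuard T c s b ⊓ lt (len (compNode T s)) (compEll T d t b)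
  | .inr (.inr (b, true)) =>
    compGuard T c s b ⊓ (eqq (len (compNode T s)) (compEll T d t b) ⊓
      (d b).B.subst (lastTo (compParam T t) (compNode T s)))

variable {T d c t s}

theorem compD_sigma0 {ι : Type} {D : ι → LBase.Formula (Fin (n + 1))} (hD : ∀ i, IsSigma0 (D i))
    (hc : IsSigma0 c) (i) : IsSigma0 (compD T d c t s D i) := by
  have hg : ∀ b, IsSigma0 (compGuard T c s b) := fun b =>
    (IsSigma0.le _ _).and (IsSigma0.and (by cases b; exacts [(hc.subst _).not, hc.subst _])
      (IsSigma0.ne _ _))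
  rcases i with (i | j) | (_ | ⟨b, _ | _⟩)
  · exact hD i
  · exact ((d j.1).D_sigma0 j.2).subst _
  · exact IsSigma0.lt _ _
  · exact (hg b).and (IsSigma0.lt _ _)
  · exact (hg b).and ((IsSigma0.eqq _ _).and ((d b).B_sigma0.subst _))

section

variable {M : Type} [AIDModel M] (x : Fin n → M) (q : M)

theorem realize_compTop :
    (compTop T).realize (Fin.snoc x q : Fin (n + 1) → M) = T.realize x := by
  rw [compTop, Term.realize_relabel]
  congr 1
  funext i
  simp

theorem realize_compSub : (fun a => (compSub T a).realize (Fin.snoc x q : Fin (n + 1) → M)) =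
    Fin.snoc x (anc q (T.realize x)) := by
  rw [compSub, realize_lastTo]
  simp [realize_compTop, anc]

theorem realize_compParam (i : Fin N) :
    (compParam T t i).realize (Fin.snoc x q : Fin (n + 1) → M) =
      (t i).realize (Fin.snoc x (anc q (T.realize x)) : Fin (n + 1) → M) := by
  rw [compParam, Term.realize_subst, realize_compSub]

theorem realize_compNode :
    (compNode T s).realize (Fin.snoc x q : Fin (n + 1) → M) =
      sim (s.realize (Fin.snoc x (anc q (T.realize x)) : Fin (n + 1) → M)) q (T.realize x) := by
  simp [compNode, Term.realize_subst, realize_compSub, realize_compTop, sim]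

theorem realize_compEll (b : Bool) :
    (compEll T d t b).realize (Fin.snoc x q : Fin (n + 1) → M) =
      ell (d b) fun i => (t i).realize (Fin.snoc x (anc q (T.realize x)) : Fin (n + 1) → M) := by
  rw [compEll, Term.realize_subst, realize_lastTo, realize_toBase, realize_ellTerm, Fin.init_snoc]
  simp only [realize_compParam]

theorem realize_compGuard (b : Bool) :
    (compGuard T c s b).Realize (Fin.snoc x q : Fin (n + 1) → M) ↔
      T.realize x ≤ Mod.len q ∧
      (c.Realize (Fin.snoc x (anc q (T.realize x)) : Fin (n + 1) → M) ↔ b = true) ∧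
      s.realize (Fin.snoc x (anc q (T.realize x)) : Fin (n + 1) → M) ≠ 0 := by
  cases b <;>
    simp [compGuard, realize_compTop, Term.realize_subst, realize_compSub, Formula.realize_not]

end

/-- Trees can be put on top of a tree: there is an inductive definition which below the height `T`
evaluates nodes by `D` and `F`, and at the height `T` has the value of another inductively defined
predicate at arbitrary arguments. -/
theorem exists_comp {ι : Type} [Finite ι] (D : ι → LBase.Formula (Fin (n + 1)))
    (hD : ∀ i, IsSigma0 (D i)) (F : (ι → Prop) → (Bool → Prop) → Prop) (hc : IsSigma0 c)
    {KT : ℕ} (hT : ∀ (M : Type) [AIDModel M] (x : Fin n → M), T.realize x ≤ KT • weight x)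
    (d : Bool → IndDef N) (t : Fin N → LBase.Term (Fin (n + 1))) (s : LBase.Term (Fin (n + 1))) :
    ∃ d' : IndDef n, ∀ (M : Type) [AIDModel M] (x : Fin n → M) (q : M), q ≠ 0 →
      (Mod.len q < T.realize x → (ind d' x q ↔
        F (fun i => (D i).Realize (Fin.snoc x q : Fin (n + 1) → M))
          fun b => ind d' x (child q b))) ∧
      (Mod.len q = T.realize x → (ind d' x q ↔ ∃ b,
        (c.Realize (Fin.snoc x q : Fin (n + 1) → M) ↔ b = true) ∧
        ind (d b) (fun i : Fin N => (t i).realize (Fin.snoc x q : Fin (n + 1) → M))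
          (s.realize (Fin.snoc x q : Fin (n + 1) → M)))) := by
  classical
  choose Kt hKt using fun i => exists_term_bound (t i)
  obtain ⟨K, hK⟩ : ∃ K : ℕ, ∀ (M : Type) [AIDModel M] (x : Fin n → M) (q : M) (b : Bool),
      Mod.len q = T.realize x → T.realize x + ell (d b) (fun i => (t i).realize
        (Fin.snoc x q : Fin (n + 1) → M)) ≤ K • weight x := by
    -- The lengths of lengths of the arguments are linearly bounded, as `‖q‖ ≤ |q| = T`.
    refine ⟨KT + ((∑ i, (d true).coeff i + (d true).const) +
      (∑ i, (d false).coeff i + (d false).const)) * ((∑ i, Kt i) * (1 + KT) + 1), ?_⟩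
    intro M _ x q b hq
    rw [add_smul]
    refine add_le_add (hT M x) ?_
    refine (ell_le _ _).trans ?_
    rw [mul_smul]
    refine (nsmul_le_nsmul_right (b := ((∑ i, Kt i) * (1 + KT) + 1) • weight x) ?_ _).trans
      (nsmul_le_nsmul_left zero_le (by cases b <;> omega))
    rw [weight, add_smul, one_smul]
    refine add_le_add ?_ (one_le_weight x)
    rw [mul_smul, Finset.sum_smul]
    refine Finset.sum_le_sum fun i _ => (hKt i M _).trans (nsmul_le_nsmul_right ?_ _)
    rw [weight_snoc, add_smul, one_smul]
    exact add_le_add_right ((len_le_self _).trans (hq.le.trans (hT M x))) _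
  obtain ⟨d', hd'⟩ := exists_indDef (compD T d c t s D) (compD_sigma0 hD hc)
    (fun v ch => (v (.inr (.inl ())) ∧ F (fun i => v (.inl (.inl i))) ch) ∨
      (∃ b, v (.inr (.inr (b, false))) ∧
        (d b).I.eval (Sum.elim (fun j => v (.inl (.inr ⟨b, j⟩))) ch)) ∨
      ∃ b, v (.inr (.inr (b, true)))) K
  refine ⟨d', fun M _ x q hq => ?_⟩
  set H := K • weight x with hH
  have hHt : Tiny H := (tiny_weight x).nsmul K
  have hTH : T.realize x ≤ H := by
    obtain ⟨y, hy⟩ := (((tiny_weight x).nsmul KT).of_le (hT M x)).exists_len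
    exact le_self_add.trans (hK M x y true hy)
  -- The value at a node `q` above the height `T`.
  set L : M → Bool → Prop := fun q b =>
    (c.Realize (Fin.snoc x (anc q (T.realize x)) : Fin (n + 1) → M) ↔ b = true) ∧
    s.realize (Fin.snoc x (anc q (T.realize x)) : Fin (n + 1) → M) ≠ 0 ∧
    ind (d b) (fun i => (t i).realize (Fin.snoc x (anc q (T.realize x)) : Fin (n + 1) → M))
      (sim (s.realize (Fin.snoc x (anc q (T.realize x)) : Fin (n + 1) → M)) q (T.realize x)) with hL
  have key : ∀ k, k ≤ H → ∀ q, Mod.len q + k = H → T.realize x ≤ Mod.len q → q ≠ 0 →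
      (ind d' x q ↔ ∃ b, L q b) := by
    obtain ⟨w, hw⟩ := hHt.exists_bound
    obtain ⟨w', hw'⟩ := hHt.small
    intro k hk
    have := length_induction (P := fun k => ∀ q, q ≤ Mod.len w → Mod.len q + k = H →
        T.realize x ≤ Mod.len q → q ≠ 0 → (ind d' x q ↔ ∃ b, L q b)) ?_ w' ?_ ?_ k (hk.trans hw')
    · intro q hq
      exact this q (hw q (le_self_add.trans hq.le)) hq
    · have h1 : TDef fun v : Fin 2 → M => anc (v 0) (T.realize x) := by unfold anc; fun_prop
      have h2 : TDef fun v : Fin 2 → M => s.realize (Fin.snoc x (anc (v 0) (T.realize x)) :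
          Fin (n + 1) → M) := TDef.realizeBase s (TDef.snoc x h1)
      refine SDef.all (by fun_prop) (SDef.imp (by fun_prop) (SDef.imp (by fun_prop) (SDef.imp
        (by fun_prop) (SDef.iff (SDef.ind d' (fun i => TDef.const _) (by fun_prop))
        (SDef.exists_finite fun b => SDef.and (SDef.iff (SDef.realizeBase hc (TDef.snoc x h1))
          (SDef.const _)) (SDef.and (SDef.not (SDef.eq h2 (by fun_prop)))
          (SDef.ind (d b) (fun i => TDef.realizeBase (t i) (TDef.snoc x h1)) ?_)))))))
      unfold sim
      fun_prop
    · intro q _ hq hTq hq0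
      rw [add_zero] at hq
      refine iff_of_false (fun h => ((hd' M x q).1 h).2.ne hq) ?_
      rintro ⟨b, -, h0, h⟩
      have h2 := (ind_le _ _ _ h).2
      rw [len_sim h0, hq] at h2
      have h3 := hK M x _ b (len_anc hTq)
      have h4 : 1 ≤ Mod.len (s.realize (Fin.snoc x (anc q (T.realize x)) : Fin (n + 1) → M)) :=
        (ne_zero_iff _).1 (by simpa using h0)
      have h5 := tsub_add_cancel_of_le hTH
      rw [← hH] at h3
      generalize Mod.len (s.realize (Fin.snoc x (anc q (T.realize x)) : Fin (n + 1) → M)) = a at *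
      generalize ell (M := M) (d b) _ = e at *
      clear hd' hL
      grind [zero_lt_one' (M := M)]
    · intro k _ ih q hqw hq hTq hq0
      have hlt : Mod.len q < H := by
        rw [← hq]; exact lt_add_of_pos_right _ (pos_iff_ne_zero.2 (add_one_ne_zero' k))
      rw [(hd' M x q).2 hq0 hlt]
      have hch : ∀ b, ind d' x (child q b) ↔ ∃ b', L (child q b) b' := by
        intro b
        have hl : Mod.len (child q b) + k = H := by
          rw [len_child hq0, ← hq]; abel
        refine ih _ (hw _ (le_self_add.trans hl.le)) hl ?_ (child_ne_zero hq0 b)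
        rw [len_child hq0]
        exact hTq.trans le_self_add
      simp only [hch]
      simp only [hL, anc_child hq0 hTq, sim_child hq0 hTq]
      simp only [compD, realize_lt', realize_compTop, realize_len, Term.realize_var, Fin.snoc_last,
        hTq, not_true, false_and, false_or, realize_and, realize_compGuard, true_and,
        realize_compNode, realize_compEll, realize_formula_subst, realize_lastTo, realize_compParam,
        realize_eqq, not_le]
      generalize hu : (Fin.snoc x (anc q (T.realize x)) : Fin (n + 1) → M) = u
      obtain ⟨b, hb⟩ : ∃ b : Bool, c.Realize u ↔ b = true := by
        by_cases h : c.Realize u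
        · exact ⟨true, by simp [h]⟩
        · exact ⟨false, by simp [h]⟩
      have hb' : ∀ b', (b = true ↔ b' = true) ↔ b' = b := by
        intro b'; cases b <;> cases b' <;> simp
      simp only [hb, hb', and_assoc, exists_eq_left]
      by_cases h0 : s.realize u = 0
      · simp [h0]
      simp only [ne_eq, h0, not_false_eq_true, true_and]
      have hs0 := sim_ne_zero (q := q) (k := T.realize x) h0
      rcases lt_trichotomy (Mod.len (sim (s.realize u) q (T.realize x)))
        (ell (d b) fun i => (t i).realize u) with h | h | h
      · rw [ind_node (d b) _ hs0 h]
        simp only [h, h.ne, true_and, false_and, or_false]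
        rfl
      · rw [ind_leaf (d b) _ hs0 h]
        simp [h]
      · refine iff_of_false ?_ fun h' => (not_le.2 h) (ind_le _ _ _ h').2
        simp [h.not_gt, h.ne']
  refine ⟨fun h => ?_, fun h => ?_⟩
  · rw [(hd' M x q).2 hq (h.trans_le hTH)]
    have hn := not_le.2 h
    simp only [compD, realize_lt', realize_compTop, realize_len, Term.realize_var, Fin.snoc_last,
      hn, realize_and, realize_compGuard, false_and, or_false, exists_false, not_false_eq_true,
      true_and]
  · rw [key (H - Mod.len q) tsub_le_self q (add_tsub_cancel_of_le (h ▸ hTH)) h.ge hq]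
    refine exists_congr fun b => ?_
    simp only [hL, anc_self h, sim_self h]
    refine and_congr_right fun _ => ⟨fun h => h.2, fun h => ⟨?_, h⟩⟩
    exact (ind_le _ _ _ h).1

end Composition

end BoundedArith

namespace BoundedArith

open BoundedArith.Mod

/-! ### Normal forms -/

namespace Mod

variable {M : Type} [AIDModel M]

theorem half_ne_zero {q : M} (h : 1 < len q) : half q ≠ 0 := by
  have hq : q ≠ 0 := fun h' => by simp [h'] at h
  have := len_half hq
  intro h0
  rw [h0, len_zero, zero_add] at this
  exact h.ne' this

theorem child_half (q : M) : ∃ b, child (half q) b = q := by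
  rcases half_cases q with h | h
  · exact ⟨false, h.symm⟩
  · exact ⟨true, h.symm⟩

/-- The value of a tree of conjunctions. -/
theorem and_tree {A : M → Prop} (hA : SDef fun v : Fin 1 → M => A (v 0)) {T : M} (hT : Tiny T)
    (h : ∀ q, q ≠ 0 → len q < T → (A q ↔ A (child q false) ∧ A (child q true))) (h1 : 1 ≤ T) :
    A 1 ↔ ∀ q, len q = T → A q := by
  obtain ⟨w, hw⟩ := hT.exists_bound
  obtain ⟨w', hw'⟩ := hT.small
  have := length_induction (P := fun k => 1 ≤ k → k ≤ T → (A 1 ↔ ∀ q, q ≤ len w → len q = k → A q))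
    ?_ w' ?_ ?_ T hw' h1 le_rfl
  · exact this.trans ⟨fun h q hq => h q (hw q hq.le) hq, fun h q _ hq => h q hq⟩
  · exact SDef.imp (by fun_prop) (SDef.imp (by fun_prop) (SDef.iff (hA.comp₁ (TDef.const _))
      (SDef.all (by fun_prop) (SDef.imp (by fun_prop) (hA.comp₁ (by fun_prop))))))
  · intro h
    exact absurd h (not_le.2 zero_lt_one')
  intro k _ ih _ hkT
  rcases eq_or_ne k 0 with rfl | hk
  · rw [zero_add]
    refine ⟨fun h q _ hq => by rwa [eq_one_of_len_eq_one hq], fun h => h 1 (hw 1 (by simpa)) len_one⟩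
  rw [ih ((ne_zero_iff k).1 hk) (le_self_add.trans hkT)]
  constructor
  · intro h' q _ hq
    have hh : half q ≠ 0 := half_ne_zero (by
      rw [hq]; exact lt_add_of_pos_left 1 (pos_iff_ne_zero.2 hk))
    obtain ⟨b, hb⟩ := child_half q
    have hl : len (half q) = k := by
      have := len_child hh b
      rw [hb, hq] at this
      exact (add_right_cancel this).symm
    have := (h (half q) hh (by rw [hl]; exact (lt_iff _ _).2 hkT)).1
      (h' _ (hw _ (hl.le.trans (le_self_add.trans hkT))) hl)
    cases b
    · rw [← hb]; exact this.1
    · rw [← hb]; exact this.2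
  · intro h' q _ hq
    have hq0 : q ≠ 0 := fun h0 => hk (by rw [← hq, h0, len_zero])
    refine (h q hq0 (by rw [hq]; exact (lt_iff _ _).2 hkT)).2 ⟨?_, ?_⟩ <;>
    · have hl := len_child hq0
      refine h' _ (hw _ ?_) ?_ <;> rw [hl, hq]
      exact hkT

end Mod

/-- A formula without inductively defined predicates is the value of a tree that consists of its
root and leaves. The truth function ignores the leaves. -/
theorem exists_normal_base {N : ℕ} (χ : LBase.Formula (Fin N)) (hχ : IsSigma0 χ) :
    ∃ d : IndDef N, ∀ (M : Type) [AIDModel M] (w : Fin N → M), ind d w 1 ↔ χ.Realize w := by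
  obtain ⟨d, hd⟩ := exists_indDef (fun _ : Unit => χ.relabel Fin.castSucc)
    (fun _ => hχ.formula_relabel _) (fun v _ => v ()) 2
  refine ⟨d, fun M _ w => ?_⟩
  rw [(hd M w 1).2 one_ne_zero', Formula.realize_relabel]
  · refine iff_of_eq (congrArg _ (funext fun i => ?_))
    simp
  · rw [len_one, two_nsmul]
    exact (one_le_weight w).trans_lt (lt_add_of_pos_right _ (zero_lt_one'.trans_le (one_le_weight w)))

/-- Every `Σ₀ᵇ`-formula is equivalent in all models to an inductively defined predicate at the root
of its tree. -/
theorem exists_normal {α : Type} {m : ℕ} {φ : LAID.BoundedFormula α m} (hφ : IsSigma0 φ) :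
    ∀ (N : ℕ) (g : α ⊕ Fin m → Fin N), ∃ d : IndDef N, ∀ (M : Type) [AIDModel M] (w : Fin N → M),
      ind d w 1 ↔ φ.Realize (fun a => w (g (Sum.inl a))) fun i => w (g (Sum.inr i)) := by
  have hsum : ∀ (M : Type) (m N : ℕ) (g : α ⊕ Fin m → Fin N) (w : Fin N → M),
      Sum.elim (fun a => w (g (Sum.inl a))) (fun i => w (g (Sum.inr i))) = w ∘ g := by
    intro M m N g w
    funext i
    rcases i with i | i <;> rfl
  induction hφ with
  | falsum =>
    intro N g
    obtain ⟨d, hd⟩ := exists_normal_base (⊥ : LBase.Formula (Fin N)) IsSigma0.bot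
    exact ⟨d, fun M _ w => (hd M w).trans Formula.realize_bot⟩
  | equal s t =>
    intro N g
    obtain ⟨d, hd⟩ := exists_normal_base (eqq (toBase (s.relabel g)) (toBase (t.relabel g)))
      (IsSigma0.eqq _ _)
    refine ⟨d, fun M _ w => (hd M w).trans ?_⟩
    rw [realize_eqq, realize_toBase, realize_toBase, Term.realize_relabel, Term.realize_relabel]
    simp only [BoundedFormula.Realize, hsum]
  | @rel m l R ts =>
    intro N g
    rcases R with R | R
    · cases R
      obtain ⟨d, hd⟩ := exists_normal_base (le (toBase ((ts 0).relabel g)) (toBase ((ts 1).relabel g)))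
        (IsSigma0.le _ _)
      refine ⟨d, fun M _ w => (hd M w).trans ?_⟩
      rw [realize_le, realize_toBase, realize_toBase, Term.realize_relabel, Term.realize_relabel]
      simp only [BoundedFormula.Realize, hsum]
      refine iff_of_eq (congrArg _ (funext fun i => ?_))
      refine Fin.cases rfl (fun i => ?_) i
      rw [Subsingleton.elim i 0]
      rfl
    · obtain ⟨d⟩ := R
      rename_i n
      obtain ⟨d', hd'⟩ := exists_comp (T := 1) (c := ⊤) (KT := 1) (fun i : Empty => i.elim)
        (fun i => i.elim) (fun _ _ => False) IsSigma0.top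
        (fun M _ x => by rw [realize_one, one_nsmul]; exact one_le_weight x) (fun _ => d)
        (fun i => (toBase ((ts i.castSucc).relabel g)).relabel Fin.castSucc)
        ((toBase ((ts (Fin.last n)).relabel g)).relabel Fin.castSucc)
      refine ⟨d', fun M _ w => ?_⟩
      rw [(hd' M w 1 one_ne_zero').2 (by simp)]
      have hw : (Fin.snoc w 1 : Fin (N + 1) → M) ∘ Fin.castSucc = w := by
        funext i; simp
      simp only [Term.realize_relabel, realize_toBase, hw]
      simp only [BoundedFormula.Realize, hsum, Formula.realize_top, true_iff, exists_eq_left]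
      refine iff_of_eq (congrArg _ (funext fun i => ?_))
      refine Fin.lastCases ?_ (fun i => ?_) i
      · simp
      · simp
  | imp _ _ h₁ h₂ =>
    intro N g
    obtain ⟨d₁, h₁⟩ := h₁ N g
    obtain ⟨d₂, h₂⟩ := h₂ N g
    obtain ⟨d', hd'⟩ := exists_comp (T := 1 + 1) (c := eqq (bit 0 (Term.var (Fin.last N))) 1)
      (KT := 2) (fun i : Empty => i.elim) (fun i => i.elim) (fun _ ch => ch false → ch true)
      (IsSigma0.eqq _ _) (fun M _ x => by
        rw [realize_add, realize_one, two_nsmul]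
        exact add_le_add (one_le_weight x) (one_le_weight x))
      (fun b => if b then d₂ else d₁) (fun i => Term.var i.castSucc) 1
    refine ⟨d', fun M _ w => ?_⟩
    rw [(hd' M w 1 one_ne_zero').1 (by simp), BoundedFormula.realize_imp, ← h₁, ← h₂]
    have hch : ∀ b, ind d' w (child 1 b) ↔ ind (if b then d₂ else d₁) w 1 := by
      intro b
      rw [(hd' M w (child 1 b) (child_ne_zero one_ne_zero' b)).2
        (by rw [len_child one_ne_zero']; simp)]
      have hb : Mod.bit 0 (child (1 : M) b) = 1 ↔ b = true := by
        cases b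
        · simp [child]
        · simp [child]
      simp only [realize_eqq, realize_bit, realize_zero, Term.realize_var, Fin.snoc_last,
        realize_one, hb, Fin.snoc_castSucc]
      constructor
      · rintro ⟨b', h, h'⟩
        rwa [Bool.eq_iff_iff.2 h]
      · intro h
        exact ⟨b, Iff.rfl, h⟩
    simp [hch]
  | @ball m t φ _ ih =>
    intro N g
    obtain ⟨d, hd⟩ := ih (N + 1)
      (Sum.elim (fun a => (g (Sum.inl a)).castSucc) (Fin.snoc (fun i => (g (Sum.inr i)).castSucc)
        (Fin.last N)))
    set tb : LBase.Term (Fin N) := toBase (t.relabel g) with htb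
    obtain ⟨K, hK⟩ := exists_term_bound tb
    have hTK : ∀ (M : Type) [AIDModel M] (x : Fin N → M),
        (len (len tb) + 1).realize x ≤ (K + 1) • weight x := by
      intro M _ x
      rw [realize_add, realize_one, add_smul, one_smul, realize_len, realize_len]
      exact add_le_add (hK M x) (one_le_weight x)
    -- The remainder of the node modulo `2 ^ ‖t‖`, cut off at `|t|`.
    set tl : LBase.Term (Fin (N + 1)) := len (tb.relabel Fin.castSucc) with htl
    set r : LBase.Term (Fin (N + 1)) := part (Term.var (Fin.last N)) 0 (len tl) with hr
    obtain ⟨d', hd'⟩ := exists_comp (T := len (len tb) + 1) (c := ⊤) (KT := K + 1)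
      (fun i : Empty => i.elim) (fun i => i.elim) (fun _ ch => ch false ∧ ch true) IsSigma0.top hTK
      (fun _ => d) (Fin.snoc (fun i => Term.var i.castSucc) (tl - (tl - r))) 1
    refine ⟨d', fun M _ w => ?_⟩
    have hT : Tiny ((len (len tb) + 1).realize w) :=
      ((tiny_weight w).nsmul _).of_le (hTK M w)
    rw [and_tree (A := ind d' w) (SDef.ind d' (fun i => TDef.const _) (TDef.var 0)) hT
      (fun q hq hl => (hd' M w q hq).1 hl) (by simp)]
    have htv : tb.realize w = t.realize (Sum.elim (fun a => w (g (Sum.inl a)))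
        fun i => w (g (Sum.inr i))) := by
      rw [htb, realize_toBase, Term.realize_relabel, hsum]
    have htl' : ∀ q, tl.realize (Fin.snoc w q : Fin (N + 1) → M) = Mod.len (tb.realize w) := by
      intro q
      rw [htl, realize_len, Term.realize_relabel]
      congr 2
      funext i
      simp
    set a := Mod.len (tb.realize w) with ha
    have hleaf : ∀ q, Mod.len q = (len (len tb) + 1).realize w → (ind d' w q ↔
        φ.Realize (fun a => w (g (Sum.inl a)))
          (Fin.snoc (fun i => w (g (Sum.inr i))) (a - (a - Mod.part q 0 (Mod.len a))))) := by
      intro q hq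
      have hq0 : q ≠ 0 := by
        rintro rfl
        rw [len_zero, realize_add, realize_one] at hq
        exact add_one_ne_zero' _ hq.symm
      rw [(hd' M w q hq0).2 hq]
      simp only [Formula.realize_top, true_iff, exists_eq_left, realize_one]
      have e : (fun i => Term.realize (Fin.snoc w q : Fin (N + 1) → M)
          ((Fin.snoc (fun i => Term.var i.castSucc) (tl - (tl - r)) :
            Fin (N + 1) → LBase.Term (Fin (N + 1))) i)) =
          Fin.snoc w (a - (a - Mod.part q 0 (Mod.len a))) := by
        funext i
        refine Fin.lastCases ?_ (fun i => ?_) i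
        · simp only [Fin.snoc_last, realize_sub, htl', hr, realize_part, Term.realize_var,
            realize_zero, realize_len]
        · simp
      rw [e, hd]
      refine iff_of_eq (congrArg₂ _ ?_ ?_)
      · funext i; simp
      · funext i
        refine Fin.lastCases ?_ (fun i => ?_) i <;> simp
    have hR : (BoundedFormula.all ((Relations.boundedFormula (L := LAID) (n := 2)
        (Sum.inl BARel.le) ![Term.var (Sum.inr (Fin.last m)),
          len (t.relabel (Sum.map id Fin.castSucc))]).imp φ)).Realize
        (fun a => w (g (Sum.inl a))) (fun i => w (g (Sum.inr i))) ↔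
        ∀ z, z ≤ a → φ.Realize (fun a => w (g (Sum.inl a)))
          (Fin.snoc (fun i => w (g (Sum.inr i))) z) := by
      rw [BoundedFormula.realize_all]
      refine forall_congr' fun z => ?_
      rw [BoundedFormula.realize_imp, BoundedFormula.realize_rel]
      refine imp_congr_left (iff_of_eq (congrArg _ (funext fun i => ?_)))
      refine Fin.cases (by simp) (fun i => ?_) i
      rw [Subsingleton.elim i 0]
      simp only [Matrix.cons_val_succ, Matrix.cons_val_zero, realize_len, Term.realize_relabel, ha,
        htv]
      congr 2
      funext i
      rcases i with i | i <;> simp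
    rw [hR]
    constructor
    · intro h z hz
      have hlen : Mod.len (Mod.pad 1 a + z) = Mod.len a + 1 := by
        have hz' : z < Mod.pad 1 a := hz.trans_lt (lt_pad_one a)
        refine le_antisymm ?_ ?_
        · have e : Mod.pad 1 (a + a + 1) = Mod.pad 1 a + Mod.pad 1 a :=
            pad_succ 1 (len_double_add_one a)
          rw [← len_double_add_one a, len_le_iff, e]
          exact add_lt_add_of_le_of_lt le_rfl hz'
        · refine le_trans ?_ (len_mono (le_self_add (a := Mod.pad 1 a)))
          rw [len_pad one_ne_zero', len_one, add_comm]
      have := (hleaf _ (by simpa using hlen)).1 (h _ (by simpa using hlen))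
      rw [part_pad_add _ _ le_rfl, part_zero_of_len_le _ _ (len_mono hz),
        tsub_tsub_cancel_of_le hz] at this
      exact this
    · intro h q hq
      exact (hleaf q hq).2 (h _ tsub_le_self)

/-- Definition by recursion on a tree: `F` gives the value at an inner node of the tree from the
values at the children and the truth values of the formulae `D`, and the value of a node of length
`T` is given by a `Σ₀ᵇ`-formula which may itself contain inductively defined predicates. -/
theorem exists_tree {n : ℕ} {ι : Type} [Finite ι] (T : LBase.Term (Fin n)) {KT : ℕ}
    (hT : ∀ (M : Type) [AIDModel M] (x : Fin n → M), T.realize x ≤ KT • weight x)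
    (D : ι → LBase.Formula (Fin (n + 1))) (hD : ∀ i, IsSigma0 (D i))
    (F : (ι → Prop) → (Bool → Prop) → Prop) {φ : LAID.Formula (Fin (n + 1))} (hφ : IsSigma0 φ) :
    ∃ d : IndDef n, ∀ (M : Type) [AIDModel M] (x : Fin n → M) (q : M), q ≠ 0 →
      (Mod.len q < T.realize x → (ind d x q ↔
        F (fun i => (D i).Realize (Fin.snoc x q : Fin (n + 1) → M))
          fun b => ind d x (child q b))) ∧
      (Mod.len q = T.realize x → (ind d x q ↔ φ.Realize (Fin.snoc x q : Fin (n + 1) → M))) := by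
  obtain ⟨d, hd⟩ := exists_normal hφ (n + 1) (Sum.elim id Fin.elim0)
  obtain ⟨d', hd'⟩ := exists_comp (c := ⊤) D hD F IsSigma0.top hT (fun _ => d) Term.var 1
  refine ⟨d', fun M _ x q hq => ⟨(hd' M x q hq).1, fun h => ?_⟩⟩
  rw [(hd' M x q hq).2 h]
  simp only [Formula.realize_top, true_iff, exists_eq_left, realize_one, Term.realize_var, hd]
  refine iff_of_eq (congrArg₂ _ rfl (Subsingleton.elim _ _))

end BoundedArith

namespace BoundedArith

open BoundedArith.Mod

/-! ### Uniform definability -/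

/-- A term without parameters defines `f` in all models. -/
def UTDef {n : ℕ} (f : ∀ (M : Type) [AIDModel M], (Fin n → M) → M) : Prop :=
  ∃ t : LAID.Term (Fin n), ∀ (M : Type) [AIDModel M] (v : Fin n → M), t.realize v = f M v

/-- A `Σ₀ᵇ`-formula without parameters defines `P` in all models. -/
def UDef {n : ℕ} (P : ∀ (M : Type) [AIDModel M], (Fin n → M) → Prop) : Prop :=
  ∃ φ : LAID.Formula (Fin n), IsSigma0 φ ∧
    ∀ (M : Type) [AIDModel M] (v : Fin n → M), φ.Realize v ↔ P M v

section

variable {n : ℕ} {f g h : ∀ (M : Type) [AIDModel M], (Fin n → M) → M}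
  {P Q : ∀ (M : Type) [AIDModel M], (Fin n → M) → Prop}

namespace UTDef

theorem var (i : Fin n) : UTDef fun _ _ v => v i := ⟨Term.var i, fun _ _ _ => rfl⟩

theorem zero : UTDef fun M _ (_ : Fin n → M) => (0 : M) := ⟨0, fun _ _ _ => by simp⟩

theorem one : UTDef fun M _ (_ : Fin n → M) => (1 : M) := ⟨1, fun _ _ _ => by simp⟩

theorem add (hf : UTDef f) (hg : UTDef g) : UTDef fun M _ v => f M v + g M v :=
  let ⟨s, hs⟩ := hf; let ⟨t, ht⟩ := hg
  ⟨s + t, fun M _ v => by simp [hs, ht]⟩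

theorem sub (hf : UTDef f) (hg : UTDef g) : UTDef fun M _ v => f M v - g M v :=
  let ⟨s, hs⟩ := hf; let ⟨t, ht⟩ := hg
  ⟨s - t, fun M _ v => by simp [hs, ht]⟩

theorem nsmul (c : ℕ) (hf : UTDef f) : UTDef fun M _ v => c • f M v :=
  let ⟨s, hs⟩ := hf
  ⟨times c s, fun M _ v => by simp [realize_times, hs]⟩

theorem half (hf : UTDef f) : UTDef fun M _ v => Mod.half (f M v) :=
  let ⟨s, hs⟩ := hf
  ⟨BoundedArith.half s, fun M _ v => by simp [hs]⟩

theorem len (hf : UTDef f) : UTDef fun M _ v => Mod.len (f M v) :=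
  let ⟨s, hs⟩ := hf
  ⟨BoundedArith.len s, fun M _ v => by simp [hs]⟩

theorem smash (hf : UTDef f) (hg : UTDef g) : UTDef fun M _ v => Mod.smash (f M v) (g M v) :=
  let ⟨s, hs⟩ := hf; let ⟨t, ht⟩ := hg
  ⟨BoundedArith.smash s t, fun M _ v => by simp [hs, ht]⟩

theorem pad (hf : UTDef f) (hg : UTDef g) : UTDef fun M _ v => Mod.pad (f M v) (g M v) :=
  let ⟨s, hs⟩ := hf; let ⟨t, ht⟩ := hg
  ⟨BoundedArith.pad s t, fun M _ v => by simp [hs, ht]⟩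

theorem part (hf : UTDef f) (hg : UTDef g) (hh : UTDef h) :
    UTDef fun M _ v => Mod.part (f M v) (g M v) (h M v) :=
  let ⟨s, hs⟩ := hf; let ⟨t, ht⟩ := hg; let ⟨u, hu⟩ := hh
  ⟨BoundedArith.part s t u, fun M _ v => by simp [hs, ht, hu]⟩

theorem bit (hf : UTDef f) (hg : UTDef g) : UTDef fun M _ v => Mod.bit (f M v) (g M v) :=
  let ⟨s, hs⟩ := hf; let ⟨t, ht⟩ := hg
  ⟨BoundedArith.bit s t, fun M _ v => by simp [hs, ht]⟩

theorem msp (hf : UTDef f) (hg : UTDef g) : UTDef fun M _ v => Mod.msp (f M v) (g M v) :=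
  let ⟨s, hs⟩ := hf; let ⟨t, ht⟩ := hg
  ⟨BoundedArith.msp s t, fun M _ v => by simp [hs, ht]⟩

theorem lmul (hf : UTDef f) (hg : UTDef g) : UTDef fun M _ v => Mod.lmul (f M v) (g M v) :=
  (hf.smash hg).half.len

end UTDef

namespace UDef

theorem le (hf : UTDef f) (hg : UTDef g) : UDef fun M _ v => f M v ≤ g M v :=
  let ⟨s, hs⟩ := hf; let ⟨t, ht⟩ := hg
  ⟨BoundedArith.le s t, IsSigma0.le _ _, fun M _ v => by simp [hs, ht]⟩

theorem lt (hf : UTDef f) (hg : UTDef g) : UDef fun M _ v => f M v < g M v :=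
  let ⟨s, hs⟩ := hf; let ⟨t, ht⟩ := hg
  ⟨BoundedArith.lt s t, IsSigma0.lt _ _, fun M _ v => by simp [hs, ht]⟩

theorem eq (hf : UTDef f) (hg : UTDef g) : UDef fun M _ v => f M v = g M v :=
  let ⟨s, hs⟩ := hf; let ⟨t, ht⟩ := hg
  ⟨BoundedArith.eqq s t, IsSigma0.eqq _ _, fun M _ v => by simp [hs, ht]⟩

theorem not (hP : UDef P) : UDef fun M _ v => ¬ P M v :=
  let ⟨φ, s, hs⟩ := hP
  ⟨∼φ, s.not, fun M _ v => by simp [hs, Formula.realize_not]⟩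

theorem and (hP : UDef P) (hQ : UDef Q) : UDef fun M _ v => P M v ∧ Q M v :=
  let ⟨φ, s, hs⟩ := hP; let ⟨ψ, t, ht⟩ := hQ
  ⟨φ ⊓ ψ, s.and t, fun M _ v => by simp [hs, ht]⟩

theorem or (hP : UDef P) (hQ : UDef Q) : UDef fun M _ v => P M v ∨ Q M v :=
  let ⟨φ, s, hs⟩ := hP; let ⟨ψ, t, ht⟩ := hQ
  ⟨φ ⊔ ψ, s.or t, fun M _ v => by simp [hs, ht]⟩

theorem imp (hP : UDef P) (hQ : UDef Q) : UDef fun M _ v => P M v → Q M v :=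
  let ⟨φ, s, hs⟩ := hP; let ⟨ψ, t, ht⟩ := hQ
  ⟨φ ⟹ ψ, s.imp t, fun M _ v => by simp [hs, ht]⟩

theorem congr (hP : UDef P) (h : ∀ (M : Type) [AIDModel M] (v : Fin n → M), P M v ↔ Q M v) :
    UDef Q :=
  let ⟨φ, s, hs⟩ := hP
  ⟨φ, s, fun M _ v => (hs M v).trans (h M v)⟩

theorem comp {m : ℕ} {P : ∀ (M : Type) [AIDModel M], (Fin m → M) → Prop} (hP : UDef P)
    {f : Fin m → ∀ (M : Type) [AIDModel M], (Fin n → M) → M} (hf : ∀ i, UTDef (f i)) :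
    UDef fun M _ v => P M fun i => f i M v := by
  obtain ⟨φ, s, hs⟩ := hP
  choose t ht using hf
  exact ⟨φ.subst t, s.subst _, fun M _ v => by
    rw [realize_formula_subst]; simp only [ht]; exact hs M _⟩

/-- Sharply bounded universal quantification. The new variable is the variable `0`. -/
theorem all {P : ∀ (M : Type) [AIDModel M], (Fin n → M) → M → Prop} (hf : UTDef f)
    (hP : UDef fun M _ (v : Fin (n + 1) → M) => P M (fun i => v i.succ) (v 0)) :
    UDef fun M _ v => ∀ z, z ≤ Mod.len (f M v) → P M v z := by
  obtain ⟨s, hs⟩ := hf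
  obtain ⟨φ, t, ht⟩ := hP
  refine ⟨allLe s (φ.relabel (Fin.cases none some)), (t.formula_relabel _).allLe, fun M _ v => ?_⟩
  rw [realize_allLe, hs]
  refine forall_congr' fun z => imp_congr_right fun _ => ?_
  rw [Formula.realize_relabel]
  refine Iff.trans ?_ (ht M (Fin.cons z v))
  refine iff_of_eq (congrArg _ (funext fun x => ?_))
  refine Fin.cases ?_ (fun i => ?_) x <;> rfl

theorem ex {P : ∀ (M : Type) [AIDModel M], (Fin n → M) → M → Prop} (hf : UTDef f)
    (hP : UDef fun M _ (v : Fin (n + 1) → M) => P M (fun i => v i.succ) (v 0)) :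
    UDef fun M _ v => ∃ z, z ≤ Mod.len (f M v) ∧ P M v z := by
  have := (UDef.all (P := fun M _ v z => ¬ P M v z) hf hP.not).not
  simpa using this

theorem realize {φ : LAID.Formula (Fin n)} (hφ : IsSigma0 φ) : UDef fun _ _ v => φ.Realize v :=
  ⟨φ, hφ, fun _ _ _ => Iff.rfl⟩

/-- A uniformly definable predicate is definable in each model. -/
theorem sdef (hP : UDef P) {M : Type} [AIDModel M] {m : ℕ} {f : Fin n → (Fin m → M) → M}
    (hf : ∀ i, TDef (f i)) : SDef fun v => P M fun i => f i v := by
  obtain ⟨φ, s, hs⟩ := hP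
  exact (SDef.realize s hf).congr fun v => hs M _

end UDef

end

namespace Mod

variable {M : Type} [AIDModel M]

/-- A linear form in `‖X‖`. -/
noncomputable def lin (K : ℕ) (X : M) : M := K • len (len X) + K • 1

theorem tiny_lin (K : ℕ) (X : M) : Tiny (lin K X) :=
  ((small_len X).tiny_len.nsmul K).add (tiny_one.nsmul K)

end Mod

/-- All numbers whose length is below a linear form in `‖X‖` are below the length of a term. -/
theorem exists_term_lin (K : ℕ) : ∃ t : LAID.Term (Fin 1), ∀ (M : Type) [AIDModel M] (X : M),
    ∀ p : M, Mod.len p ≤ lin K X → p ≤ Mod.len (t.realize fun _ => X) := by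
  suffices h : ∃ t : LAID.Term (Fin 1), ∀ (M : Type) [AIDModel M] (X y : M),
      Mod.len y = lin K X → t.realize (fun _ => X) ≠ 0 ∧
        Mod.pad 1 y ≤ Mod.len (t.realize fun _ => X) by
    obtain ⟨t, ht⟩ := h
    refine ⟨t, fun M _ X p hp => ?_⟩
    obtain ⟨y, hy⟩ := (tiny_lin K X).exists_len
    rw [← hy] at hp
    exact ((len_le_iff _ _).1 hp).le.trans (ht M X y hy).2
  induction K with
  | zero =>
    refine ⟨1, fun M _ X y hy => ?_⟩
    have : y = 0 := by simpa [lin] using hy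
    simp [this]
  | succ K ih =>
    obtain ⟨t, ht⟩ := ih
    -- `|u| * 2 ^ ‖X‖ ≤ 2 * |u| * |X|` for `X ≠ 0`
    let p : LAID.Term (Fin 1) := half (smash (Term.var 0) t) + 1
    refine ⟨pad (pad t t) (pad (pad p p) (pad p p)), fun M _ X y hy => ?_⟩
    obtain ⟨z, hz⟩ := (tiny_lin K X).exists_len
    obtain ⟨h0, h⟩ := ht M X z hz
    set u := t.realize fun _ => X with hu
    have hp0 : p.realize (fun _ => X) ≠ 0 := by
      simp only [p, realize_add, realize_one]; exact add_one_ne_zero' _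
    have hp : lmul X u ≤ Mod.len (p.realize fun _ => X) := by
      simp only [p, realize_add, realize_one, realize_half, realize_smash, Term.realize_var]
      exact len_mono le_self_add
    set r := p.realize fun _ => X with hr
    have hq0 : Mod.pad r r ≠ 0 := fun h => hp0 (le_zero_iff.1 ((le_pad r r).trans h.le))
    have hu0 : Mod.pad u u ≠ 0 := fun h => h0 (le_zero_iff.1 ((le_pad u u).trans h.le))
    have hy' : Mod.pad 1 y = Mod.pad (Mod.pad 1 z) (Mod.len X) + Mod.pad (Mod.pad 1 z) (Mod.len X) := by
      have e : Mod.pad (Mod.pad 1 z) (Mod.len X) + Mod.pad (Mod.pad 1 z) (Mod.len X) =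
          Mod.pad (Mod.pad (Mod.pad 1 z) (Mod.len X)) 1 := (pad_one _).symm
      rw [e]
      obtain ⟨z', hz'⟩ : ∃ z' : M, Mod.len z' = Mod.len z + Mod.len (Mod.len X) := by
        refine (((tiny_lin K X).add (small_len X).tiny_len).of_le ?_).exists_len
        rw [hz]
      rw [pad_pad 1 z (Mod.len X) z' hz', pad_pad 1 z' 1 y]
      rw [hy, hz', hz, len_one, lin, lin, succ_nsmul, succ_nsmul]
      abel
    simp only [realize_pad, ← hu, ← hr]
    refine ⟨fun h => hu0 (le_zero_iff.1 ((le_pad _ _).trans h.le)), ?_⟩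
    rw [hy', len_pad hu0, len_pad hq0, len_pad h0, len_pad hp0]
    have h1 : Mod.pad (Mod.pad 1 z) (Mod.len X) ≤ Mod.pad (Mod.len u) (Mod.len X) :=
      pad_mono_left _ h
    have h2 : Mod.pad (Mod.len u) (Mod.len X) ≤ Mod.len u + (Mod.len r + Mod.len r) := by
      by_cases hX : Mod.len X = 0
      · rw [hX, pad_zero]; exact le_self_add
      · exact (pad_len_le hX).trans ((add_le_add hp hp).trans le_add_self)
    exact (add_le_add (h1.trans h2) (h1.trans h2)).trans (le_of_eq (by abel))

/-- Quantification over numbers with a tiny length. -/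
theorem UDef.exLin {n : ℕ} {f : ∀ (M : Type) [AIDModel M], (Fin n → M) → M}
    {P : ∀ (M : Type) [AIDModel M], (Fin n → M) → M → Prop} (K : ℕ) (hf : UTDef f)
    (hP : UDef fun M _ (v : Fin (n + 1) → M) => P M (fun i => v i.succ) (v 0)) :
    UDef fun M _ v => ∃ z, Mod.len z ≤ lin K (f M v) ∧ P M v z := by
  obtain ⟨t, ht⟩ := exists_term_lin K
  obtain ⟨s, hs⟩ := hf
  have h1 : UTDef fun M _ v => t.realize fun _ => f M v :=
    ⟨t.subst fun _ => s, fun M _ v => by rw [Term.realize_subst]; simp only [hs]⟩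
  have h2 : UTDef fun M _ (v : Fin (n + 1) → M) => f M fun i => v i.succ :=
    ⟨s.relabel Fin.succ, fun M _ v => by
      rw [Term.realize_relabel]; exact hs M _⟩
  refine (UDef.ex (P := fun M _ v z => Mod.len z ≤ lin K (f M v) ∧ P M v z) h1
    (UDef.and (UDef.le (UTDef.len (UTDef.var 0)) ((h2.len.len.nsmul K).add (UTDef.one.nsmul K)))
      hP)).congr fun M _ v => ?_
  exact ⟨fun ⟨z, _, h⟩ => ⟨z, h⟩, fun ⟨z, h⟩ => ⟨z, ht M _ z h.1, h⟩⟩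

end BoundedArith

namespace BoundedArith

open BoundedArith.Mod

/-! ### Iteration and counting -/

namespace Mod

variable {M : Type} [AIDModel M]

theorem bit_le_one (i x : M) : bit i x ≤ 1 := by
  rcases bit_cases i x with h | h <;> simp [h]

theorem lmul_self_le (x : M) : lmul x x ≤ 8 • x := by
  refine notation_induction (P := fun x => lmul x x ≤ 8 • x) ?_ (by simp) ?_ x
  · have h : TDef fun v : Fin 1 → M => 8 • v 0 := by
      simp only [succ_nsmul, zero_nsmul]
      fun_prop
    exact SDef.le (by fun_prop) h
  intro y hy ih
  have hl := len_half hy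
  rw [lmul_succ y hl, lmul_comm, lmul_succ (half y) hl]
  by_cases h0 : half y = 0
  · rw [h0]
    have h1 := (ne_zero_iff y).1 hy
    rw [h0] at hl
    simp only [zero_lmul, len_zero, zero_add, hl]
    rw [succ_nsmul]
    exact h1.trans le_add_self
  · have h1 := (ne_zero_iff _).1 h0
    have h2 := len_le_self (half y)
    have h3 : lmul (half y) (half y) + len (half y) + len y ≤ 8 • (half y + half y) := by
      rw [hl, nsmul_add, add_assoc]
      refine add_le_add ih ?_
      generalize half y = z at *
      have : len z + (len z + 1) ≤ z + (z + z) := add_le_add h2 (add_le_add h2 h1)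
      refine this.trans ?_
      simp only [succ_nsmul, zero_nsmul, zero_add, ← add_assoc]
      grind [zero_lt_one' (M := M)]
    refine h3.trans (nsmul_le_nsmul_right ?_ 8)
    rcases half_cases y with h | h
    · rw [← h]
    · conv_rhs => rw [h]
      exact le_self_add

/-- `j * |v|` for `j ≤ |V|`. -/
def mulLen (V v j : M) : M := lmul (msp V (len V - j)) v

theorem mulLen_zero (V v : M) : mulLen V v 0 = 0 := by
  simp [mulLen, msp_of_len_le]

theorem mulLen_succ {V v j : M} (h : j < len V) : mulLen V v (j + 1) = mulLen V v j + len v := by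
  refine lmul_succ v ?_
  rw [len_msp, len_msp, tsub_tsub_cancel_of_le h.le, tsub_tsub_cancel_of_le ((lt_iff _ _).1 h)]

theorem mulLen_mono {V v j k : M} (hjk : j ≤ k) (hk : k ≤ len V) : mulLen V v j ≤ mulLen V v k := by
  revert hjk
  refine length_induction (P := fun k => j ≤ k → mulLen V v j ≤ mulLen V v k) ?_ V ?_ ?_ k hk
  · unfold mulLen; fun_prop
  · intro h; rw [le_zero_iff.1 h]
  · intro k hk ih h
    rcases eq_or_lt_of_le h with h | h
    · rw [← h]
    · rw [mulLen_succ hk]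
      exact (ih (Order.lt_add_one_iff.1 h)).trans le_self_add

theorem le_mulLen {V v j : M} (hv : v ≠ 0) (hj : j ≤ len V) : j ≤ mulLen V v j := by
  refine length_induction (P := fun j => j ≤ mulLen V v j) ?_ V zero_le ?_ j hj
  · unfold mulLen; fun_prop
  · intro j hj ih
    rw [mulLen_succ hj]
    exact add_le_add ih ((ne_zero_iff _).1 (by simpa using hv))

/-- The block of `|v|` digits of `W` from the digit `r` on. -/
def field (v W r : M) : M := part (msp W r) 0 (len v)

theorem field_lt (v W r : M) : field v W r < pad 1 v :=
  (len_le_iff _ _).1 (len_part_le _ le_rfl)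

theorem field_append_of_le {v W r y : M} (a : M) (h : r + len v ≤ len y) :
    field v (pad a y + W) r = field v W r := by
  have hr : r ≤ len y := le_self_add.trans h
  unfold field
  refine eq_of_bit fun i hi => ?_
  have hi : i < len v := by
    rcases hi with hi | hi
    · exact hi.trans_le (len_part_le _ le_rfl)
    · exact hi.trans_le (len_part_le _ le_rfl)
  rw [bit_part_of_lt _ le_rfl hi, bit_part_of_lt _ le_rfl hi, bit_msp, bit_msp,
    bit_pad_add_of_lt]
  exact (add_lt_add_of_le_of_lt le_rfl hi).trans_le h

theorem field_append {v a W y : M} (ha : a < pad 1 v) (hW : W < pad 1 y) :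
    field v (pad a y + W) (len y) = a := by
  rw [field, (msp_pad_add hW).1]
  exact part_zero_eq_self le_rfl ((len_le_iff _ _).2 ha)

/-- The relation `St` leads from `a` to `b` in `m` steps through numbers of at most `|v|` digits. The
numbers are listed in a number of length at most `B`. -/
def iter (v V B : M) (St : M → M → M → Prop) (a m b : M) : Prop :=
  ∃ W, len W ≤ B ∧ field v W 0 = a ∧ field v W (mulLen V v m) = b ∧
    ∀ j, j ≤ len V → j < m → St j (field v W (mulLen V v j)) (field v W (mulLen V v (j + 1)))

theorem iter_zero {v V B : M} {St : M → M → M → Prop} {a b : M} (ha : a < pad 1 v)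
    (hB : len v ≤ B) : iter v V B St a 0 b ↔ b = a := by
  unfold iter
  rw [mulLen_zero]
  constructor
  · rintro ⟨W, _, h1, h2, _⟩
    rw [← h2, h1]
  · rintro rfl
    have h := (len_le_iff _ _).2 ha
    have e : field v b 0 = b := by
      rw [field, msp_zero, part_zero_eq_self le_rfl h]
    exact ⟨b, h.trans hB, e, e, fun j _ hj => absurd hj (not_lt.2 zero_le)⟩

theorem iter_lt {v V B : M} {St : M → M → M → Prop} {a m b : M} (h : iter v V B St a m b) :
    b < pad 1 v := by
  obtain ⟨W, _, _, h, _⟩ := h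
  exact h ▸ field_lt v W _

theorem iter_succ {v V B : M} {St : M → M → M → Prop} {a m b : M} (hm : m < len V)
    (hB : mulLen V v (m + 1) + len v ≤ B) (hBt : Tiny B) :
    iter v V B St a (m + 1) b ↔ b < pad 1 v ∧ ∃ c, iter v V B St a m c ∧ St m c b := by
  constructor
  · rintro ⟨W, hW, h1, h2, h3⟩
    refine ⟨h2 ▸ field_lt v W _, field v W (mulLen V v m), ⟨W, hW, h1, rfl, fun j hj hjm => ?_⟩, ?_⟩
    · exact h3 j hj (hjm.trans (Order.lt_add_one_iff.2 le_rfl))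
    · rw [← h2]
      exact h3 m hm.le (Order.lt_add_one_iff.2 le_rfl)
  · rintro ⟨hb, c, ⟨W, hW, h1, h2, h3⟩, hc⟩
    obtain ⟨y, hy⟩ := (hBt.of_le (le_self_add.trans hB)).exists_len
    -- The old list, cut off after the field `m`, with the new field in front.
    set W' := part W 0 (len y) with hW'
    have hW'y : W' < pad 1 y := (len_le_iff _ _).1 (len_part_le _ le_rfl)
    have hold : ∀ r, r + len v ≤ len y → field v (pad b y + W') r = field v W r := by
      intro r hr
      rw [field_append_of_le b hr]
      have := field_append_of_le (W := W') (msp W (len y)) hr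
      rw [hW', (pad_add_part W y).1] at this
      exact this.symm
    have hle : ∀ j, j ≤ m → mulLen V v j + len v ≤ len y := by
      intro j hj
      rw [hy, mulLen_succ hm]
      exact add_le_add (mulLen_mono hj hm.le) le_rfl
    refine ⟨pad b y + W', ?_, ?_, ?_, fun j hj hjm => ?_⟩
    · refine le_trans ?_ hB
      obtain ⟨z, hz⟩ := (hBt.of_le hB).exists_len
      rw [← hz, len_le_iff]
      have e : pad 1 z = pad (pad 1 v) y := by
        rw [pad_pad 1 v y z]
        rw [hz, hy, add_comm]
      rw [e]
      have h4 : pad (b + 1) y ≤ pad (pad 1 v) y := pad_mono_left y ((lt_iff _ _).1 hb)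
      rw [add_pad] at h4
      exact (add_lt_add_of_le_of_lt le_rfl hW'y).trans_le h4
    · have := hle 0 zero_le
      rw [mulLen_zero] at this
      rw [hold 0 this, h1]
    · rw [← hy, field_append hb hW'y]
    · rw [hold _ (hle j (Order.lt_add_one_iff.1 hjm))]
      rcases eq_or_lt_of_le (Order.lt_add_one_iff.1 hjm) with rfl | hlt
      · rw [← hy, field_append hb hW'y, h2]
        exact hc
      · rw [hold _ (hle _ ((lt_iff _ _).1 hlt))]
        exact h3 j hj hlt

end Mod

theorem UTDef.mulLen {n : ℕ} {f g h : ∀ (M : Type) [AIDModel M], (Fin n → M) → M}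
    (hf : UTDef f) (hg : UTDef g) (hh : UTDef h) :
    UTDef fun M _ v => Mod.mulLen (f M v) (g M v) (h M v) :=
  (hf.msp (hf.len.sub hh)).lmul hg

theorem UTDef.field {n : ℕ} {f g h : ∀ (M : Type) [AIDModel M], (Fin n → M) → M}
    (hf : UTDef f) (hg : UTDef g) (hh : UTDef h) :
    UTDef fun M _ v => Mod.field (f M v) (g M v) (h M v) :=
  (hg.msp hh).part UTDef.zero hf.len

theorem UTDef.up {n : ℕ} {f : ∀ (M : Type) [AIDModel M], (Fin n → M) → M} (hf : UTDef f) :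
    UTDef fun M _ (v : Fin (n + 1) → M) => f M fun i => v i.succ := by
  obtain ⟨s, hs⟩ := hf
  exact ⟨s.relabel Fin.succ, fun M _ v => by rw [Term.realize_relabel]; exact hs M _⟩

theorem UDef.iter {n : ℕ} {v V X a m b : ∀ (M : Type) [AIDModel M], (Fin n → M) → M}
    {St : ∀ (M : Type) [AIDModel M], (Fin n → M) → M → M → M → Prop}
    (hSt : ∀ {f g : ∀ (M : Type) [AIDModel M], (Fin (n + 2) → M) → M}, UTDef f → UTDef g →
      UDef fun M _ (x : Fin (n + 2) → M) => St M (fun i => x i.succ.succ) (x 0) (f M x) (g M x))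
    (hv : UTDef v) (hV : UTDef V) (K : ℕ) (hX : UTDef X) (ha : UTDef a) (hm : UTDef m)
    (hb : UTDef b) :
    UDef fun M _ x => Mod.iter (v M x) (V M x) (lin K (X M x)) (St M x) (a M x) (m M x) (b M x) := by
  unfold Mod.iter
  refine UDef.exLin K hX (UDef.and (UDef.eq (hv.up.field (UTDef.var 0) UTDef.zero) ha.up)
    (UDef.and (UDef.eq (hv.up.field (UTDef.var 0) (hV.up.mulLen hv.up hm.up)) hb.up) ?_))
  refine UDef.all (f := fun M _ x => V M fun i => x i.succ) hV.up
    (UDef.imp (UDef.lt (UTDef.var 0) hm.up.up) (hSt ?_ ?_))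
  · exact hv.up.up.field (UTDef.var 1) (hV.up.up.mulLen hv.up.up (UTDef.var 0))
  · exact hv.up.up.field (UTDef.var 1) (hV.up.up.mulLen hv.up.up ((UTDef.var 0).add UTDef.one))

namespace Mod

variable {M : Type} [AIDModel M]

/-- The number `4 ‖X‖ + 1`. Its length is the size of the fields in which numbers up to `2 ‖X‖` are
stored. -/
noncomputable def cntWidth (X : M) : M := 4 • len (len X) + 1

/-- A number of length `|cntWidth X| + ‖X‖`. -/
noncomputable def cntRange (X : M) : M := pad (cntWidth X) (len X)

/-- The number of ones among the digits `12 h + 1` and `12 h + 2` of `q`. -/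
noncomputable def cntStep (q h : M) : M := bit (12 • h + 1) q + bit (12 • h + 2 • 1) q

/-- `b = a + ∑_{j < e} cntStep q (r + j)`, for `e` up to the length of `cntWidth X`. -/
noncomputable def cntBlock (X q r a e b : M) : Prop :=
  iter (cntWidth X) (cntRange X) (lin 40 X) (fun j s s' => s' = s + cntStep q (r + j)) a e b

/-- `b` is the sum of `cntStep q` over the first `j` blocks. -/
noncomputable def cntBlocks (X q j b : M) : Prop :=
  iter (cntWidth X) (cntRange X) (lin 40 X)
    (fun j s s' => cntBlock X q (mulLen (cntRange X) (cntWidth X) j) s (len (cntWidth X)) s') 0 j b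

/-- `c = ∑_{h' < h} cntStep q h'`, for `h ≤ ‖X‖`. A list of all partial sums would be too long for a
sharply bounded quantifier, hence there is one list with the partial sums of blocks, and for each
block another one with the partial sums within that block. -/
noncomputable def cnt (X q h c : M) : Prop :=
  ∃ j, j ≤ len (len X) ∧ ∃ e, e ≤ len (cntWidth X) ∧ e < len (cntWidth X) ∧
    h = mulLen (cntRange X) (cntWidth X) j + e ∧
    ∃ s, len s ≤ lin 40 X ∧ cntBlocks X q j s ∧
      cntBlock X q (mulLen (cntRange X) (cntWidth X) j) s e c

section

variable (X q : M)

theorem cntWidth_ne_zero : cntWidth X ≠ 0 := add_one_ne_zero' _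

theorem len_cntRange : len (cntRange X) = len (cntWidth X) + len (len X) :=
  len_pad (cntWidth_ne_zero X) _

theorem lin_bound₁ : mulLen (cntRange X) (cntWidth X) (len (cntWidth X)) + len (cntWidth X) ≤
    lin 40 X := by
  have h1 : mulLen (cntRange X) (cntWidth X) (len (cntWidth X)) =
      lmul (cntWidth X) (cntWidth X) := by
    refine lmul_congr _ ?_
    rw [len_msp, tsub_tsub_cancel_of_le]
    rw [len_cntRange]
    exact le_self_add
  rw [h1]
  refine (add_le_add (lmul_self_le _) (len_le_self _)).trans ?_
  rw [← succ_nsmul, lin, cntWidth, nsmul_add, ← mul_nsmul']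
  exact add_le_add (nsmul_le_nsmul_left zero_le (by norm_num))
    (nsmul_le_nsmul_left zero_le (by norm_num))

theorem lin_bound₂ {a : M} (h : a ≤ len (len X)) : a + len (cntWidth X) ≤ lin 40 X := by
  refine (add_le_add h (len_le_self _)).trans ?_
  rw [lin, cntWidth, ← add_assoc, ← succ_nsmul']
  refine add_le_add (nsmul_le_nsmul_left zero_le (by norm_num)) ?_
  rw [succ_nsmul]
  exact le_add_self

theorem len_cntWidth_le : len (cntWidth X) ≤ lin 40 X := by
  have := lin_bound₂ X (a := 0) zero_le
  rwa [zero_add] at this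

variable {X q}

theorem cntBlock_zero {r a b : M} (ha : a < pad 1 (cntWidth X)) :
    cntBlock X q r a 0 b ↔ b = a :=
  iter_zero ha (len_cntWidth_le X)

theorem cntBlock_succ {r a e b : M} (he : e < len (cntWidth X)) :
    cntBlock X q r a (e + 1) b ↔ b < pad 1 (cntWidth X) ∧
      ∃ c, cntBlock X q r a e c ∧ b = c + cntStep q (r + e) := by
  have hr : len (cntWidth X) ≤ len (cntRange X) := by rw [len_cntRange]; exact le_self_add
  exact iter_succ (he.trans_le hr)
    ((add_le_add (mulLen_mono ((lt_iff _ _).1 he) hr) le_rfl).trans (lin_bound₁ X)) (tiny_lin 40 X)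

theorem cntBlocks_zero {b : M} : cntBlocks X q 0 b ↔ b = 0 :=
  iter_zero (zero_lt_one'.trans_le (one_le_pad_one _)) (len_cntWidth_le X)

theorem cntBlocks_succ {j b : M} (hj : j < len (len X))
    (hj' : mulLen (cntRange X) (cntWidth X) (j + 1) ≤ len (len X)) :
    cntBlocks X q (j + 1) b ↔ b < pad 1 (cntWidth X) ∧ ∃ c, cntBlocks X q j c ∧
      cntBlock X q (mulLen (cntRange X) (cntWidth X) j) c (len (cntWidth X)) b := by
  have hr : len (len X) ≤ len (cntRange X) := by rw [len_cntRange]; exact le_add_self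
  exact iter_succ (hj.trans_le hr) (lin_bound₂ X hj') (tiny_lin 40 X)

theorem cnt_zero {c : M} : cnt X q 0 c ↔ c = 0 := by
  have h0 : (0 : M) < pad 1 (cntWidth X) := zero_lt_one'.trans_le (one_le_pad_one _)
  have hw : 0 < len (cntWidth X) := by
    rw [pos_iff_ne_zero, ne_eq, len_eq_zero]; exact cntWidth_ne_zero X
  constructor
  · rintro ⟨j, hj, e, _, _, h, s, _, hs, hc⟩
    obtain ⟨h1, rfl⟩ := add_eq_zero.1 h.symm
    have hr : len (len X) ≤ len (cntRange X) := by rw [len_cntRange]; exact le_add_self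
    have : j = 0 := le_zero_iff.1 ((le_mulLen (cntWidth_ne_zero X) (hj.trans hr)).trans h1.le)
    subst this
    rw [cntBlocks_zero.1 hs, cntBlock_zero h0] at hc
    exact hc
  · rintro rfl
    exact ⟨0, zero_le, 0, zero_le, hw, by rw [mulLen_zero, add_zero], 0, by simp,
      cntBlocks_zero.2 rfl, (cntBlock_zero h0).2 rfl⟩

theorem cnt_lt {h c : M} (H : cnt X q h c) : c < pad 1 (cntWidth X) := by
  obtain ⟨j, _, e, _, _, _, s, _, _, hc⟩ := H
  exact iter_lt hc

theorem cnt_succ {h c' : M} (hh : h < len (len X)) : cnt X q (h + 1) c' ↔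
    ∃ c, cnt X q h c ∧ c' = c + cntStep q h ∧ c' < pad 1 (cntWidth X) := by
  have hv := cntWidth_ne_zero X
  have hr : len (len X) ≤ len (cntRange X) := by rw [len_cntRange]; exact le_add_self
  have hw : len (cntWidth X) ≠ (0 : M) := by simpa using hv
  obtain ⟨w', hw'⟩ : ∃ w' : M, len (cntWidth X) = w' + 1 := ⟨_, len_half hv⟩
  have hw'lt : w' < len (cntWidth X) := hw' ▸ Order.lt_add_one_iff.2 le_rfl
  have hlen : ∀ s : M, s < pad 1 (cntWidth X) → len s ≤ lin 40 X := fun s hs =>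
    ((len_le_iff _ _).2 hs).trans (len_cntWidth_le X)
  constructor
  · intro H
    have hc' := cnt_lt H
    obtain ⟨j, hj, e, _, he, h1, s, hs, hJ, hB⟩ := H
    by_cases he0 : e = 0
    · subst he0
      rw [cntBlock_zero (iter_lt hJ)] at hB
      subst hB
      rw [add_zero] at h1
      have hj0 : j ≠ 0 := by
        rintro rfl
        rw [mulLen_zero] at h1
        exact add_one_ne_zero' h h1
      obtain ⟨j, rfl⟩ : ∃ j', j = j' + 1 :=
        ⟨j - 1, (tsub_add_cancel_of_le ((ne_zero_iff j).1 hj0)).symm⟩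
      have hjlt := (lt_iff _ _).2 hj
      rw [cntBlocks_succ hjlt (h1 ▸ (lt_iff _ _).1 hh), hw'] at hJ
      obtain ⟨_, c₀, hc₀, hB⟩ := hJ
      rw [cntBlock_succ hw'lt] at hB
      obtain ⟨_, c, hc, hc1⟩ := hB
      have h2 : h = mulLen (cntRange X) (cntWidth X) j + w' := by
        rw [mulLen_succ (hjlt.trans_le hr), hw', ← add_assoc] at h1
        exact add_right_cancel h1
      exact ⟨c, ⟨j, hjlt.le, w', hw'lt.le, hw'lt, h2, c₀, hlen _ (iter_lt hc₀), hc₀, hc⟩,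
        by rw [hc1, h2], hc'⟩
    · obtain ⟨e, rfl⟩ : ∃ e', e = e' + 1 :=
        ⟨e - 1, (tsub_add_cancel_of_le ((ne_zero_iff e).1 he0)).symm⟩
      have helt : e < len (cntWidth X) := (Order.lt_add_one_iff.2 le_rfl).trans he
      have h2 : h = mulLen (cntRange X) (cntWidth X) j + e := by
        rw [← add_assoc] at h1
        exact add_right_cancel h1
      rw [cntBlock_succ helt] at hB
      obtain ⟨_, c, hc, hc1⟩ := hB
      exact ⟨c, ⟨j, hj, e, helt.le, helt, h2, s, hs, hJ, hc⟩, by rw [hc1, h2], hc'⟩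
  · rintro ⟨c, ⟨j, hj, e, _, he, h1, s, hs, hJ, hB⟩, h2, hc'⟩
    have hB' : cntBlock X q (mulLen (cntRange X) (cntWidth X) j) s (e + 1) c' := by
      rw [cntBlock_succ he]
      exact ⟨hc', c, hB, by rw [h2, h1]⟩
    rcases eq_or_lt_of_le ((lt_iff _ _).1 he) with he' | he'
    · rw [he'] at hB'
      have hjr : j < len (cntRange X) := by
        rw [len_cntRange, add_comm]
        exact lt_of_le_of_lt hj (lt_add_of_pos_right _ (pos_iff_ne_zero.2 hw))
      have h3 : mulLen (cntRange X) (cntWidth X) (j + 1) = h + 1 := by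
        rw [mulLen_succ hjr, h1, ← he', add_assoc]
      have h4 : mulLen (cntRange X) (cntWidth X) (j + 1) ≤ len (len X) := h3 ▸ (lt_iff _ _).1 hh
      have h5 : j + 1 ≤ len (len X) := (le_mulLen hv ((lt_iff _ _).1 hjr)).trans h4
      exact ⟨j + 1, h5, 0, zero_le, pos_iff_ne_zero.2 hw, by rw [h3, add_zero], c', hlen _ hc',
        (cntBlocks_succ ((lt_iff _ _).2 h5) h4).2 ⟨hc', s, hJ, hB'⟩, (cntBlock_zero hc').2 rfl⟩
    · exact ⟨j, hj, e + 1, he'.le, he', by rw [h1, add_assoc], s, hs, hJ, hB'⟩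

end

end Mod

open UTDef in
theorem UDef.cnt {n : ℕ} {X q h c : ∀ (M : Type) [AIDModel M], (Fin n → M) → M} (hX : UTDef X)
    (hq : UTDef q) (hh : UTDef h) (hc : UTDef c) :
    UDef fun M _ v => Mod.cnt (X M v) (q M v) (h M v) (c M v) := by
  have hw : ∀ {n : ℕ} {X : ∀ (M : Type) [AIDModel M], (Fin n → M) → M}, UTDef X →
      UTDef fun M _ v => cntWidth (X M v) := fun hX => (hX.len.len.nsmul 4).add one
  have hr : ∀ {n : ℕ} {X : ∀ (M : Type) [AIDModel M], (Fin n → M) → M}, UTDef X →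
      UTDef fun M _ v => cntRange (X M v) := fun hX => (hw hX).pad hX.len
  have hstep : ∀ {n : ℕ} {q h : ∀ (M : Type) [AIDModel M], (Fin n → M) → M}, UTDef q → UTDef h →
      UTDef fun M _ v => cntStep (q M v) (h M v) := fun hq hh =>
    (((hh.nsmul 12).add one).bit hq).add (((hh.nsmul 12).add (one.nsmul 2)).bit hq)
  have hblock : ∀ {n : ℕ} {X q r a e b : ∀ (M : Type) [AIDModel M], (Fin n → M) → M}, UTDef X →
      UTDef q → UTDef r → UTDef a → UTDef e → UTDef b →
      UDef fun M _ v => cntBlock (X M v) (q M v) (r M v) (a M v) (e M v) (b M v) := by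
    intro n X q r a e b hX hq hr' ha he hb
    exact UDef.iter (St := fun M _ v j s s' => s' = s + cntStep (q M v) (r M v + j))
      (fun hf hg => UDef.eq hg (hf.add (hstep hq.up.up (hr'.up.up.add (var 0))))) (hw hX) (hr hX) 40
      hX ha he hb
  have hblocks : ∀ {n : ℕ} {X q j b : ∀ (M : Type) [AIDModel M], (Fin n → M) → M}, UTDef X →
      UTDef q → UTDef j → UTDef b →
      UDef fun M _ v => cntBlocks (X M v) (q M v) (j M v) (b M v) := by
    intro n X q j b hX hq hj hb
    exact UDef.iter (St := fun M _ v j s s' => cntBlock (X M v) (q M v)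
        (mulLen (cntRange (X M v)) (cntWidth (X M v)) j) s (Mod.len (cntWidth (X M v))) s')
      (fun hf hg => hblock hX.up.up hq.up.up ((hr hX.up.up).mulLen (hw hX.up.up) (var 0)) hf
        (hw hX.up.up).len hg) (hw hX) (hr hX) 40 hX UTDef.zero hj hb
  unfold Mod.cnt
  refine UDef.ex (f := fun M _ v => Mod.len (X M v)) hX.len ?_
  refine UDef.ex (f := fun M _ v => cntWidth (X M fun i => v i.succ)) (hw hX.up) ?_
  refine UDef.and (UDef.lt (var 0) (hw hX.up.up).len) (UDef.and (UDef.eq hh.up.up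
    (((hr hX.up.up).mulLen (hw hX.up.up) (var 1)).add (var 0))) ?_)
  refine UDef.exLin (f := fun M _ v => X M fun i => v i.succ.succ) 40 hX.up.up ?_
  exact UDef.and (hblocks hX.up.up.up hq.up.up.up (var 2) (var 0))
    (hblock hX.up.up.up hq.up.up.up ((hr hX.up.up.up).mulLen (hw hX.up.up.up) (var 2)) (var 0)
      (var 1) hc.up.up.up)

namespace Mod

variable {M : Type} [AIDModel M]

theorem SDef.cnt {n : ℕ} {X q h c : (Fin n → M) → M} (hX : TDef X) (hq : TDef q) (hh : TDef h)
    (hc : TDef c) : SDef fun v => Mod.cnt (X v) (q v) (h v) (c v) :=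
  (UDef.cnt (UTDef.var (n := 4) 0) (UTDef.var 1) (UTDef.var 2) (UTDef.var 3)).sdef
    (f := ![X, q, h, c]) fun i => by fin_cases i <;> assumption

theorem cntStep_le (q h : M) : cntStep q h ≤ 1 + 1 := add_le_add (bit_le_one _ _) (bit_le_one _ _)

theorem exists_cnt (X q : M) : ∃ N : M → M, N 0 = 0 ∧
    (∀ h, h < len (len X) → N (h + 1) = N h + cntStep q h) ∧
    ∀ h, h ≤ len (len X) → ∀ c, cnt X q h c ↔ c = N h := by
  have hwt : Tiny (len (cntWidth X)) := (tiny_lin 40 X).of_le (len_cntWidth_le X)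
  obtain ⟨W, hW⟩ := hwt.small_pad
  have key : ∀ h, h ≤ len (len X) → ∃ c, c ≤ len W ∧ c ≤ h + h ∧ cnt X q h c ∧
      ∀ c', c' ≤ len W → cnt X q h c' → c' = c := by
    refine length_induction (P := fun h => ∃ c, c ≤ len W ∧ c ≤ h + h ∧ cnt X q h c ∧
      ∀ c', c' ≤ len W → cnt X q h c' → c' = c) ?_ (len X) ?_ ?_
    · refine SDef.ex (by fun_prop) (SDef.and (by fun_prop) (SDef.and
        (SDef.cnt (by fun_prop) (by fun_prop) (by fun_prop) (by fun_prop))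
        (SDef.all (by fun_prop) (SDef.imp
          (SDef.cnt (by fun_prop) (by fun_prop) (by fun_prop) (by fun_prop)) (by fun_prop)))))
    · exact ⟨0, zero_le, zero_le, cnt_zero.2 rfl, fun c' _ h => cnt_zero.1 h⟩
    · rintro h hh ⟨c, _, hc, hN, hu⟩
      have hc2 : c + cntStep q h ≤ h + 1 + (h + 1) :=
        (add_le_add hc (cntStep_le q h)).trans (le_of_eq (by abel))
      have hlt : c + cntStep q h < pad 1 (cntWidth X) := by
        refine lt_of_le_of_lt ?_ (lt_pad_one _)
        have h1 := (lt_iff _ _).1 hh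
        refine hc2.trans ((add_le_add h1 h1).trans ?_)
        rw [← two_nsmul, cntWidth]
        exact (nsmul_le_nsmul_left zero_le (by norm_num)).trans le_self_add
      refine ⟨_, hlt.le.trans hW, hc2, (cnt_succ hh).2 ⟨c, hN, rfl, hlt⟩, fun c' _ h' => ?_⟩
      obtain ⟨c₁, h1, h2, _⟩ := (cnt_succ hh).1 h'
      rw [h2, hu c₁ ((cnt_lt h1).le.trans hW) h1]
  have : ∀ h, ∃ c, h ≤ len (len X) → ∀ c', cnt X q h c' ↔ c' = c := by
    intro h
    by_cases hh : h ≤ len (len X)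
    · obtain ⟨c, _, _, h1, h2⟩ := key h hh
      exact ⟨c, fun _ c' => ⟨fun h' => h2 c' ((cnt_lt h').le.trans hW) h', fun h' => h' ▸ h1⟩⟩
    · exact ⟨0, fun h' => absurd h' hh⟩
  choose N hN using this
  refine ⟨N, ?_, fun h hh => ?_, hN⟩
  · exact (cnt_zero.1 ((hN 0 zero_le (N 0)).2 rfl))
  · obtain ⟨c, h1, h2, _⟩ := (cnt_succ hh).1 ((hN (h + 1) ((lt_iff _ _).1 hh) _).2 rfl)
    rw [h2, (hN h hh.le c).1 h1]

end Mod

end BoundedArith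

namespace BoundedArith

open BoundedArith.Mod

/-! ### Trees of carry-save adders -/

/-- The digits of the two outputs of a carry-save adder with four inputs, the first output if `τ` is
false, the second one otherwise. The summands `b = false` and `b = true` of a sum are each given by
two numbers, `τ' = false, true`. The input `V b τ' δ` is the digit of the number `τ'` of the summand
`b` at the present place if `δ` is false, and at the place before it otherwise. -/
def gate (τ : Prop) (V : Bool → Bool → Bool → Prop) : Prop :=
  let s := Xor (Xor (V false false false) (V false true false)) (V true false false)
  let c := maj (V false false true) (V false true true) (V true false true)
  (¬ τ ∧ Xor (Xor s c) (V true true false)) ∨ (τ ∧ maj s c (V true true false))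

/-- The address of the digit of the inputs of an adder that is used in a node for the inputs. -/
def gateBit : Bool → Bool → Bool → Fin 14
  | false, false, false => 3
  | false, false, true => 4
  | false, true, false => 5
  | false, true, true => 6
  | true, false, false => 7
  | true, false, true => 8
  | true, true, false => 9
  | true, true, true => 10

/-- The truth function of a tree that simulates adders by blocks of twelve levels: eight
disjunctions guess the inputs, three conjunctions choose one of the inputs, and finally the value of
the adder for these inputs is computed, and it is checked that the chosen input is correct. The
atom `inl r` says that a node is on level `r` of its block, the atom `inr j` is the digit `j` of
the node. -/
def blockFun (v : Fin 12 ⊕ Fin 14 → Prop) (ch : Bool → Prop) : Prop :=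
  (∃ r : Fin 12, r.1 < 8 ∧ v (.inl r) ∧ (ch false ∨ ch true)) ∨
  (∃ r : Fin 12, 8 ≤ r.1 ∧ r.1 < 11 ∧ v (.inl r) ∧ (ch false ∧ ch true)) ∨
  (v (.inl 11) ∧ gate (v (.inr 13)) (fun b τ δ => v (.inr (gateBit b τ δ))) ∧
    ((∃ b τ δ, (v (.inr 2) ↔ b = true) ∧ (v (.inr 1) ↔ τ = true) ∧ (v (.inr 0) ↔ δ = true) ∧
      v (.inr (gateBit b τ δ))) ↔ ch false))

/-- The formulae for the atoms of `blockFun`; the last variable is the node. -/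
def blockD (n : ℕ) : Fin 12 ⊕ Fin 14 → LBase.Formula (Fin (n + 1))
  | .inl r => exLe (Term.var (Fin.last n))
      (eqq (up (len (Term.var (Fin.last n)))) (times 12 (Term.var none) + times (4 + r.1) 1))
  | .inr j => eqq (bit (times j.1 1) (Term.var (Fin.last n))) 1

theorem blockD_sigma0 (n : ℕ) (i) : IsSigma0 (blockD n i) := by
  rcases i with r | j
  · exact (IsSigma0.eqq _ _).exLe
  · exact IsSigma0.eqq _ _

namespace Mod

variable {M : Type} [AIDModel M]

theorem realize_times' {X : ℕ → Type} [(LBA X).Structure M] [Compat X M] {α : Type} (c : ℕ)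
    (t : (LBA X).Term α) (v : α → M) : (times c t).realize v = c • t.realize v := by
  induction c with
  | zero => rw [zero_nsmul]; exact realize_zero v
  | succ c ih => rw [succ_nsmul, ← ih]; exact realize_add _ _ _

theorem residue_unique {k k' : M} {r r' : Fin 12} (h : 12 • k + (4 + r.1) • 1 = 12 • k' + (4 + r'.1) • 1) :
    r = r' := by
  have key : ∀ (k k' : M) (r r' : Fin 12), 12 • k + (4 + r.1) • 1 = 12 • k' + (4 + r'.1) • 1 →
      ¬ r < r' := by
    intro k k' r r' h hlt
    have hr' := r'.2
    have hs : ∀ a b : ℕ, a < b → (a • 1 : M) < b • 1 := fun _ _ =>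
      nsmul_lt_nsmul_left zero_lt_one'
    have hlt' : r.1 < r'.1 := hlt
    rcases le_or_gt k k' with hk | hk
    · exact (add_lt_add_of_le_of_lt (nsmul_le_nsmul_right hk 12) (hs _ _ (by omega))).ne h
    · have h1 : 12 • (k' + 1) ≤ 12 • k := nsmul_le_nsmul_right ((lt_iff _ _).1 hk) 12
      rw [nsmul_add] at h1
      have h2 : 12 • k' + (4 + r'.1) • 1 < 12 • k + (4 + r.1) • 1 := by
        refine lt_of_lt_of_le ?_ (add_le_add h1 le_rfl)
        rw [add_assoc, ← add_smul]
        exact add_lt_add_of_le_of_lt le_rfl (hs _ _ (by omega))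
      exact h2.ne h.symm
  rcases lt_trichotomy r r' with h' | h' | h'
  · exact absurd h' (key _ _ _ _ h)
  · exact h'
  · exact absurd h' (key _ _ _ _ h.symm)

theorem bit_child_zero (q : M) (b : Bool) : bit (0 • 1) (child q b) = 1 ↔ b = true := by
  rw [zero_nsmul]
  cases b
  · simp [child]
  · simp [child]

theorem bit_child_succ (q : M) (b : Bool) (j : ℕ) :
    bit ((j + 1) • 1) (child q b) = bit (j • 1) q := by
  rw [succ_nsmul, bit_add_one, half_child]

/-- The node for an input of the adder at `q`, if the values `α` have been guessed. -/
def ext (q : M) (α : List Bool) (b τ δ : Bool) : M :=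
  child (child (child (child (α.foldl child q) b) τ) δ) false

theorem len_foldl_child {q : M} (hq : q ≠ 0) (α : List Bool) :
    α.foldl child q ≠ 0 ∧ len (α.foldl child q) = len q + α.length • 1 := by
  induction α generalizing q with
  | nil => exact ⟨hq, by simp⟩
  | cons b α ih =>
    obtain ⟨h1, h2⟩ := ih (child_ne_zero hq b)
    refine ⟨h1, h2.trans ?_⟩
    rw [len_child hq, List.length_cons, succ_nsmul, add_assoc, add_comm (1 : M)]

theorem len_ext {q : M} (hq : q ≠ 0) {α : List Bool} (hα : α.length = 8) (b τ δ : Bool) :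
    len (ext q α b τ δ) = len q + 12 • 1 := by
  have h := (len_foldl_child hq α).1
  rw [ext, len_child, len_child, len_child, len_child h, (len_foldl_child hq α).2, hα]
  · simp only [succ_nsmul, zero_nsmul]
    abel
  · exact child_ne_zero h _
  · exact child_ne_zero (child_ne_zero h _) _
  · exact child_ne_zero (child_ne_zero (child_ne_zero h _) _) _

section Block

variable {n : ℕ} {A : M → Prop} {x : Fin n → M} {T : M}
  (hA : ∀ q, q ≠ 0 → len q < T → (A q ↔
    blockFun (fun i => (blockD n i).Realize (Fin.snoc x q : Fin (n + 1) → M))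
      fun b => A (child q b)))

include hA

theorem block_level {k p : M} {r : Fin 12} (hp : len p = 12 • k + (4 + r.1) • 1) (hT : len p < T) :
    (r.1 < 8 → (A p ↔ ∃ b, A (child p b))) ∧
    (8 ≤ r.1 → r.1 < 11 → (A p ↔ ∀ b, A (child p b))) ∧
    (r.1 = 11 → (A p ↔ gate (bit (13 • 1) p = 1) (fun b τ δ => bit ((gateBit b τ δ).1 • 1) p = 1) ∧
      ((∃ b τ δ, (bit (2 • 1) p = 1 ↔ b = true) ∧ (bit (1 • 1) p = 1 ↔ τ = true) ∧
        (bit (0 • 1) p = 1 ↔ δ = true) ∧ bit ((gateBit b τ δ).1 • 1) p = 1) ↔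
          A (child p false)))) := by
  have hp0 : p ≠ 0 := by
    rintro rfl
    rw [len_zero, add_smul] at hp
    have := (add_eq_zero.1 (add_eq_zero.1 hp.symm).2).1
    rw [succ_nsmul] at this
    exact add_one_ne_zero' _ this
  have hr : ∀ r', (blockD n (.inl r')).Realize (Fin.snoc x p : Fin (n + 1) → M) ↔ r' = r := by
    intro r'
    simp only [blockD, realize_exLe, realize_eqq, realize_up, realize_len, Term.realize_var,
      Option.elim, Fin.snoc_last, realize_add, realize_times', realize_one]
    constructor
    · rintro ⟨a, _, ha⟩
      exact residue_unique (ha.symm.trans hp)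
    · rintro rfl
      refine ⟨k, ?_, hp⟩
      rw [hp, succ_nsmul, add_assoc]
      exact le_add_left (le_self_add)
  have hb : ∀ j, (blockD n (.inr j)).Realize (Fin.snoc x p : Fin (n + 1) → M) ↔
      bit (j.1 • 1) p = 1 := by
    intro j
    simp [blockD, realize_times']
  have h := hA p hp0 hT
  simp only [blockFun, hr, hb] at h
  refine ⟨fun h8 => ?_, fun h8 h11 => ?_, fun h11 => ?_⟩
  · have e : (11 : Fin 12) ≠ r := by rintro rfl; exact absurd h8 (by decide)
    refine h.trans (Iff.trans ?_ Bool.exists_bool.symm)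
    constructor
    · rintro (⟨_, _, _, h⟩ | ⟨r', h1, _, rfl, _⟩ | ⟨h1, _⟩)
      · exact h
      · omega
      · exact absurd h1 e
    · exact fun h => Or.inl ⟨r, h8, rfl, h⟩
  · have e : (11 : Fin 12) ≠ r := by rintro rfl; exact absurd h11 (by decide)
    refine h.trans (Iff.trans ?_ Bool.forall_bool.symm)
    constructor
    · rintro (⟨r', h1, rfl, _⟩ | ⟨_, _, _, _, h⟩ | ⟨h1, _⟩)
      · omega
      · exact h
      · exact absurd h1 e
    · exact fun h => Or.inr (Or.inl ⟨r, h8, h11, rfl, h⟩)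
  · rw [h]
    have e : (11 : Fin 12) = r := Fin.ext h11.symm
    constructor
    · rintro (⟨r', h1, rfl, _⟩ | ⟨r', _, h1, rfl, _⟩ | ⟨_, h⟩)
      · omega
      · omega
      · exact h
    · exact fun h => Or.inr (Or.inr ⟨e, h⟩)

/-- The value at a node for an adder, if the values at the nodes for its inputs do not depend on the
guesses. -/
theorem block_gate {k q : M} (hq : len q = 12 • k + 4 • 1) (hT : 12 • (k + 1) + 4 • 1 ≤ T)
    {W : Bool → Bool → Bool → Prop}
    (hW : ∀ α b τ δ, α.length = 8 → (A (ext q α b τ δ) ↔ W b τ δ)) :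
    A q ↔ gate (bit (2 • 1) q = 1) W := by
  have hq0 : q ≠ 0 := by
    rintro rfl
    rw [len_zero] at hq
    have := (add_eq_zero.1 hq.symm).2
    rw [succ_nsmul] at this
    exact add_one_ne_zero' _ this
  have hs : ∀ a b : ℕ, a < b → (a • 1 : M) < b • 1 := by
    intro a b hab
    obtain ⟨c, rfl⟩ := Nat.exists_eq_add_of_lt hab
    rw [add_assoc, add_smul, add_smul, one_smul]
    exact lt_add_of_pos_right _ (zero_lt_one'.trans_le le_add_self)
  have hlen : ∀ {p : M} {r : ℕ}, len p = len q + r • 1 → r < 12 →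
      len p = 12 • k + (4 + r) • 1 ∧ len p < T := by
    intro p r hp hr
    rw [hp, hq, add_assoc, ← add_smul]
    refine ⟨rfl, lt_of_lt_of_le ?_ hT⟩
    rw [nsmul_add, add_assoc, ← add_smul]
    exact add_lt_add_of_le_of_lt le_rfl (hs _ _ (by omega))
  -- the disjunctions
  have h1 : ∀ s, s ≤ 8 → (A q ↔ ∃ α : List Bool, α.length = s ∧ A (α.foldl child q)) := by
    intro s
    induction s with
    | zero =>
      intro _
      exact ⟨fun h => ⟨[], rfl, h⟩, fun ⟨α, hα, h⟩ => by rwa [List.length_eq_zero_iff.1 hα] at h⟩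
    | succ s ih =>
      intro hs8
      rw [ih (by omega)]
      have hl : ∀ α : List Bool, α.length = s →
          (A (α.foldl child q) ↔ ∃ b, A (child (α.foldl child q) b)) := by
        intro α hα
        obtain ⟨e1, e2⟩ := hlen (hα ▸ (len_foldl_child hq0 α).2) (by omega)
        exact (block_level hA (r := ⟨s, by omega⟩) e1 e2).1 (by simpa using (by omega : s < 8))
      constructor
      · rintro ⟨α, hα, h⟩
        obtain ⟨b, hb⟩ := (hl α hα).1 h
        exact ⟨α ++ [b], by simp [hα], by simpa using hb⟩
      · rintro ⟨α, hα, h⟩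
        obtain ⟨β, b, rfl⟩ := List.eq_nil_or_concat' α |>.resolve_left (by rintro rfl; simp at hα)
        have hβ : β.length = s := by simpa using hα
        exact ⟨β, hβ, (hl β hβ).2 ⟨b, by simpa using h⟩⟩
  -- the conjunctions and the check
  have h2 : ∀ α : List Bool, α.length = 8 → (A (α.foldl child q) ↔ ∀ b τ δ,
      gate (bit (2 • 1) q = 1)
        (fun b τ δ => bit ((gateBit b τ δ).1 • 1) (child (child (child (α.foldl child q) false) false)
          false) = 1) ∧
      (bit ((gateBit b τ δ).1 • 1) (child (child (child (α.foldl child q) false) false) false) = 1 ↔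
        W b τ δ)) := by
    intro α hα
    obtain ⟨g0, g1⟩ := len_foldl_child hq0 α
    rw [hα] at g1
    set p := α.foldl child q with hp
    have hbit : ∀ b τ δ b' τ' δ', bit ((gateBit b τ δ).1 • 1) (child (child (child p b') τ') δ') =
        bit ((gateBit b τ δ).1 • 1) (child (child (child p false) false) false) := by
      intro b τ δ b' τ' δ'
      have : ∃ j, (gateBit b τ δ).1 = j + 1 + 1 + 1 := by
        cases b <;> cases τ <;> cases δ <;> exact ⟨_, rfl⟩
      obtain ⟨j, hj⟩ := this
      rw [hj]
      simp only [bit_child_succ]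
    have h8 := hlen g1 (by omega)
    have g2 : ∀ b, len (child p b) = len q + 9 • 1 := fun b => by
      rw [len_child g0, g1, add_assoc, ← succ_nsmul]
    have h9 := fun b => hlen (g2 b) (by omega)
    have g3 : ∀ b τ, len (child (child p b) τ) = len q + 10 • 1 := fun b τ => by
      rw [len_child (child_ne_zero g0 b), g2, add_assoc, ← succ_nsmul]
    have h10 := fun b τ => hlen (g3 b τ) (by omega)
    have g4 : ∀ b τ δ, len (child (child (child p b) τ) δ) = len q + 11 • 1 := fun b τ δ => by
      rw [len_child (child_ne_zero (child_ne_zero g0 b) τ), g3, add_assoc, ← succ_nsmul]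
    have h11 := fun b τ δ => hlen (g4 b τ δ) (by omega)
    rw [(block_level hA (r := 8) h8.1 h8.2).2.1 (by decide) (by decide)]
    refine forall_congr' fun b => ?_
    rw [(block_level hA (r := 9) (h9 b).1 (h9 b).2).2.1 (by decide) (by decide)]
    refine forall_congr' fun τ => ?_
    rw [(block_level hA (r := 10) (h10 b τ).1 (h10 b τ).2).2.1 (by decide) (by decide)]
    refine forall_congr' fun δ => ?_
    rw [(block_level hA (r := 11) (h11 b τ δ).1 (h11 b τ δ).2).2.2 rfl]
    have e13 : bit (13 • 1) (child (child (child p b) τ) δ) = bit (2 • 1) q := by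
      match α, hα with
      | [a0, a1, a2, a3, a4, a5, a6, a7], _ =>
        simp only [hp, List.foldl_cons, List.foldl_nil]
        simp only [bit_child_succ _ _ 12, bit_child_succ _ _ 11, bit_child_succ _ _ 10,
          bit_child_succ _ _ 9, bit_child_succ _ _ 8, bit_child_succ _ _ 7, bit_child_succ _ _ 6,
          bit_child_succ _ _ 5, bit_child_succ _ _ 4, bit_child_succ _ _ 3, bit_child_succ _ _ 2]
    simp only [hbit, e13]
    refine and_congr Iff.rfl ?_
    have hsel : (∃ b' τ' δ', (bit (2 • 1) (child (child (child p b) τ) δ) = 1 ↔ b' = true) ∧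
        (bit (1 • 1) (child (child (child p b) τ) δ) = 1 ↔ τ' = true) ∧
        (bit (0 • 1) (child (child (child p b) τ) δ) = 1 ↔ δ' = true) ∧
        bit ((gateBit b' τ' δ').1 • 1) (child (child (child p false) false) false) = 1) ↔
        bit ((gateBit b τ δ).1 • 1) (child (child (child p false) false) false) = 1 := by
      rw [bit_child_succ _ _ 1, bit_child_succ _ _ 0, bit_child_succ _ _ 0]
      simp only [bit_child_zero]
      constructor
      · rintro ⟨b', τ', δ', e1, e2, e3, h⟩
        rwa [Bool.eq_iff_iff.2 e1, Bool.eq_iff_iff.2 e2, Bool.eq_iff_iff.2 e3]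
      · exact fun h => ⟨b, τ, δ, Iff.rfl, Iff.rfl, Iff.rfl, h⟩
    rw [hsel]
    have := hW α b τ δ hα
    rw [ext, ← hp] at this
    rw [this]
  rw [h1 8 le_rfl]
  constructor
  · rintro ⟨α, hα, h⟩
    have h := (h2 α hα).1 h
    have e : W = fun b τ δ => bit ((gateBit b τ δ).1 • 1) (child (child (child (α.foldl child q)
        false) false) false) = 1 := by
      funext b τ δ
      exact propext (h b τ δ).2.symm
    rw [e]
    exact (h false false false).1
  · intro h
    classical
    let α : List Bool := [decide (W true true true), decide (W true true false),
      decide (W true false true), decide (W true false false), decide (W false true true),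
      decide (W false true false), decide (W false false true), decide (W false false false)]
    have e : ∀ b τ δ, bit ((gateBit b τ δ).1 • 1) (child (child (child (α.foldl child q)
        false) false) false) = 1 ↔ W b τ δ := by
      intro b τ δ
      simp only [α, List.foldl_cons, List.foldl_nil]
      have hg : (gateBit b τ δ).1 = 3 + (4 * b.toNat + 2 * τ.toNat + δ.toNat) := by
        cases b <;> cases τ <;> cases δ <;> rfl
      rw [hg]
      cases b <;> cases τ <;> cases δ <;>
      simp only [Bool.toNat_true, Bool.toNat_false, Nat.reduceMul, Nat.reduceAdd, bit_child_succ _ _ 9, bit_child_succ _ _ 8, bit_child_succ _ _ 7,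
        bit_child_succ _ _ 6, bit_child_succ _ _ 5, bit_child_succ _ _ 4, bit_child_succ _ _ 3,
        bit_child_succ _ _ 2, bit_child_succ _ _ 1, bit_child_succ _ _ 0, bit_child_zero,
        decide_eq_true_eq]
    refine ⟨α, rfl, (h2 α rfl).2 fun b τ δ => ⟨?_, e b τ δ⟩⟩
    simp only [e]
    exact h

end Block


/-! ### The tree of sums -/

theorem TDef.nsmul {n : ℕ} (c : ℕ) {f : (Fin n → M) → M} (hf : TDef f) :
    TDef fun v => c • f v := by
  obtain ⟨t, ht⟩ := hf
  exact ⟨times c t, fun v => by rw [realize_times, ht]⟩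

attribute [fun_prop] TDef.nsmul SDef.cnt

theorem bit_add_foldl_child (q i : M) (α : List Bool) :
    bit (i + α.length • 1) (α.foldl child q) = bit i q := by
  induction α generalizing q i with
  | nil => simp
  | cons b α ih =>
    have e : i + (α.length + 1) • (1 : M) = i + 1 + α.length • 1 := by
      rw [succ_nsmul]; abel
    rw [List.foldl_cons, List.length_cons, e, ih, bit_add_one, half_child]

section Ext

variable (q : M) {α : List Bool} (b τ δ : Bool)

theorem bit_ext_add (hα : α.length = 8) (h : M) (r : ℕ) :
    bit (12 • (h + 1) + r • 1) (ext q α b τ δ) = bit (12 • h + r • 1) q := by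
  have e : 12 • (h + 1) + r • (1 : M) = 12 • h + r • 1 + (α ++ [b, τ, δ, false]).length • 1 := by
    rw [List.length_append, hα]
    show _ = _ + 12 • 1
    rw [nsmul_add]
    abel
  rw [e, ← bit_add_foldl_child q _ (α ++ [b, τ, δ, false]), List.foldl_append]
  rfl

theorem bit_ext : (bit (1 • 1) (ext q α b τ δ) = 1 ↔ δ = true) ∧
    (bit (2 • 1) (ext q α b τ δ) = 1 ↔ τ = true) ∧
    (bit (3 • 1) (ext q α b τ δ) = 1 ↔ b = true) := by
  rw [ext, bit_child_succ _ _ 2, bit_child_succ _ _ 1, bit_child_succ _ _ 1, bit_child_succ _ _ 0,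
    bit_child_succ _ _ 0, bit_child_succ _ _ 0]
  exact ⟨bit_child_zero _ _, bit_child_zero _ _, bit_child_zero _ _⟩

theorem bit_eq_ite {i x : M} {b : Bool} (h : bit i x = 1 ↔ b = true) :
    bit i x = if b then 1 else 0 := by
  cases b
  · exact (bit_cases i x).resolve_right fun h' => by simpa using h.1 h'
  · exact h.2 rfl

theorem cntStep_ext_zero :
    cntStep (ext q α b τ δ) 0 = (if δ then 1 else 0) + (if τ then 1 else 0) := by
  obtain ⟨h1, h2, _⟩ := bit_ext q (α := α) b τ δ
  rw [cntStep, nsmul_zero, zero_add, zero_add, ← bit_eq_ite h2]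
  rw [one_nsmul] at h1
  rw [← bit_eq_ite h1]

theorem cntStep_ext_succ (hα : α.length = 8) (h : M) :
    cntStep (ext q α b τ δ) (h + 1) = cntStep q h := by
  have e := bit_ext_add q b τ δ hα h 1
  rw [one_nsmul] at e
  rw [cntStep, cntStep, bit_ext_add q b τ δ hα, e]

end Ext

theorem exists_cnt_bound (X : M) : ∃ W : M, ∀ q h c, cnt X q h c → c ≤ len W := by
  have hwt : Tiny (len (cntWidth X)) := (tiny_lin 40 X).of_le (len_cntWidth_le X)
  obtain ⟨W, hW⟩ := hwt.small_pad
  exact ⟨W, fun q h c H => (cnt_lt H).le.trans hW⟩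

/-- From a node to a node for one of its inputs, the count of shifts increases by the two digits that
choose a shifted digit and a carry output. -/
theorem cnt_ext (X q : M) {α : List Bool} (hα : α.length = 8) (b τ δ : Bool) {h c : M}
    (hh : h < len (len X)) (hc : cnt X q h c) :
    cnt X (ext q α b τ δ) (h + 1) (c + ((if δ then 1 else 0) + (if τ then 1 else 0))) := by
  obtain ⟨N, h0, hs, hN⟩ := exists_cnt X q
  obtain ⟨N', h0', hs', hN'⟩ := exists_cnt X (ext q α b τ δ)
  obtain ⟨W, hW⟩ := exists_cnt_bound X
  rw [← cntStep_ext_zero q (α := α)]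
  have key : ∀ h, h ≤ len (len X) → h < len (len X) → ∃ c, c ≤ len W ∧ cnt X q h c ∧
      cnt X (ext q α b τ δ) (h + 1) (c + cntStep (ext q α b τ δ) 0) := by
    refine length_induction (P := fun h => h < len (len X) → ∃ c, c ≤ len W ∧ cnt X q h c ∧
      cnt X (ext q α b τ δ) (h + 1) (c + cntStep (ext q α b τ δ) 0)) ?_ (len X) ?_ ?_
    · exact SDef.imp (by fun_prop) (SDef.ex (by fun_prop) (SDef.and
        (SDef.cnt (by fun_prop) (by fun_prop) (by fun_prop) (by fun_prop))
        (SDef.cnt (by fun_prop) (by fun_prop) (by fun_prop) (by fun_prop))))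
    · intro h
      refine ⟨0, zero_le, cnt_zero.2 rfl, ?_⟩
      rw [hN' _ ((lt_iff _ _).1 h), hs' 0 h, h0']
    · intro h hh ih hh'
      obtain ⟨c, _, h1, h2⟩ := ih hh
      have h3 : cnt X q (h + 1) (c + cntStep q h) := by
        rw [hN _ hh'.le, hs h hh, (hN h hh.le c).1 h1]
      refine ⟨_, hW _ _ _ h3, h3, ?_⟩
      rw [hN' _ ((lt_iff _ _).1 hh'), hs' _ hh', ← (hN' _ hh'.le _).1 h2, cntStep_ext_succ q b τ δ hα]
      abel
  obtain ⟨c', _, h1, h2⟩ := key h hh.le hh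
  rwa [(hN h hh.le c).1 hc, ← (hN h hh.le c').1 h1]

theorem cnt_unique {X q h c c' : M} (hh : h ≤ len (len X)) (h1 : cnt X q h c) (h2 : cnt X q h c') :
    c = c' := by
  obtain ⟨N, _, _, hN⟩ := exists_cnt X q
  rw [(hN h hh c).1 h1, (hN h hh c').1 h2]

theorem cnt_exists {X q h : M} (hh : h ≤ len (len X)) : ∃ c, cnt X q h c := by
  obtain ⟨N, _, _, hN⟩ := exists_cnt X q
  exact ⟨N h, (hN h hh _).2 rfl⟩

theorem gate_false (τ : Prop) : ¬ gate τ fun _ _ _ => False := by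
  simp [gate, maj, Xor]

/-- The predicate `A m i` on the nodes of a tree is evaluated by carry-save adders, and the leaves
hold the digits of the numbers with the digits `f j`, `j < m`. The position of the digit at a leaf is
`i` minus the number of shifts on the way to the leaf. -/
structure SumTree (X : M) (f : M → M → Prop) (A : M → M → M → Prop) : Prop where
  sdef : SDef fun v : Fin 3 → M => A (v 0) (v 1) (v 2)
  node : ∀ {m i q k : M} {W : Bool → Bool → Bool → Prop}, k < len (len X) →
    len q = 12 • k + 4 • 1 →
    (∀ α b τ δ, α.length = 8 → (A m i (ext q α b τ δ) ↔ W b τ δ)) →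
    (A m i q ↔ gate (bit (2 • 1) q = 1) W)
  leaf : ∀ {m i q : M}, len q = 12 • len (len X) + 4 • 1 → (A m i q ↔ bit (2 • 1) q ≠ 1 ∧
    ∃ j, j ≤ len X ∧ j < m ∧
      (∀ h, h ≤ len (len X) → h < len (len X) → bit h j = bit (12 • h + 3 • 1) q) ∧
      ∃ c, cnt X q (len (len X)) c ∧ c ≤ i ∧ f j (i - c))

namespace SumTree

variable {X : M} {f : M → M → Prop} {A : M → M → M → Prop} (H : SumTree X f A)

/-- All nodes of the tree, and all counts, are below this length. -/
theorem exists_node_bound (X : M) : ∃ W : M, (∀ q k, k ≤ len (len X) → len q = 12 • k + 4 • 1 → q ≤ len W) ∧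
    ∀ q h c, cnt X q h c → c ≤ len W := by
  obtain ⟨W, hW⟩ := exists_cnt_bound X
  obtain ⟨W', hW'⟩ := (((small_len X).tiny_len.nsmul 12).add (tiny_one.nsmul 4)).exists_bound
  have := (small_len W).add (small_len W')
  obtain ⟨V, hV⟩ := this
  refine ⟨V, fun q k hk hq => ?_, fun q h c h' => (hW q h c h').trans (le_self_add.trans hV)⟩
  refine (hW' q ?_).trans (le_add_self.trans hV)
  rw [hq]
  exact add_le_add (nsmul_le_nsmul_right hk 12) le_rfl

theorem level_ne_zero {q k : M} (hq : len q = 12 • k + 4 • 1) : q ≠ 0 := by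
  rintro rfl
  rw [len_zero] at hq
  have := (add_eq_zero.1 hq.symm).2
  rw [succ_nsmul] at this
  exact add_one_ne_zero' _ this

theorem level_ext {q k : M} (hq : len q = 12 • k + 4 • 1) {α : List Bool} (hα : α.length = 8)
    (b τ δ : Bool) : len (ext q α b τ δ) = 12 • (k + 1) + 4 • 1 := by
  rw [len_ext (level_ne_zero hq) hα, hq, nsmul_add]
  abel

/-- Induction from the leaves to the root. -/
theorem level_induction {P : M → Prop} (hP : SDef fun v : Fin 1 → M => P (v 0))
    (hL : P (len (len X))) (hs : ∀ k, k < len (len X) → P (k + 1) → P k) (k : M)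
    (hk : k ≤ len (len X)) : P k := by
  have := length_induction (P := fun t => P (len (len X) - t)) (hP.comp₁ (by fun_prop)) (len X)
    (by simpa using hL) ?_ (len (len X) - k) tsub_le_self
  · rwa [tsub_tsub_cancel_of_le hk] at this
  · intro t ht ih
    rw [sub_add_one_sub ht] at ih
    refine hs _ ?_ ih
    rw [lt_iff, ← sub_add_one_sub ht]
    exact tsub_le_self

include H

/-- There are no digits before the first one, and an empty sum has no digits. -/
theorem le_of_mem {m k : M} (hk : k ≤ len (len X)) :
    ∀ q i c, len q = 12 • k + 4 • 1 → cnt X q k c → A m i q → c ≤ i ∧ m ≠ 0 := by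
  obtain ⟨W, hW, hW'⟩ := exists_node_bound X
  intro q i
  revert k q
  have key := level_induction (X := X) (P := fun k => ∀ q, q ≤ len W → ∀ c, c ≤ len W →
    len q = 12 • k + 4 • 1 → cnt X q k c → A m i q → c ≤ i ∧ m ≠ 0) ?_ ?_ ?_
  · exact fun k hk q c hq hc h => key k hk q (hW q k hk hq) c (hW' _ _ _ hc) hq hc h
  · refine SDef.all (by fun_prop) (SDef.all (by fun_prop) (SDef.imp (by fun_prop)
      (SDef.imp (by fun_prop) (SDef.imp ?_ (by fun_prop)))))
    exact H.sdef.comp₃ (by fun_prop) (by fun_prop) (by fun_prop)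
  · intro q _ c _ hq hc h
    obtain ⟨_, j, _, hj, _, c', hc', hi, _⟩ := (H.leaf hq).1 h
    rw [cnt_unique le_rfl hc hc']
    exact ⟨hi, (zero_le.trans_lt hj).ne'⟩
  · intro k hk ih q _ c _ hq hc h
    by_contra hn
    refine gate_false _ ((H.node hk hq (W := fun _ _ _ => False) fun α b τ δ hα => ?_).1 h)
    refine iff_of_false (fun h' => hn ?_) id
    have hq' := level_ext hq hα b τ δ
    have hc' := cnt_ext X q hα b τ δ hk hc
    obtain ⟨h1, h2⟩ := ih _ (hW _ _ ((lt_iff _ _).1 hk) hq') _ (hW' _ _ _ hc') hq' hc' h'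
    exact ⟨le_self_add.trans h1, h2⟩

/-- The value at a node only depends on the path through the tree of summands, on the adder output,
and on the position of the digit. -/
theorem invariant {m k : M} (hk : k ≤ len (len X)) :
    ∀ q q' i i' c c', len q = 12 • k + 4 • 1 → len q' = 12 • k + 4 • 1 →
      bit (2 • 1) q = bit (2 • 1) q' →
      (∀ h, h ≤ k → bit (12 • h + 3 • 1) q = bit (12 • h + 3 • 1) q') →
      cnt X q k c → cnt X q' k c' → i + c' = i' + c → A m i q → A m i' q' := by
  obtain ⟨W, hW, hW'⟩ := exists_node_bound X
  intro q q' i i'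
  -- all relevant `q`, `c` are below `len W`; the positions are fixed
  revert k q q'
  have key := level_induction (X := X) (P := fun k => ∀ q, q ≤ len W → ∀ q', q' ≤ len W →
    ∀ c, c ≤ len W → ∀ c', c' ≤ len W → len q = 12 • k + 4 • 1 → len q' = 12 • k + 4 • 1 →
      bit (2 • 1) q = bit (2 • 1) q' →
      (∀ h, h ≤ len (len X) → h ≤ k → bit (12 • h + 3 • 1) q = bit (12 • h + 3 • 1) q') →
      cnt X q k c → cnt X q' k c' →
        (i + c' = i' + c → (A m i q ↔ A m i' q')) ∧ (c = c' → (A m i q ↔ A m i q'))) ?_ ?_ ?_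
  · intro k hk q q' c c' hq hq' h2 hb hc hc' hi
    exact ((key k hk q (hW q k hk hq) q' (hW q' k hk hq') c (hW' _ _ _ hc) c' (hW' _ _ _ hc') hq hq'
      h2 (fun h _ => hb h) hc hc').1 hi).1
  · refine SDef.all (by fun_prop) (SDef.all (by fun_prop) (SDef.all (by fun_prop) (SDef.all
      (by fun_prop) (SDef.imp (by fun_prop) (SDef.imp (by fun_prop) (SDef.imp (by fun_prop)
      (SDef.imp (by fun_prop) (SDef.imp (by fun_prop) (SDef.imp (by fun_prop)
      (SDef.and (SDef.imp (by fun_prop) (SDef.iff ?_ ?_)) (SDef.imp (by fun_prop)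
      (SDef.iff ?_ ?_))))))))))))
    all_goals exact H.sdef.comp₃ (by fun_prop) (by fun_prop) (by fun_prop)
  · intro q _ q' _ c _ c' _ hq hq' h2 hb hc hc'
    have main : ∀ i i', i + c' = i' + c → (A m i q → A m i' q') := by
      intro i i' hi h
      obtain ⟨h1, j, hj, hjm, hjb, c₁, hc₁, hci, hf⟩ := (H.leaf hq).1 h
      rw [← cnt_unique le_rfl hc hc₁] at hci hf
      refine (H.leaf hq').2 ⟨h2 ▸ h1, j, hj, hjm, fun h hh hh' => ?_, c', hc', ?_, ?_⟩
      · rw [hjb h hh hh', hb h hh hh]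
      · have := tsub_add_cancel_of_le hci
        grind [zero_lt_one' (M := M)]
      · have e : i' - c' = i - c := by
          have e1 := tsub_add_cancel_of_le hci
          have e2 : i' = i - c + c' := by grind
          rw [e2, add_tsub_cancel_right]
        rwa [e]
    have main' : ∀ i i', i + c' = i' + c → (A m i' q' → A m i q) := by
      intro i i' hi h
      obtain ⟨h1, j, hj, hjm, hjb, c₁, hc₁, hci, hf⟩ := (H.leaf hq').1 h
      rw [← cnt_unique le_rfl hc' hc₁] at hci hf
      refine (H.leaf hq).2 ⟨h2 ▸ h1, j, hj, hjm, fun h hh hh' => ?_, c, hc, ?_, ?_⟩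
      · rw [hjb h hh hh', hb h hh hh]
      · have := tsub_add_cancel_of_le hci
        grind [zero_lt_one' (M := M)]
      · have e : i - c = i' - c' := by
          have e1 := tsub_add_cancel_of_le hci
          have e2 : i = i' - c' + c := by grind
          rw [e2, add_tsub_cancel_right]
        rwa [e]
    refine ⟨fun hi => ⟨main i i' hi, main' i i' hi⟩, fun hcc => ?_⟩
    exact ⟨main i i (by rw [hcc]), main' i i (by rw [hcc])⟩
  · intro k hk ih q _ q' _ c _ c' _ hq hq' h2 hb hc hc'
    have hk' := (lt_iff _ _).1 hk
    -- the children of two nodes at the same place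
    have step : ∀ (p p' d d' : M) (α α' : List Bool) (b τ δ : Bool), len p = 12 • k + 4 • 1 →
        len p' = 12 • k + 4 • 1 → cnt X p k d → cnt X p' k d' →
        (∀ h, h ≤ len (len X) → h ≤ k → bit (12 • h + 3 • 1) p = bit (12 • h + 3 • 1) p') →
        α.length = 8 → α'.length = 8 →
        (i + d' = i' + d → (A m i (ext p α b τ δ) ↔ A m i' (ext p' α' b τ δ))) ∧
        (d = d' → (A m i (ext p α b τ δ) ↔ A m i (ext p' α' b τ δ))) := by
      intro p p' d d' α α' b τ δ hp hp' hd hd' hbb hα hα'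
      have l1 := level_ext hp hα b τ δ
      have l2 := level_ext hp' hα' b τ δ
      have c1 := cnt_ext X p hα b τ δ hk hd
      have c2 := cnt_ext X p' hα' b τ δ hk hd'
      have b1 := bit_ext p (α := α) b τ δ
      have b2 := bit_ext p' (α := α') b τ δ
      have := ih _ (hW _ _ hk' l1) _ (hW _ _ hk' l2) _ (hW' _ _ _ c1) _ (hW' _ _ _ c2) l1 l2
        (by rw [bit_eq_ite b1.2.1, bit_eq_ite b2.2.1]) ?_ c1 c2
      · refine ⟨fun h => this.1 ?_, fun h => this.2 (by rw [h])⟩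
        rw [← add_assoc, h, add_assoc]
      · intro h hh hhk
        by_cases h0 : h = 0
        · subst h0
          rw [nsmul_zero, zero_add, bit_eq_ite b1.2.2, bit_eq_ite b2.2.2]
        · obtain ⟨h', rfl⟩ : ∃ h', h = h' + 1 :=
            ⟨h - 1, (tsub_add_cancel_of_le ((ne_zero_iff h).1 h0)).symm⟩
          rw [bit_ext_add p b τ δ hα, bit_ext_add p' b τ δ hα']
          exact hbb h' (le_self_add.trans hh) ((add_le_add_iff_right 1).1 hhk)
    let α₀ : List Bool := List.replicate 8 false
    have e1 := H.node (m := m) (i := i) hk hq (W := fun b τ δ => A m i (ext q α₀ b τ δ))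
      fun α b τ δ hα => (step q q c c α α₀ b τ δ hq hq hc hc (fun _ _ _ => rfl) hα rfl).2 rfl
    refine ⟨fun hi => ?_, fun hcc => ?_⟩
    · have e2 := H.node (m := m) (i := i') hk hq' (W := fun b τ δ => A m i (ext q α₀ b τ δ))
        fun α b τ δ hα => ((step q q' c c' α₀ α b τ δ hq hq' hc hc' hb rfl hα).1 hi).symm
      rw [e1, e2, h2]
    · have e2 := H.node (m := m) (i := i) hk hq' (W := fun b τ δ => A m i (ext q α₀ b τ δ))
        fun α b τ δ hα => ((step q q' c c' α₀ α b τ δ hq hq' hc hc' hb rfl hα).2 hcc).symm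
      rw [e1, e2, h2]

end SumTree


/-! ### The sums at the nodes of the tree -/

theorem bit_congr {i x j y : M} (h : bit i x = 1 ↔ bit j y = 1) : bit i x = bit j y := by
  rcases bit_cases i x with h' | h' <;> rcases bit_cases j y with h'' | h'' <;> grind

namespace SumTree

/-- The node `q` on level `k` computes the output `τ` for the subtree of the summands at `v`. -/
def At (k v : M) (τ : Prop) (q : M) : Prop :=
  len q = 12 • k + 4 • 1 ∧ (bit (2 • 1) q = 1 ↔ τ) ∧
    ∀ h, h ≤ k → bit (12 • h + 3 • 1) q = bit h v

theorem level_lt {h k : M} {r : ℕ} (hr : r < 12) (hh : h < k) :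
    12 • h + r • (1 : M) < 12 • k := by
  have h1 : 12 • (h + 1) ≤ 12 • k := nsmul_le_nsmul_right ((lt_iff _ _).1 hh) 12
  refine lt_of_lt_of_le ?_ h1
  rw [nsmul_add]
  refine (add_lt_add_iff_left _).2 ?_
  exact nsmul_lt_nsmul_left zero_lt_one' hr

theorem exists_at {X k v : M} (hk : k ≤ len (len X)) (hv : len v = k + 1) (τ : Prop) :
    ∃ q, At k v τ q := by
  have ht : Tiny (12 • k + 4 • (1 : M)) :=
    (((small_len X).tiny_len.of_le hk).nsmul 12).add (tiny_one.nsmul 4)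
  have hP : SDef fun x : Fin 1 → M => (x 0 = 2 • 1 ∧ τ) ∨
      ∃ h, h ≤ len (len X) ∧ h ≤ k ∧ x 0 = 12 • h + 3 • 1 ∧ bit h v = 1 :=
    SDef.or (SDef.and (by fun_prop) (SDef.const τ)) (SDef.ex (by fun_prop) (by fun_prop))
  obtain ⟨q, hq, hb⟩ := exists_bits (P := fun i => (i = 2 • 1 ∧ τ) ∨
    ∃ h, h ≤ len (len X) ∧ h ≤ k ∧ i = 12 • h + 3 • 1 ∧ bit h v = 1) hP ht
  have h3 : ∀ h, h ≤ k → (bit (12 • h + 3 • 1) q = 1 ↔ bit h v = 1) := by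
    intro h hh
    have hlt : 12 • h + 3 • (1 : M) < 12 • k + 4 • 1 :=
      add_lt_add_of_le_of_lt (nsmul_le_nsmul_right hh 12)
        (nsmul_lt_nsmul_left zero_lt_one' (by norm_num))
    rw [hb _ hlt]
    constructor
    · rintro (⟨h', _⟩ | ⟨h', _, _, e, hv⟩)
      · have : 2 • (1 : M) < 12 • h + 3 • 1 :=
          (nsmul_lt_nsmul_left zero_lt_one' (by norm_num)).trans_le le_add_self
        exact absurd h' this.ne'
      · have e := add_right_cancel e
        rcases lt_trichotomy h h' with hl | rfl | hl
        · have := level_lt (r := 0) (by norm_num) hl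
          rw [zero_nsmul, add_zero] at this
          exact absurd e this.ne
        · exact hv
        · have := level_lt (r := 0) (by norm_num) hl
          rw [zero_nsmul, add_zero] at this
          exact absurd e this.ne'
    · exact fun hv => Or.inr ⟨h, hh.trans hk, hh, rfl, hv⟩
  refine ⟨q, le_antisymm hq ?_, ?_, fun h hh => ?_⟩
  · have h0 : v ≠ 0 := by
      rintro rfl
      rw [len_zero] at hv
      exact add_one_ne_zero' _ hv.symm
    have htop := bit_len_sub_one h0
    rw [hv, add_tsub_cancel_right] at htop
    by_contra hn
    have hn : len q ≤ 12 • k + 3 • 1 := by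
      rw [succ_nsmul _ 3, ← add_assoc, not_le] at hn
      exact Order.lt_add_one_iff.1 hn
    have := (h3 k le_rfl).2 htop
    rw [bit_of_len_le hn] at this
    exact one_ne_zero' this.symm
  · have hlt : 2 • (1 : M) < 12 • k + 4 • 1 :=
      (nsmul_lt_nsmul_left zero_lt_one' (by norm_num)).trans_le le_add_self
    rw [hb _ hlt]
    refine ⟨?_, fun h => Or.inl ⟨rfl, h⟩⟩
    rintro (h | ⟨h, _, _, e, _⟩)
    · exact h.2
    · have : 2 • (1 : M) < 12 • h + 3 • 1 :=
        (nsmul_lt_nsmul_left zero_lt_one' (by norm_num)).trans_le le_add_self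
      exact absurd e this.ne
  · exact bit_congr (h3 h hh)

theorem at_ext {k v q : M} {α : List Bool} (hα : α.length = 8) {τ : Prop} (hq : At k v τ q)
    (b τ' δ : Bool) : At (k + 1) (child v b) (τ' = true) (ext q α b τ' δ) := by
  obtain ⟨h1, h2, h3⟩ := hq
  refine ⟨level_ext h1 hα b τ' δ, (bit_ext q b τ' δ).2.1, fun h hh => ?_⟩
  by_cases h0 : h = 0
  · subst h0
    rw [nsmul_zero, zero_add, bit_eq_ite (bit_ext q (α := α) b τ' δ).2.2]
    have := bit_child_zero v b
    rw [zero_nsmul] at this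
    rw [bit_eq_ite this]
  · obtain ⟨h', rfl⟩ : ∃ h', h = h' + 1 :=
      ⟨h - 1, (tsub_add_cancel_of_le ((ne_zero_iff h).1 h0)).symm⟩
    rw [bit_ext_add q b τ' δ hα, bit_add_one, half_child]
    exact h3 h' ((add_le_add_iff_right 1).1 hh)

section Node

variable (X w : M) (A : M → M → M → Prop)

/-- The digit `e` of the output `τ` of the adder for the sum of the summands below `m` whose numbers
start with the digits of `v`. -/
def out (m k v : M) (τ : Prop) (e : M) : Prop :=
  e < len w ∧ ∃ q, At k v τ q ∧ ∃ c, cnt X q k c ∧ A m (e + c) q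

variable {X w A} {f : M → M → Prop} (H : SumTree X f A)
include H

theorem out_iff {m k v e q c : M} {τ : Prop} (hk : k ≤ len (len X)) (hq : At k v τ q)
    (hc : cnt X q k c) : out X w A m k v τ e ↔ e < len w ∧ A m (e + c) q := by
  refine and_congr_right fun _ => ⟨?_, fun h => ⟨q, hq, c, hc, h⟩⟩
  rintro ⟨q', hq', c', hc', h⟩
  refine H.invariant hk q' q (e + c') (e + c) c' c hq'.1 hq.1 ?_ (fun h hh => ?_) hc' hc
    (by abel) h
  · exact bit_congr (hq'.2.1.trans hq.2.1.symm)
  · rw [hq'.2.2 h hh, hq.2.2 h hh]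

theorem sdef_out {n : ℕ} {fm fk fv fe : (Fin n → M) → M} (hm : TDef fm) (hk : TDef fk) (hv : TDef fv)
    (he : TDef fe) (τ : Prop) : SDef fun x => fk x ≤ len (len X) →
      out X w A (fm x) (fk x) (fv x) τ (fe x) := by
  obtain ⟨W, hW, hW'⟩ := exists_node_bound X
  have : SDef fun x : Fin 4 → M => x 1 ≤ len (len X) → (x 3 < len w ∧ ∃ q, q ≤ len W ∧
      (len q = 12 • x 1 + 4 • 1 ∧ (bit (2 • 1) q = 1 ↔ τ) ∧
        ∀ h, h ≤ len (len X) → h ≤ x 1 → bit (12 • h + 3 • 1) q = bit h (x 2)) ∧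
      ∃ c, c ≤ len W ∧ cnt X q (x 1) c ∧ A (x 0) (x 3 + c) q) := by
    refine SDef.imp (by fun_prop) (SDef.and (by fun_prop) (SDef.ex (by fun_prop) (SDef.and
      (by fun_prop) (SDef.ex (by fun_prop) (SDef.and ?_ ?_)))))
    · exact SDef.cnt (by fun_prop) (by fun_prop) (by fun_prop) (by fun_prop)
    · exact H.sdef.comp₃ (by fun_prop) (by fun_prop) (by fun_prop)
  refine (this.comp ![fm, fk, fv, fe] fun i => by fin_cases i <;> assumption).congr fun x => ?_
  show (fk x ≤ _ → _) ↔ _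
  refine imp_congr_right fun hk => and_congr_right fun _ => ?_
  show (∃ q, q ≤ len W ∧ (len q = 12 • fk x + 4 • 1 ∧ (bit (2 • 1) q = 1 ↔ τ) ∧
        ∀ h, h ≤ len (len X) → h ≤ fk x → bit (12 • h + 3 • 1) q = bit h (fv x)) ∧
      ∃ c, c ≤ len W ∧ cnt X q (fk x) c ∧ A (fm x) (fe x + c) q) ↔ _
  constructor
  · rintro ⟨q, _, ⟨h1, h2, h3⟩, c, _, hc, h⟩
    exact ⟨q, ⟨h1, h2, fun h hh => h3 h (hh.trans hk) hh⟩, c, hc, h⟩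
  · rintro ⟨q, ⟨h1, h2, h3⟩, c, hc, h⟩
    exact ⟨q, hW _ _ hk h1, ⟨h1, h2, fun h _ hh => h3 h hh⟩, c, hW' _ _ _ hc, hc, h⟩

/-- The output `τ` as a set of digits; it is empty beyond the leaves. -/
def num (w m k v : M) (τ : Prop) : DSet w where
  mem e := k ≤ len (len X) ∧ out X w A m k v τ e
  sdef := SDef.congr (SDef.and (SDef.const (k ≤ len (len X))) (H.sdef_out (TDef.const m)
    (TDef.const k) (TDef.const v) (TDef.var 0) τ)) fun x => by tauto
  lt _ h := h.2.1

theorem sdef_num {n : ℕ} {fm fk fv fe : (Fin n → M) → M} (hm : TDef fm) (hk : TDef fk) (hv : TDef fv)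
    (he : TDef fe) (τ : Prop) : SDef fun x => (H.num w (fm x) (fk x) (fv x) τ).mem (fe x) :=
  SDef.congr (SDef.and (SDef.le hk (TDef.const (len (len X)))) (H.sdef_out hm hk hv he τ))
    fun x => by show _ ↔ _ ∧ _; tauto

open DSet

omit H in
theorem shift_mem (U : DSet w) (e : M) : U.shift.mem e ↔ e < len w ∧ e ≠ 0 ∧ U.mem (e - 1) := Iff.rfl

/-- A node adds the four outputs of its children; the second output of an adder consists of carries,
and is therefore shifted. -/
theorem node_mem {m k v e : M} {τ : Prop} (hk : k < len (len X)) (hv : len v = k + 1)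
    (he : e < len w) : (H.num w m k v τ).mem e ↔ gate τ fun b τ' δ =>
      (DSet.shift^[δ.toNat] (DSet.shift^[τ'.toNat]
        (H.num w m (k + 1) (child v b) (τ' = true)))).mem e := by
  obtain ⟨q, hq⟩ := exists_at hk.le hv τ
  obtain ⟨c, hc⟩ := cnt_exists (q := q) hk.le
  have h1 : (H.num w m k v τ).mem e ↔ A m (e + c) q := by
    show _ ∧ _ ↔ _
    rw [H.out_iff hk.le hq hc]
    simp [hk.le, he]
  rw [h1, H.node hk hq.1 (W := fun b τ' δ => (DSet.shift^[δ.toNat] (DSet.shift^[τ'.toNat]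
        (H.num w m (k + 1) (child v b) (τ' = true)))).mem e), hq.2.1]
  intro α b τ' δ hα
  have hq' := at_ext hα hq b τ' δ
  have hc' := cnt_ext X q hα b τ' δ hk hc
  have hk' := (lt_iff _ _).1 hk
  have out' : ∀ e', e' < len w → ((H.num w m (k + 1) (child v b) (τ' = true)).mem e' ↔
      A m (e' + (c + ((if δ then 1 else 0) + (if τ' then 1 else 0)))) (ext q α b τ' δ)) := by
    intro e' he'
    show _ ∧ _ ↔ _
    rw [H.out_iff hk' hq' hc']
    simp [hk', he']
  have low := fun i h => (H.le_of_mem (m := m) hk' _ i _ hq'.1 hc' h).1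
  have pred : ∀ {i : M}, i ≠ 0 → i = i - 1 + 1 := fun {i} h =>
    (tsub_add_cancel_of_le ((ne_zero_iff i).1 h)).symm
  cases δ <;> cases τ' <;>
    simp only [Bool.toNat_false, Bool.toNat_true, Function.iterate_zero, Function.iterate_one, id,
      shift_mem, he, true_and, Bool.false_eq_true, if_false, if_true, add_zero, zero_add] at out' low ⊢
  · rw [out' e he]
  · by_cases h0 : e = 0
    · subst h0
      refine iff_of_false (fun h => ?_) (by simp)
      have := low _ h
      grind [zero_lt_one' (M := M)]
    · have hp := pred h0
      have hlt : e - 1 < len w := tsub_le_self.trans_lt he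
      rw [out' _ hlt]
      simp only [h0, ne_eq, not_false_eq_true, true_and]
      rw [show e + c = e - 1 + (c + 1) by grind]
  · by_cases h0 : e = 0
    · subst h0
      refine iff_of_false (fun h => ?_) (by simp)
      have := low _ h
      grind [zero_lt_one' (M := M)]
    · have hp := pred h0
      have hlt : e - 1 < len w := tsub_le_self.trans_lt he
      rw [out' _ hlt]
      simp only [h0, ne_eq, not_false_eq_true, true_and]
      rw [show e + c = e - 1 + (c + 1) by grind]
  · by_cases h0 : e = 0
    · subst h0
      refine iff_of_false (fun h => ?_) (by simp)
      have := low _ h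
      grind [zero_lt_one' (M := M)]
    · have hp := pred h0
      have hlt : e - 1 < len w := tsub_le_self.trans_lt he
      by_cases h1 : e - 1 = 0
      · refine iff_of_false (fun h => ?_) (by simp [h1])
        have := low _ h
        grind [zero_lt_one' (M := M)]
      have hp1 := pred h1
      have hlt1 : e - 1 - 1 < len w := tsub_le_self.trans_lt hlt
      rw [out' _ hlt1]
      simp only [h0, h1, ne_eq, not_false_eq_true, true_and, hlt]
      rw [show e + c = e - 1 - 1 + (c + (1 + 1)) by grind]

/-- The sum of the summands below `m` whose numbers start with the digits of `v`. -/
def total (w m k v : M) : DSet w := H.num w m k v False + (H.num w m k v True).shift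

theorem total_node {m k v : M} (hk : k < len (len X)) (hv : len v = k + 1) :
    H.total w m k v = H.total w m (k + 1) (child v false) + H.total w m (k + 1) (child v true) := by
  unfold total
  rw [← add_assoc]
  set a := H.num w m (k + 1) (child v false) False with ha
  set b := (H.num w m (k + 1) (child v false) True).shift with hb
  set c := H.num w m (k + 1) (child v true) False with hc
  set d := (H.num w m (k + 1) (child v true) True).shift with hd
  have hmaj : ∀ e, (maj3 a b c).shift.mem e ↔
      maj (a.shift.mem e) (b.shift.mem e) (c.shift.mem e) := by
    intro e
    show (_ ∧ _ ∧ maj _ _ _) ↔ _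
    simp only [shift_mem, maj]
    tauto
  have hs : H.num w m k v False = xor3 (xor3 a b c) (shift (maj3 a b c)) d := by
    refine ext_iff_lt fun e he => ?_
    rw [H.node_mem hk hv he]
    simp only [gate, Bool.toNat_false, Bool.toNat_true, Function.iterate_zero, Function.iterate_one,
      id, Bool.false_eq_true]
    show _ ↔ Xor (Xor (Xor (Xor (a.mem e) (b.mem e)) (c.mem e)) ((maj3 a b c).shift.mem e)) (d.mem e)
    simp only [not_false_eq_true, true_and, false_and, or_false, ← ha, ← hb, ← hc, ← hd]
    rw [hmaj]
  have hc' : H.num w m k v True = maj3 (xor3 a b c) (shift (maj3 a b c)) d := by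
    refine ext_iff_lt fun e he => ?_
    rw [H.node_mem hk hv he]
    simp only [gate, Bool.toNat_false, Bool.toNat_true, Function.iterate_zero, Function.iterate_one,
      id, Bool.false_eq_true]
    show _ ↔ maj (Xor (Xor (a.mem e) (b.mem e)) (c.mem e)) ((maj3 a b c).shift.mem e) (d.mem e)
    simp only [not_true_eq_false, true_and, false_and, false_or, ← ha, ← hb, ← hc, ← hd]
    rw [hmaj]
  rw [add_add_eq a b c, hs, hc', ← add_add_eq (xor3 a b c)]

/-- The total of a leaf is the summand at the leaf. -/
theorem total_leaf {m v e : M} (hv : len v = len (len X) + 1) :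
    (H.total w m (len (len X)) v).mem e ↔ e < len w ∧ ∃ j, j ≤ len X ∧ j < m ∧
      (∀ h, h < len (len X) → bit h j = bit h v) ∧ f j e := by
  have hT : H.num w m (len (len X)) v True = 0 := by
    refine ext_iff_lt fun e he => iff_of_false ?_ (zero_mem e)
    obtain ⟨q, hq⟩ := exists_at le_rfl hv True
    obtain ⟨c, hc⟩ := cnt_exists (X := X) (q := q) le_rfl
    rintro ⟨_, h⟩
    exact ((H.leaf hq.1).1 ((H.out_iff le_rfl hq hc).1 h).2).1 (hq.2.1.2 trivial)
  have h0 : shift (0 : DSet w) = 0 := ext_iff_lt fun e he =>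
    iff_of_false (fun h => zero_mem _ h.2.2) (zero_mem e)
  rw [total, hT, h0, add_zero]
  obtain ⟨q, hq⟩ := exists_at le_rfl hv False
  obtain ⟨c, hc⟩ := cnt_exists (X := X) (q := q) le_rfl
  show _ ∧ _ ↔ _
  rw [H.out_iff le_rfl hq hc, H.leaf hq.1]
  have h2 : bit (2 • 1) q ≠ 1 := hq.2.1.1
  simp only [ne_eq, h2, not_false_eq_true, true_and, le_refl]
  refine and_congr_right fun he => exists_congr fun j => and_congr_right fun _ =>
    and_congr_right fun _ => and_congr ?_ ?_
  · refine forall_congr' fun h => ⟨fun h' hh => ?_, fun h' _ hh => ?_⟩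
    · rw [h' hh.le hh, hq.2.2 h hh.le]
    · rw [h' hh, hq.2.2 h hh.le]
  · constructor
    · rintro ⟨c', hc', _, h⟩
      rwa [← cnt_unique le_rfl hc hc', add_tsub_cancel_right] at h
    · exact fun h => ⟨c, hc, le_add_self, by rwa [add_tsub_cancel_right]⟩

theorem sdef_total {n : ℕ} {fm fk fv fe : (Fin n → M) → M} (hm : TDef fm) (hk : TDef fk)
    (hv : TDef fv) (he : TDef fe) : SDef fun x => (H.total w (fm x) (fk x) (fv x)).mem (fe x) := by
  have h1 : ∀ {n : ℕ} {fm fk fv fe : (Fin n → M) → M} (hm : TDef fm) (hk : TDef fk)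
      (hv : TDef fv) (he : TDef fe), SDef fun x => (H.num w (fm x) (fk x) (fv x) True).shift.mem (fe x) :=
    fun hm hk hv he => SDef.and (by fun_prop) (SDef.and (by fun_prop)
      (H.sdef_num hm hk hv (by fun_prop) True))
  have : SDef fun x : Fin 4 → M => (H.total w (x 0) (x 1) (x 2)).mem (x 3) :=
    SDef.dsum (U := fun x : Fin 4 → M => (H.num w (x 0) (x 1) (x 2) False).mem)
      (V := fun x => (H.num w (x 0) (x 1) (x 2) True).shift.mem)
      (H.sdef_num (by fun_prop) (by fun_prop) (by fun_prop) (by fun_prop) False)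
      (h1 (by fun_prop) (by fun_prop) (by fun_prop) (by fun_prop)) (by fun_prop)
  exact this.comp ![fm, fk, fv, fe] fun i => by fin_cases i <;> assumption

end Node

end SumTree


/-! ### Sums over initial segments -/

theorem carry_congr {w w' : M} {U U' V V' : M → Prop} {i : M} (hi : i ≤ len w) (hi' : i ≤ len w')
    (hU : ∀ j, j < i → (U j ↔ U' j)) (hV : ∀ j, j < i → (V j ↔ V' j)) :
    carry w U V i ↔ carry w' U' V' i := by
  unfold carry
  refine exists_congr fun j => ⟨?_, ?_⟩
  · rintro ⟨_, hj, h, h'⟩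
    refine ⟨hj.le.trans hi', hj, by rwa [← hU j hj, ← hV j hj], fun k _ hjk hk => ?_⟩
    rw [← hU k hk, ← hV k hk]
    exact h' k (hk.le.trans hi) hjk hk
  · rintro ⟨_, hj, h, h'⟩
    refine ⟨hj.le.trans hi, hj, by rwa [hU j hj, hV j hj], fun k _ hjk hk => ?_⟩
    rw [hU k hk, hV k hk]
    exact h' k (hk.le.trans hi') hjk hk

theorem dsum_congr {w w' : M} {U U' V V' : M → Prop} {i : M} (hi : i < len w) (hi' : i < len w')
    (hU : ∀ j, j ≤ i → (U j ↔ U' j)) (hV : ∀ j, j ≤ i → (V j ↔ V' j)) :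
    dsum w U V i ↔ dsum w' U' V' i := by
  simp only [dsum, hi, hi', true_and, hU i le_rfl, hV i le_rfl,
    carry_congr hi.le hi'.le (fun j hj => hU j hj.le) fun j hj => hV j hj.le]

/-- The set of the digits `f m`. -/
def digits {f : M → M → Prop} (hf : SDef fun v : Fin 2 → M => f (v 0) (v 1)) (w m : M) : DSet w where
  mem e := e < len w ∧ f m e
  sdef := SDef.and (by fun_prop) (hf.comp₂ (TDef.const m) (TDef.var 0))
  lt _ h := h.1

namespace SumTree

variable {X w : M} {A : M → M → M → Prop} {f : M → M → Prop} (H : SumTree X f A)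
include H
open DSet

theorem total_zero {k : M} (v : M) (hk : k ≤ len (len X)) : H.total w 0 k v = 0 := by
  have h : ∀ τ, H.num w 0 k v τ = 0 := by
    intro τ
    refine ext_iff_lt fun e he => iff_of_false ?_ (zero_mem e)
    rintro ⟨_, _, q, hq, c, hc, h⟩
    exact (H.le_of_mem hk q _ c hq.1 hc h).2 rfl
  have h0 : shift (0 : DSet w) = 0 := ext_iff_lt fun e he =>
    iff_of_false (fun h => zero_mem _ h.2.2) (zero_mem e)
  rw [total, h, h, h0, add_zero]

/-- Increasing the number of summands by one adds the new summand to the totals of the nodes on the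
path to its leaf, and does not change the other ones. -/
theorem total_succ (hf : SDef fun v : Fin 2 → M => f (v 0) (v 1)) {m : M} (hm : m < len X) :
    H.total w (m + 1) 0 1 = H.total w m 0 1 + digits hf w m := by
  set L := len (len X) with hL
  set u := pad 1 (len X) + m with hu
  have hlt : m < pad 1 (len X) := hm.trans (lt_pad_one _)
  have hmu : msp u L = 1 := (msp_pad_add hlt).1
  have hbu : ∀ h, h < L → bit h u = bit h m := fun h hh => bit_pad_add_of_lt 1 m hh
  have hlu : len u = L + 1 := by
    have := len_msp u L
    rw [hmu, len_one] at this
    have hle : L ≤ len u := by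
      by_contra hn
      rw [tsub_eq_zero_of_le (not_le.1 hn).le] at this
      exact one_ne_zero' this
    rw [add_comm, this, tsub_add_cancel_of_le hle]
  obtain ⟨W, hW⟩ := ((small_len X).tiny_len.add tiny_one).exists_bound
  have key := level_induction (X := X) (P := fun k => ∀ v, v ≤ len W → len v = k + 1 →
    (v = msp u (L - k) → ∀ e, e ≤ len w → ((H.total w (m + 1) k v).mem e ↔
      dsum w (H.total w m k v).mem (digits hf w m).mem e)) ∧
    (v ≠ msp u (L - k) → ∀ e, e ≤ len w → ((H.total w (m + 1) k v).mem e ↔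
      (H.total w m k v).mem e))) ?_ ?_ ?_ 0 zero_le 1 (hW 1 (by simp)) (by simp)
  · refine ext_iff_lt fun e he => ?_
    rw [tsub_zero, hmu] at key
    exact key.1 rfl e he.le
  · refine SDef.all (by fun_prop) (SDef.imp (by fun_prop) (SDef.and (SDef.imp (by fun_prop)
      (SDef.all (by fun_prop) (SDef.iff ?_ ?_))) (SDef.imp (by fun_prop)
      (SDef.all (by fun_prop) (SDef.iff ?_ ?_)))))
    · exact H.sdef_total (by fun_prop) (by fun_prop) (by fun_prop) (by fun_prop)
    · exact SDef.dsum (U := fun x : Fin 3 → M => (H.total w m (x 2) (x 1)).mem)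
        (V := fun x => (digits hf w m).mem)
        (H.sdef_total (by fun_prop) (by fun_prop) (by fun_prop) (by fun_prop))
        ((digits hf w m).sdef.comp₁ (TDef.var 0)) (by fun_prop)
    · exact H.sdef_total (by fun_prop) (by fun_prop) (by fun_prop) (by fun_prop)
    · exact H.sdef_total (by fun_prop) (by fun_prop) (by fun_prop) (by fun_prop)
  · -- the leaves
    intro v _ hv
    rw [tsub_self, msp_zero]
    refine ⟨fun hvu e he => ?_, fun hvu e he => ?_⟩
    · subst hvu
      have h0 : H.total w m L u = 0 := by
        refine ext_iff_lt fun e _ => iff_of_false (fun h => ?_) (zero_mem e)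
        obtain ⟨_, j, hj, hjm, hb, _⟩ := (H.total_leaf hv).1 h
        refine hjm.ne (eq_of_bit fun i hi => ?_)
        have hi : i < L := by
          rcases hi with hi | hi
          · exact hi.trans_le (len_mono hj)
          · exact hi.trans_le (len_mono hm.le)
        rw [hb i hi, hbu i hi]
      rw [← hL, ← DSet.add_mem, h0, zero_add, H.total_leaf hv]
      refine and_congr_right fun _ => ⟨?_, fun h => ⟨m, hm.le, Order.lt_add_one_iff.2 le_rfl,
        fun i hi => (hbu i hi).symm, h⟩⟩
      rintro ⟨j, hj, _, hb, h⟩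
      have : j = m := by
        refine eq_of_bit fun i hi => ?_
        have hi : i < L := by
          rcases hi with hi | hi
          · exact hi.trans_le (len_mono hj)
          · exact hi.trans_le (len_mono hm.le)
        rw [hb i hi, hbu i hi]
      rwa [← this]
    · rw [H.total_leaf hv, H.total_leaf hv]
      refine and_congr_right fun _ => exists_congr fun j => and_congr_right fun _ => ?_
      refine ⟨fun ⟨hj, hb, h⟩ => ⟨?_, hb, h⟩, fun ⟨hj, hb, h⟩ =>
        ⟨hj.trans (Order.lt_add_one_iff.2 le_rfl), hb, h⟩⟩
      refine lt_of_le_of_ne (Order.lt_add_one_iff.1 hj) ?_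
      rintro rfl
      -- otherwise `v` and `u` have the same digits, the first one being `1`
      have hne : ∀ {x : M}, len x = L + 1 → bit L x = 1 := by
        intro x hx
        have := bit_len_sub_one (x := x) (by rintro rfl; rw [len_zero] at hx; exact add_one_ne_zero' _ hx.symm)
        rwa [hx, add_tsub_cancel_right] at this
      refine hvu (eq_of_bit_of_len (hv.trans hlu.symm) fun i hi => ?_)
      rw [hv] at hi
      rcases eq_or_lt_of_le (Order.lt_add_one_iff.1 hi) with rfl | hlt
      · exact (hne hv).trans (hne hlu).symm
      · rw [← hb i hlt, hbu i hlt]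
  · -- the inner nodes
    intro k hk ih v _ hv
    have hk' := (lt_iff _ _).1 hk
    have hv0 : v ≠ 0 := by
      rintro rfl
      rw [len_zero] at hv
      exact add_one_ne_zero' _ hv.symm
    have hlc : ∀ b, len (child v b) = k + 1 + 1 := fun b => by rw [len_child hv0, hv]
    have hcW : ∀ b, child v b ≤ len W := fun b => hW _ (by
      rw [hlc]
      exact (add_le_add_iff_right 1).2 hk')
    have hms : msp u (L - k) = half (msp u (L - (k + 1))) := by
      rw [sub_add_one_sub hk, msp_succ]
    have hon : ∀ b, child v b = msp u (L - (k + 1)) →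
        H.total w (m + 1) (k + 1) (child v b) = H.total w m (k + 1) (child v b) + digits hf w m :=
      fun b hb => ext_iff_lt fun e he => (ih _ (hcW b) (hlc b)).1 hb e he.le
    have hoff : ∀ b, child v b ≠ msp u (L - (k + 1)) →
        H.total w (m + 1) (k + 1) (child v b) = H.total w m (k + 1) (child v b) :=
      fun b hb => ext_iff_lt fun e he => (ih _ (hcW b) (hlc b)).2 hb e he.le
    have hne : child v false ≠ child v true := by
      intro h
      have := bit_child_zero v true
      rw [← h, bit_child_zero] at this
      simp at this
    rw [H.total_node hk hv, H.total_node hk hv]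
    refine ⟨fun hvu e _ => ?_, fun hvu e _ => ?_⟩
    · rw [← DSet.add_mem]
      rcases half_cases (msp u (L - (k + 1))) with h | h
      · have h' : child v false = msp u (L - (k + 1)) := by
          rw [h, ← hms, ← hvu]; rfl
        rw [hon false h', hoff true fun h => hne (h'.trans h.symm), add_right_comm]
      · have h' : child v true = msp u (L - (k + 1)) := by
          rw [h, ← hms, ← hvu]; rfl
        rw [hon true h', hoff false fun h => hne (h.trans h'.symm), add_assoc]
    · have : ∀ b, child v b ≠ msp u (L - (k + 1)) := by
        intro b hb
        rw [hms, ← hb, half_child] at hvu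
        exact hvu rfl
      rw [hoff _ (this _), hoff _ (this _)]

/-- The digits of the total are computed at the two roots of the tree. -/
theorem total_mem (m e : M) : (H.total w m 0 1).mem e ↔
    dsum w (fun e => A m e (8 • 1)) (dshift w fun e => A m e (12 • 1)) e := by
  have hroot : ∀ c : Bool, At 0 1 (c = true) (child (child (child 1 c) false) false : M) := by
    intro c
    have h1 : (1 : M) ≠ 0 := one_ne_zero'
    refine ⟨?_, ?_, fun h hh => ?_⟩
    · rw [len_child (child_ne_zero (child_ne_zero h1 _) _), len_child (child_ne_zero h1 _),
        len_child h1, len_one, nsmul_zero, zero_add]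
      simp only [succ_nsmul, zero_nsmul, zero_add]
    · rw [bit_child_succ _ _ 1, bit_child_succ _ _ 0, bit_child_zero]
    · rw [le_antisymm hh zero_le, nsmul_zero, zero_add, bit_child_succ _ _ 2, bit_child_succ _ _ 1,
        bit_child_succ _ _ 0, zero_nsmul]
  have e8 : (8 • 1 : M) = child (child (child 1 false) false) false := by
    simp only [child, Bool.false_eq_true, if_false, succ_nsmul, zero_nsmul, zero_add]
    abel
  have e12 : (12 • 1 : M) = child (child (child 1 true) false) false := by
    simp only [child, Bool.false_eq_true, if_false, if_true, succ_nsmul, zero_nsmul, zero_add]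
    abel
  have hn : ∀ c : Bool, ∀ e, (H.num w m 0 1 (c = true)).mem e ↔ e < len w ∧
      A m e (child (child (child 1 c) false) false) := by
    intro c e
    show _ ∧ _ ↔ _
    rw [H.out_iff zero_le (hroot c) (cnt_zero.2 rfl), add_zero]
    simp
  have hF := hn false
  have hT := hn true
  simp only [Bool.false_eq_true, ← e8] at hF
  simp only [← e12] at hT
  rw [total, DSet.add_mem]
  by_cases he : e < len w
  · refine dsum_congr he he (fun j hj => ?_) (fun j hj => ?_)
    · rw [hF]
      simp [hj.trans_lt he]
    · rw [shift_mem, dshift]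
      refine and_congr_right fun hj' => and_congr_right fun _ => ?_
      rw [hT]
      simp [tsub_le_self.trans_lt hj']
  · exact iff_of_false (fun h => he h.1) fun h => he h.1

end SumTree


/-! ### Bounds by polynomials in lengths -/

theorem lmul_mono {x x' y y' : M} (hx : len x ≤ len x') (hy : len y ≤ len y') :
    lmul x y ≤ lmul x' y' := by
  have key : ∀ {x x' : M} (y : M), len x ≤ len x' → lmul x y ≤ lmul x' y := by
    intro x x' y h
    obtain ⟨v, hv⟩ := exists_len_eq (tsub_le_self : len x' - len x ≤ len x')
    rw [lmul_add (x := x') (u := x) (v := v) y (by rw [hv, add_tsub_cancel_of_le h])]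
    exact le_self_add
  refine (key y hx).trans ?_
  rw [lmul_comm x' y, lmul_comm x' y']
  exact key x' hy

/-- A number whose length is the value of the monomial `N` at the lengths of `a`. -/
def monoVal {n : ℕ} (N : List (Fin n)) (a : Fin n → M) : M :=
  N.foldr (fun i t => half (smash (a i) t)) 1

/-- The value of a polynomial in lengths. -/
def polyVal {n : ℕ} (P : LenPoly n) (a : Fin n → M) : M :=
  (P.map fun N => len (monoVal N a)).foldr (· + ·) 0

theorem realize_monoTerm {α : Type} {n : ℕ} (N : List (Fin n)) (a : Fin n → LAID.Term α)
    (v : α → M) : (monoTerm N a).realize v = monoVal N fun i => (a i).realize v := by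
  unfold monoTerm monoVal
  induction N with
  | nil => simp
  | cons i N ih => simp [ih]

theorem realize_polyTerm {α : Type} {n : ℕ} (P : LenPoly n) (a : Fin n → LAID.Term α)
    (v : α → M) : (P.term a).realize v = polyVal P fun i => (a i).realize v := by
  unfold LenPoly.term polyVal
  induction P with
  | nil => simp
  | cons N P ih =>
    simp only [List.map_cons, List.foldr_cons, realize_add, realize_len, realize_monoTerm, ih]

theorem polyVal_mono {n : ℕ} (P : LenPoly n) {a b : Fin n → M} (h : ∀ i, len (a i) ≤ len (b i)) :
    polyVal P a ≤ polyVal P b := by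
  have hm : ∀ N : List (Fin n), len (monoVal N a) ≤ len (monoVal N b) := by
    intro N
    unfold monoVal
    induction N with
    | nil => exact le_rfl
    | cons i N ih => exact lmul_mono (h i) ih
  unfold polyVal
  induction P with
  | nil => exact le_rfl
  | cons N P ih => exact add_le_add (hm N) ih

theorem polyVal_cons {n : ℕ} (P : LenPoly n) (i : Fin n) (a : Fin n → M) :
    polyVal ([i] :: P) a = len (a i) + polyVal P a := by
  have : lmul (a i) 1 = len (a i) := by rw [lmul_comm, one_lmul]
  show lmul (a i) 1 + _ = _
  rw [this]
  rfl

theorem SumTree.total_lt {X w : M} {A : M → M → M → Prop} {f : M → M → Prop} (H : SumTree X f A)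
    (hf : SDef fun v : Fin 2 → M => f (v 0) (v 1)) {b : M} (hb : ∀ m e, m < len X → f m e → e < b)
    {m e : M} (hm : m ≤ len X) (h : (H.total w m 0 1).mem e) : e < b + m := by
  refine length_induction (P := fun m => ∀ e, e ≤ len w → (H.total w m 0 1).mem e → e < b + m)
    ?_ X ?_ ?_ m hm e (((H.total w m 0 1).lt e h).le) h
  · exact SDef.all (by fun_prop) (SDef.imp
      (H.sdef_total (by fun_prop) (by fun_prop) (by fun_prop) (by fun_prop)) (by fun_prop))
  · intro e _ h
    rw [H.total_zero _ zero_le] at h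
    exact absurd h (DSet.zero_mem e)
  · intro m hm ih e he h
    rw [H.total_succ hf hm] at h
    by_contra hn
    have hn : b + m < e := by
      rw [lt_iff, add_assoc]
      exact not_lt.1 hn
    have h1 : ∀ j, b + m ≤ j → ¬ (H.total w m 0 1).mem j := fun j hj h' =>
      (ih j ((H.total w m 0 1).lt j h').le h').not_ge hj
    have h2 : ∀ j, b + m ≤ j → ¬ (digits hf w m).mem j := fun j hj h' =>
      (hb m j hm h'.2).not_ge (le_self_add.trans hj)
    obtain ⟨_, h⟩ := h
    have hc : ¬ carry w (H.total w m 0 1).mem (digits hf w m).mem e := by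
      rintro ⟨j, _, hj, hUV, h'⟩
      have hjb : j < b + m := by
        by_contra hj'
        exact h1 j (not_lt.1 hj') hUV.1
      have := h' (b + m) (hn.le.trans he) hjb hn
      have e1 := h1 _ le_rfl
      have e2 := h2 _ le_rfl
      simp [Xor, e1, e2] at this
    have e1 := h1 _ hn.le
    have e2 := h2 _ hn.le
    simp [Xor, e1, e2, hc] at h

/-- The sum of the first numbers does not depend on the tree used for its computation. -/
theorem SumTree.total_unique {X X' w : M} {A A' : M → M → M → Prop} {f : M → M → Prop}
    (H : SumTree X f A) (H' : SumTree X' f A') (hf : SDef fun v : Fin 2 → M => f (v 0) (v 1))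
    {m : M} (hm : m ≤ len X) (hm' : m ≤ len X') : H.total w m 0 1 = H'.total w m 0 1 := by
  have key := length_induction (P := fun m => m ≤ len X' → ∀ e, e ≤ len w →
    ((H.total w m 0 1).mem e ↔ (H'.total w m 0 1).mem e)) ?_ X ?_ ?_ m hm hm'
  · exact DSet.ext_iff_lt fun e he => key e he.le
  · refine SDef.imp (by fun_prop) (SDef.all (by fun_prop) (SDef.iff ?_ ?_))
    · exact H.sdef_total (by fun_prop) (by fun_prop) (by fun_prop) (by fun_prop)
    · exact H'.sdef_total (by fun_prop) (by fun_prop) (by fun_prop) (by fun_prop)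
  · intro _ e _
    rw [H.total_zero _ zero_le, H'.total_zero _ zero_le]
  · intro m hm ih hm' e _
    have hlt := (lt_iff _ _).2 hm'
    have : H.total w m 0 1 = H'.total w m 0 1 := DSet.ext_iff_lt fun e he => ih hlt.le e he.le
    rw [H.total_succ hf hm, H'.total_succ hf hlt, this]

end Mod

/-- Uniform bounds by the length of a term. -/
theorem exists_len_bound {n : ℕ} (P : LenPoly n) : ∃ t : ∀ (M : Type) [AIDModel M], (Fin n → M) → M,
    UTDef t ∧ ∀ (M : Type) [AIDModel M] (v : Fin n → M), polyVal P v ≤ Mod.len (t M v) := by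
  induction P with
  | nil => exact ⟨_, UTDef.zero, fun M _ v => zero_le⟩
  | cons N P ih =>
    obtain ⟨t, ht, h⟩ := ih
    have hN : UTDef fun M _ (v : Fin n → M) => monoVal N v :=
      ⟨monoTerm N Term.var, fun M _ v => by rw [realize_monoTerm]; rfl⟩
    refine ⟨_, (hN.add UTDef.one).pad (ht.add UTDef.one), fun M _ v => ?_⟩
    rw [len_pad (add_one_ne_zero' _)]
    exact add_le_add (len_mono le_self_add) ((h M v).trans (len_mono le_self_add))

theorem UDef.ind {n m : ℕ} (d : IndDef m) {f : Fin m → ∀ (M : Type) [AIDModel M], (Fin n → M) → M}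
    {g : ∀ (M : Type) [AIDModel M], (Fin n → M) → M} (hf : ∀ i, UTDef (f i)) (hg : UTDef g) :
    UDef fun M _ v => Mod.ind d (fun i => f i M v) (g M v) := by
  choose t ht using hf
  obtain ⟨s, hs⟩ := hg
  refine ⟨Relations.formula (L := LAID) (n := m + 1) (Sum.inr (IndPred.mk d)) (Fin.snoc t s),
    IsSigma0.rel _ _, fun M _ v => ?_⟩
  rw [Formula.realize_rel]
  refine iff_of_eq (congrArg _ (funext fun i => ?_))
  refine Fin.lastCases ?_ (fun i => ?_) i
  · simp [hs]
  · simp [ht]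

section Families

variable {n : ℕ} {w f : ∀ (M : Type) [AIDModel M], (Fin n → M) → M}
  {U V : ∀ (M : Type) [AIDModel M], (Fin n → M) → M → Prop}

theorem UDef.comp_lift (hU : UDef fun M _ (v : Fin (n + 1) → M) => U M (fun i => v i.succ) (v 0))
    {m : ℕ} {g : Fin n → ∀ (M : Type) [AIDModel M], (Fin m → M) → M} (hg : ∀ i, UTDef (g i))
    {f : ∀ (M : Type) [AIDModel M], (Fin m → M) → M} (hf : UTDef f) :
    UDef fun M _ v => U M (fun i => g i M v) (f M v) := by
  refine (hU.comp (f := Fin.cons f g) (Fin.cases hf hg)).congr fun M _ v => ?_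
  simp

theorem UDef.xor {P Q : ∀ (M : Type) [AIDModel M], (Fin n → M) → Prop} (hP : UDef P) (hQ : UDef Q) :
    UDef fun M _ v => Xor (P M v) (Q M v) := by
  simp only [Xor]
  exact (hP.and hQ.not).or (hQ.and hP.not)

theorem UDef.dsum (hw : UTDef w) (hf : UTDef f)
    (hU : UDef fun M _ (v : Fin (n + 1) → M) => U M (fun i => v i.succ) (v 0))
    (hV : UDef fun M _ (v : Fin (n + 1) → M) => V M (fun i => v i.succ) (v 0)) :
    UDef fun M _ v => Mod.dsum (w M v) (U M v) (V M v) (f M v) := by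
  unfold Mod.dsum Mod.carry
  have h0 : ∀ {W : ∀ (M : Type) [AIDModel M], (Fin n → M) → M → Prop},
      UDef (fun M _ (v : Fin (n + 1) → M) => W M (fun i => v i.succ) (v 0)) →
      UDef fun M _ v => W M v (f M v) := fun hW => hW.comp_lift (fun i => UTDef.var i) hf
  refine UDef.and (UDef.lt hf hw.len) (UDef.xor (UDef.xor (h0 hU) (h0 hV)) (UDef.ex hw ?_))
  refine UDef.and (UDef.lt (UTDef.var 0) hf.up) (UDef.and (UDef.and hU hV)
    (UDef.all (f := fun M _ v => w M fun i => v i.succ) hw.up ?_))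
  refine UDef.imp (UDef.lt (UTDef.var 1) (UTDef.var 0)) (UDef.imp (UDef.lt (UTDef.var 0) hf.up.up)
    (UDef.xor ?_ ?_))
  · exact hU.comp_lift (g := fun i _ _ v => v i.succ.succ) (fun i => UTDef.var _) (UTDef.var 0)
  · exact hV.comp_lift (g := fun i _ _ v => v i.succ.succ) (fun i => UTDef.var _) (UTDef.var 0)

theorem UDef.dshift (hw : UTDef w) (hf : UTDef f)
    (hU : UDef fun M _ (v : Fin (n + 1) → M) => U M (fun i => v i.succ) (v 0)) :
    UDef fun M _ v => Mod.dshift (w M v) (U M v) (f M v) :=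
  UDef.and (UDef.lt hf hw.len) (UDef.and (UDef.not (UDef.eq hf UTDef.zero))
    (hU.comp_lift (g := fun i _ _ v => v i) (fun i => UTDef.var i) (hf.sub UTDef.one)))

end Families

end BoundedArith

namespace BoundedArith

open BoundedArith.Mod

/-! ### The formula for the sum -/

/-- The digit `e` of the value `f(m, y)` of a bitdefinable function. -/
def IsDigit {k : ℕ} (Af : LAID.Formula (Fin (k + 2))) (P : LenPoly (k + 1)) {M : Type} [AIDModel M]
    (y : Fin k → M) (m e : M) : Prop :=
  e < polyVal P (Fin.cons m y : Fin (k + 1) → M) ∧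
    Af.Realize (Fin.cons e (Fin.cons m y) : Fin (k + 2) → M)

section Digit

variable {k : ℕ} {Af : LAID.Formula (Fin (k + 2))} (hAf : IsSigma0 Af) (P : LenPoly (k + 1))

include hAf

theorem UDef.isDigit {n : ℕ} {m e : ∀ (M : Type) [AIDModel M], (Fin n → M) → M}
    {y : Fin k → ∀ (M : Type) [AIDModel M], (Fin n → M) → M} (hy : ∀ i, UTDef (y i))
    (hm : UTDef m) (he : UTDef e) :
    UDef fun M _ v => IsDigit Af P (fun i => y i M v) (m M v) (e M v) := by
  have hP : UTDef fun M _ (v : Fin (k + 1) → M) => polyVal P v :=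
    ⟨P.term Term.var, fun M _ v => by rw [realize_polyTerm]; rfl⟩
  have h : UDef fun M _ (v : Fin (k + 2) → M) =>
      v 0 < polyVal P (fun i => v i.succ) ∧ Af.Realize v :=
    UDef.and (UDef.lt (UTDef.var 0) hP.up) (UDef.realize hAf)
  have hc : ∀ i : Fin (k + 2), UTDef ((Fin.cons e (Fin.cons m y : Fin (k + 1) → _) :
      Fin (k + 2) → ∀ (M : Type) [AIDModel M], (Fin n → M) → M) i) :=
    Fin.cases he (Fin.cases hm hy)
  refine (h.comp hc).congr fun M _ v => ?_
  have e1 : (fun i : Fin (k + 2) => (Fin.cons e (Fin.cons m y : Fin (k + 1) → _) :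
      Fin (k + 2) → ∀ (M : Type) [AIDModel M], (Fin n → M) → M) i M v) =
      Fin.cons (e M v) (Fin.cons (m M v) fun i => y i M v : Fin (k + 1) → M) := by
    funext i
    refine Fin.cases rfl (Fin.cases rfl fun i => rfl) i
  rw [e1]
  rfl

theorem SDef.isDigit {M : Type} [AIDModel M] (y : Fin k → M) :
    SDef fun v : Fin 2 → M => IsDigit Af P y (v 0) (v 1) :=
  (UDef.isDigit (n := k + 2) hAf P (y := fun i _ _ v => v i.succ.succ) (fun _ => UTDef.var _)
    (UTDef.var 0) (UTDef.var 1)).sdef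
    (f := Fin.cons (fun v => v 0) (Fin.cons (fun v => v 1) fun i _ => y i))
    (Fin.cases (TDef.var 0) (Fin.cases (TDef.var 1) fun _ => TDef.const _))

/-- The digits of sums of values of a bitdefinable function are inductively definable. -/
theorem exists_sumTree : ∃ d : IndDef (k + 3), ∀ (M : Type) [AIDModel M] (X : M) (y : Fin k → M),
    SumTree X (IsDigit Af P y) fun m i q =>
      ind d (Fin.cons X (Fin.cons m (Fin.cons i y)) : Fin (k + 3) → M) q := by
  -- the value at a leaf; the variables are `X`, `m`, `i`, `y`, and the leaf
  have hl : UDef fun M _ (v : Fin (k + 4) → M) => ¬ Mod.bit (2 • 1) (v (Fin.last _)) = 1 ∧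
      ∃ j, j ≤ Mod.len (v 0) ∧ (j < v 1 ∧
        (∀ h, h ≤ Mod.len (Mod.len (v 0)) → h < Mod.len (Mod.len (v 0)) →
          Mod.bit h j = Mod.bit (12 • h + 3 • 1) (v (Fin.last _))) ∧
        ∃ c, Mod.len c ≤ lin 40 (v 0) ∧ (cnt (v 0) (v (Fin.last _)) (Mod.len (Mod.len (v 0))) c ∧
          c ≤ v 2 ∧ IsDigit Af P (fun i : Fin k => v i.succ.succ.succ.castSucc) j (v 2 - c))) := by
    refine UDef.and (UDef.not (UDef.eq (UTDef.bit (UTDef.one.nsmul 2) (UTDef.var _)) UTDef.one))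
      (UDef.ex (UTDef.var 0) (UDef.and (UDef.lt (UTDef.var _) (UTDef.var _)) (UDef.and
      (UDef.all (f := fun M _ v => Mod.len (v (0 : Fin (k + 4)).succ)) (UTDef.len (UTDef.var _))
        (UDef.imp (UDef.lt (UTDef.var _) ((UTDef.var _).len.len)) (UDef.eq
        ((UTDef.var _).bit (UTDef.var _))
        ((((UTDef.var _).nsmul 12).add (UTDef.one.nsmul 3)).bit (UTDef.var _)))))
      (UDef.exLin (f := fun M _ v => v (0 : Fin (k + 4)).succ) 40 (UTDef.var _) (UDef.and
        (UDef.cnt (UTDef.var _) (UTDef.var _) ((UTDef.var _).len.len) (UTDef.var _)) (UDef.and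
        (UDef.le (UTDef.var _) (UTDef.var _)) (UDef.isDigit hAf P (fun i => UTDef.var _)
          (UTDef.var _) ((UTDef.var _).sub (UTDef.var _)))))))))
  obtain ⟨φ, hφ, hφv⟩ := hl
  let T : LBase.Term (Fin (k + 3)) := times 12 (len (len (Term.var 0))) + times 4 1
  have hTv : ∀ (M : Type) [AIDModel M] (x : Fin (k + 3) → M),
      T.realize x = 12 • Mod.len (Mod.len (x 0)) + 4 • 1 := fun M _ x => by
    simp [T, realize_times']
  have hT : ∀ (M : Type) [AIDModel M] (x : Fin (k + 3) → M), T.realize x ≤ 16 • weight x := by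
    intro M _ x
    rw [hTv, show 16 = 12 + 4 from rfl, add_nsmul]
    exact add_le_add (nsmul_le_nsmul_right (len_len_le_weight x 0) 12)
      (nsmul_le_nsmul_right (one_le_weight x) 4)
  obtain ⟨d, hd⟩ := exists_tree T hT (blockD (k + 3)) (blockD_sigma0 (k + 3)) blockFun hφ
  refine ⟨d, fun M _ X y => ⟨?_, ?_, ?_⟩⟩
  · refine SDef.ind d (f := Fin.cons (fun _ => X) (Fin.cons (fun v => v 0) (Fin.cons (fun v => v 1)
      fun i _ => y i))) (Fin.cases (TDef.const X) (Fin.cases (TDef.var 0) (Fin.cases (TDef.var 1)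
      fun _ => TDef.const _))) (TDef.var 2) |>.congr fun v => iff_of_eq (congrArg₂ _ ?_ rfl)
    funext i
    refine Fin.cases rfl (Fin.cases rfl (Fin.cases rfl fun i => rfl)) i
  · intro m i q κ W hκ hq hW
    refine block_gate (n := k + 3) (A := ind d _) (T := 12 • Mod.len (Mod.len X) + 4 • 1)
      (x := Fin.cons X (Fin.cons m (Fin.cons i y)))
      (fun q hq hlt => (hd M _ q hq).1 (by rw [hTv]; exact hlt)) hq ?_ hW
    exact add_le_add (nsmul_le_nsmul_right ((lt_iff _ _).1 hκ) 12) le_rfl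
  · intro m i q hq
    have hq0 := SumTree.level_ne_zero hq
    rw [(hd M _ q hq0).2 (by rw [hTv]; exact hq), hφv]
    simp only [Fin.snoc_last]
    have e : (fun t : Fin k => (Fin.snoc (Fin.cons X (Fin.cons m (Fin.cons i y)) : Fin (k + 3) → M)
        q : Fin (k + 4) → M) t.succ.succ.succ.castSucc) = y := by
      funext t
      rw [Fin.snoc_castSucc]
      rfl
    rw [e]
    refine and_congr_right fun _ => exists_congr fun j => and_congr_right fun _ =>
      and_congr_right fun _ => and_congr_right fun _ => ⟨fun ⟨c, _, h⟩ => ⟨c, h⟩, fun ⟨c, h⟩ =>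
        ⟨c, ?_, h⟩⟩
    exact (((len_le_iff _ _).2 (cnt_lt h.1))).trans (len_cntWidth_le X)

end Digit

end BoundedArith

namespace BoundedArith

open BoundedArith.Mod

/-- The set `{i < |w| : A(i, x, y)}`. -/
def digitSet {k : ℕ} {A : LAID.Formula (Fin (k + 2))} (hA : IsSigma0 A) {M : Type} [AIDModel M]
    (w : M) (y : Fin k → M) (x : M) : DSet w where
  mem i := i < Mod.len w ∧ A.Realize (Fin.cons i (Fin.cons x y) : Fin (k + 2) → M)
  sdef := SDef.and (by fun_prop) ((SDef.realize hA (f := Fin.cons (fun v => v 0) (Fin.cons (fun _ => x)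
    fun i _ => y i)) (Fin.cases (TDef.var 0) (Fin.cases (TDef.const x) fun _ => TDef.const _))).congr
      fun v => iff_of_eq (congrArg _ (by
        funext i
        refine Fin.cases rfl (Fin.cases rfl fun i => rfl) i)))
  lt _ h := h.1

/-- A formula for the digits of the sum. In all models, its sets of digits satisfy the recursion
equations modulo each power of two `2 ^ |w|`. -/
theorem exists_sum {k : ℕ} {Af : LAID.Formula (Fin (k + 2))} (hAf : IsSigma0 Af)
    (P : LenPoly (k + 1)) :
    ∃ (Ag : LAID.Formula (Fin (k + 2))) (hAg : IsSigma0 Ag), ∀ (M : Type) [AIDModel M]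
      (y : Fin k → M),
      (∀ i x : M, Ag.Realize (Fin.cons i (Fin.cons x y) : Fin (k + 2) → M) →
        i < polyVal ([0] :: P) (Fin.cons x y : Fin (k + 1) → M)) ∧
      (∀ w : M, digitSet hAg w y 0 = 0) ∧
      ∀ w x : M, x ≠ 0 → digitSet hAg w y x =
        digitSet hAg w y (Mod.half x) + digits (SDef.isDigit hAf P y) w (Mod.len x - 1) := by
  obtain ⟨d, hd⟩ := exists_sumTree hAf P
  obtain ⟨t, ht, htb⟩ := exists_len_bound ([0] :: P)
  have hU : ∀ (c : ℕ) {n : ℕ} {x e : ∀ (M : Type) [AIDModel M], (Fin n → M) → M}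
      {y : Fin k → ∀ (M : Type) [AIDModel M], (Fin n → M) → M}, UTDef x → UTDef e →
      (∀ i, UTDef (y i)) → UDef fun M _ v => ind d (Fin.cons (x M v) (Fin.cons (Mod.len (x M v))
        (Fin.cons (e M v) fun i => y i M v)) : Fin (k + 3) → M) (c • 1) := by
    intro c n x e y hx he hy
    refine (UDef.ind (n := n) d (f := Fin.cons x (Fin.cons (fun M _ v => Mod.len (x M v))
      (Fin.cons e y))) (g := fun _ _ _ => c • 1) (Fin.cases hx (Fin.cases hx.len (Fin.cases he hy)))
      (UTDef.one.nsmul c)).congr fun M _ v => iff_of_eq (congrArg₂ _ ?_ rfl)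
    funext i
    refine Fin.cases rfl (Fin.cases rfl (Fin.cases rfl fun i => rfl)) i
  have ht' : UTDef fun M _ (v : Fin (k + 2) → M) => t M fun i => v i.succ := ht.up
  have hP : UTDef fun M _ (v : Fin (k + 1) → M) => polyVal ([0] :: P) v :=
    ⟨LenPoly.term ([0] :: P) Term.var, fun M _ v => by rw [realize_polyTerm]; rfl⟩
  obtain ⟨Ag, hAg, hv⟩ := UDef.and (UDef.lt (UTDef.var (0 : Fin (k + 2))) hP.up)
    (UDef.dsum (n := k + 2) (U := fun M _ v e => ind d (Fin.cons (v 1) (Fin.cons (Mod.len (v 1)) (Fin.cons e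
        fun i => v i.succ.succ)) : Fin (k + 3) → M) (8 • 1))
      (V := fun M _ v => dshift (t M fun i => v i.succ) fun e =>
        ind d (Fin.cons (v 1) (Fin.cons (Mod.len (v 1)) (Fin.cons e
        fun i => v i.succ.succ)) : Fin (k + 3) → M) (12 • 1)) ht' (UTDef.var 0)
      (hU 8 (UTDef.var _) (UTDef.var _) fun _ => UTDef.var _)
      (UDef.dshift (n := k + 3) (w := fun M _ v => t M fun i => v i.succ.succ) (f := fun _ _ v => v 0)
        (U := fun M _ v e => ind d (Fin.cons (v 2) (Fin.cons (Mod.len (v 2)) (Fin.cons e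
        fun i => v i.succ.succ.succ)) : Fin (k + 3) → M) (12 • 1)) ht'.up (UTDef.var 0)
        (hU 12 (x := fun _ _ v => v 3) (UTDef.var _) (UTDef.var _) fun _ => UTDef.var _)))
  refine ⟨Ag, hAg, fun M _ y => ⟨fun i x h => ((hv M _).1 h).1, ?_⟩⟩
  have key : ∀ w x : M, digitSet hAg w y x = (hd M x y).total w (Mod.len x) 0 1 := by
    intro w x
    refine DSet.ext_iff_lt fun i hi => ?_
    show i < _ ∧ _ ↔ _
    have hlt : ∀ j, ((hd M x y).total w (Mod.len x) 0 1).mem j →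
        j < polyVal ([0] :: P) (Fin.cons x y : Fin (k + 1) → M) := by
      intro j hj
      rw [polyVal_cons, add_comm]
      refine (hd M x y).total_lt (SDef.isDigit hAf P y) (fun m e hm he => he.1.trans_le
        (polyVal_mono P (Fin.cases ?_ fun _ => le_rfl))) le_rfl hj
      exact len_mono (hm.le.trans (len_le_self x))
    rw [hv]
    constructor
    · rintro ⟨_, h, h'⟩
      rw [SumTree.total_mem]
      refine (dsum_congr ((h.trans_le (htb M _))) hi (fun _ _ => Iff.rfl) fun j hj => ?_).1 h'
      exact and_congr_left fun _ => iff_of_true (hj.trans_lt (h.trans_le (htb M _))) (hj.trans_lt hi)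
    · intro h
      have hQ := hlt i h
      refine ⟨hi, hQ, ?_⟩
      rw [SumTree.total_mem] at h
      refine (dsum_congr ((hQ.trans_le (htb M _))) hi (fun _ _ => Iff.rfl) fun j hj => ?_).2 h
      exact and_congr_left fun _ => iff_of_true (hj.trans_lt (hQ.trans_le (htb M _))) (hj.trans_lt hi)
  refine ⟨fun w => ?_, fun w x hx => ?_⟩
  · rw [key, len_zero, SumTree.total_zero _ _ zero_le]
  · have e := len_half hx
    have hlt : Mod.len (Mod.half x) < Mod.len x := by rw [e]; exact Order.lt_add_one_iff.2 le_rfl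
    rw [key, key, e, add_tsub_cancel_right, SumTree.total_succ _ (SDef.isDigit hAf P y) hlt,
      SumTree.total_unique (hd M x y) (hd M (Mod.half x) y) (SDef.isDigit hAf P y) hlt.le le_rfl]

end BoundedArith

namespace BoundedArith

open BoundedArith.Mod

/-! ### The recursion equations -/

section

variable {M : Type} [AIDModel M] {β : Type} {n : ℕ}

theorem realize_cons {γ : Type} (t : LAID.Term γ) (a : Fin n → LAID.Term γ) (v : γ → M) :
    (fun i => ((Fin.cons t a : Fin (n + 1) → LAID.Term γ) i).realize v) =
      (Fin.cons (t.realize v) fun i => (a i).realize v : Fin (n + 1) → M) := by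
  funext i
  refine Fin.cases rfl (fun i => rfl) i

theorem realize_bitSet (A : LAID.Formula (Fin (n + 1))) (P : LenPoly n) (a : Fin n → LAID.Term β)
    (v : Option β → M) : (bitSet A P a).Realize v ↔
      v none < polyVal P (fun i => (a i).realize fun b => v (some b)) ∧
        A.Realize (Fin.cons (v none) fun i => (a i).realize fun b => v (some b) :
          Fin (n + 1) → M) := by
  simp only [bitSet, realize_and, realize_lt', Term.realize_var, realize_up, realize_polyTerm, not_le,
    realize_formula_subst, realize_cons]

theorem realize_isBitSet (t : LAID.Term β) (A : LAID.Formula (Fin (n + 1))) (P : LenPoly n)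
    (a : Fin n → LAID.Term β) (v : β → M) : (isBitSet t A P a).Realize v ↔
      Mod.len (t.realize v) ≤ polyVal P (fun i => (a i).realize v) ∧
        ∀ i, i < polyVal P (fun i => (a i).realize v) → (Mod.bit i (t.realize v) = 1 ↔
          A.Realize (Fin.cons i fun i => (a i).realize v : Fin (n + 1) → M)) := by
  simp only [isBitSet, realize_and, realize_le, realize_allV, realize_imp', realize_lt', realize_iff',
    realize_eqq, realize_bit, realize_len, realize_one, Term.realize_var, realize_up, realize_polyTerm,
    not_le, realize_formula_subst, realize_cons, Option.elim]

theorem realize_sumBit (U V : LAID.Formula (Option β)) (v : Option β → M) :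
    (sumBit U V).Realize v ↔ Xor (Xor (U.Realize v) (V.Realize v))
      (∃ j, (j < v none ∧ U.Realize (fun o => o.elim j fun b => v (some b)) ∧
          V.Realize (fun o => o.elim j fun b => v (some b))) ∧
        ∀ k, j < k ∧ k < v none → Xor (U.Realize fun o => o.elim k fun b => v (some b))
          (V.Realize fun o => o.elim k fun b => v (some b))) := by
  have h1 : ∀ (j : M), (fun o : Option (Option β) => o.elim j v) ∘ Option.map some =
      fun o => o.elim j fun b => v (some b) := by
    intro j; funext o; cases o <;> rfl
  have h2 : ∀ (j k : M), ((fun o : Option (Option (Option β)) => o.elim k fun o => o.elim j v) ∘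
      Option.map fun b => some (some b)) = fun o => o.elim k fun b => v (some b) := by
    intro j k; funext o; cases o <;> rfl
  simp only [sumBit, realize_xor, realize_exV, realize_and, realize_lt', realize_allV, realize_imp',
    Term.realize_var, Formula.realize_relabel, realize_up, not_le, h1, h2, Option.elim_none, Option.elim_some]

/-- Digitwise addition of bounded sets is addition modulo a large power of two. -/
theorem dsum_of_bounded {w b i : M} {U V : M → Prop} (hU : ∀ j, U j → j < b) (hV : ∀ j, V j → j < b)
    (hb : b < Mod.len w) : Xor (Xor (U i) (V i))
      (∃ j, (j < i ∧ U j ∧ V j) ∧ ∀ k, j < k ∧ k < i → Xor (U k) (V k)) ↔ dsum w U V i := by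
  by_cases hi : i < Mod.len w
  · simp only [dsum, hi, true_and]
    refine iff_of_eq (congrArg _ (propext ?_))
    refine exists_congr fun j => ⟨?_, ?_⟩
    · rintro ⟨⟨h1, h2⟩, h3⟩
      exact ⟨(h1.trans hi).le, h1, h2, fun k _ hk hk' => h3 k ⟨hk, hk'⟩⟩
    · rintro ⟨_, h1, h2, h3⟩
      exact ⟨⟨h1, h2⟩, fun k hk => h3 k (hk.2.trans hi).le hk.1 hk.2⟩
  · have hbi := hb.trans_le (not_lt.1 hi)
    have e1 : ¬ U i := fun h => lt_asymm hbi (hU i h)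
    have e2 : ¬ V i := fun h => lt_asymm hbi (hV i h)
    have e3 : ¬ ∃ j, (j < i ∧ U j ∧ V j) ∧ ∀ k, j < k ∧ k < i → Xor (U k) (V k) := by
      rintro ⟨j, ⟨_, h, _⟩, h'⟩
      have e1 : ¬ U b := fun h => lt_irrefl _ (hU b h)
      have e2 : ¬ V b := fun h => lt_irrefl _ (hV b h)
      have := h' b ⟨hU j h, hbi⟩
      simp [Xor, e1, e2] at this
    refine iff_of_false (fun h => ?_) fun h => hi h.1
    rcases h with h | h
    · rcases h.1 with h | h
      exacts [e1 h.1, e2 h.1]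
    · exact e3 h.1

/-- A number represented by a set of digits. -/
theorem dig_eq_digitSet {k : ℕ} {A : LAID.Formula (Fin (k + 2))} (hA : IsSigma0 A) {w u b x : M}
    {y : Fin k → M} (hu : Mod.len u ≤ b)
    (h : ∀ i, i < b → (Mod.bit i u = 1 ↔ A.Realize (Fin.cons i (Fin.cons x y) : Fin (k + 2) → M)))
    (hb : ∀ i, A.Realize (Fin.cons i (Fin.cons x y) : Fin (k + 2) → M) → i < b) :
    DSet.dig w u = digitSet hA w y x := by
  refine DSet.ext_iff_lt fun i hi => and_congr_right fun _ => ?_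
  by_cases hib : i < b
  · exact h i hib
  · refine iff_of_false (fun h' => ?_) fun h' => hib (hb i h')
    rw [bit_of_len_le (hu.trans (not_lt.1 hib))] at h'
    exact one_ne_zero' h'.symm

/-- A number represented by the set of the digits of a value of a bitdefinable function. -/
theorem dig_eq_digits {k : ℕ} {A : LAID.Formula (Fin (k + 2))} (hA : IsSigma0 A) {P : LenPoly (k + 1)}
    {w u m : M} {y : Fin k → M} (hu : Mod.len u ≤ polyVal P (Fin.cons m y : Fin (k + 1) → M))
    (h : ∀ i, i < polyVal P (Fin.cons m y : Fin (k + 1) → M) → (Mod.bit i u = 1 ↔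
      A.Realize (Fin.cons i (Fin.cons m y) : Fin (k + 2) → M))) :
    DSet.dig w u = digits (SDef.isDigit hA P y) w m := by
  refine DSet.ext_iff_lt fun i hi => and_congr_right fun _ => ?_
  by_cases hib : i < polyVal P (Fin.cons m y : Fin (k + 1) → M)
  · exact (h i hib).trans ⟨fun h => ⟨hib, h⟩, fun h => h.2⟩
  · refine iff_of_false (fun h' => ?_) fun h' => hib h'.1
    rw [bit_of_len_le (hu.trans (not_lt.1 hib))] at h'
    exact one_ne_zero' h'.symm

theorem small_polyVal (P : LenPoly n) (a : Fin n → M) : Small (polyVal P a) := by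
  obtain ⟨t, _, ht⟩ := exists_len_bound P
  exact ⟨t M a, ht M a⟩

end

instance (M : AID.ModelType) : AIDModel (M : Type) := ⟨M.is_model⟩

section Proofs

variable {k : ℕ} {Af Ag : LAID.Formula (Fin (k + 2))} (hAf : IsSigma0 Af) (hAg : IsSigma0 Ag)
  {P : LenPoly (k + 1)} (H : ∀ (M : Type) [AIDModel M] (y : Fin k → M),
      (∀ i x : M, Ag.Realize (Fin.cons i (Fin.cons x y) : Fin (k + 2) → M) →
        i < polyVal ([0] :: P) (Fin.cons x y : Fin (k + 1) → M)) ∧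
      (∀ w : M, digitSet hAg w y 0 = 0) ∧
      ∀ w x : M, x ≠ 0 → digitSet hAg w y x =
        digitSet hAg w y (Mod.half x) + digits (SDef.isDigit hAf P y) w (Mod.len x - 1))

include H

theorem not_realize_zero {M : Type} [AIDModel M] (y : Fin k → M) (i : M) :
    ¬ Ag.Realize (Fin.cons i (Fin.cons 0 y) : Fin (k + 2) → M) := by
  intro h
  obtain ⟨w, hw⟩ := small_polyVal ([0] :: P) (Fin.cons (0 : M) y : Fin (k + 1) → M)
  have : (digitSet hAg w y 0).mem i := ⟨((H M y).1 i 0 h).trans_le hw, h⟩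
  rw [(H M y).2.1] at this
  exact this

theorem realize_sumZero {M : Type} [AIDModel M] (v : Option (Fin k) → M) :
    (sumZero Ag ([0] :: P)).Realize v := by
  unfold sumZero
  rw [Formula.realize_not, realize_bitSet, realize_cons, realize_zero]
  exact fun h => not_realize_zero hAf hAg H _ _ h.2

theorem realize_sumZeroNum {M : Type} [AIDModel M] (v : Option (Fin k) → M) :
    (sumZeroNum Ag ([0] :: P)).Realize v := by
  unfold sumZeroNum
  rw [realize_imp', realize_isBitSet, realize_eqq, realize_cons, realize_zero]
  rintro ⟨h1, h2⟩
  refine eq_of_bit fun i _ => ?_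
  rw [bit_zero_right]
  refine iff_of_false (fun h => ?_) one_ne_zero'.symm
  by_cases hi : i < polyVal ([0] :: P)
      (Fin.cons 0 fun i => (Term.var (some i) : LAID.Term _).realize v : Fin (k + 1) → M)
  · exact not_realize_zero hAf hAg H _ _ ((h2 i hi).1 h)
  · rw [bit_of_len_le (h1.trans (not_lt.1 hi))] at h
    exact one_ne_zero' h.symm

omit H in
/-- The sets of digits in the recursion for the sum have a common bound. -/
theorem polyVal_bounds {M : Type} [AIDModel M] (y : Fin k → M) (x : M) :
    polyVal ([0] :: P) (Fin.cons (Mod.half x) y : Fin (k + 1) → M) ≤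
        polyVal ([0] :: P) (Fin.cons x y : Fin (k + 1) → M) ∧
      polyVal P (Fin.cons (Mod.len x - 1) y : Fin (k + 1) → M) ≤
        polyVal ([0] :: P) (Fin.cons x y : Fin (k + 1) → M) := by
  constructor
  · exact polyVal_mono _ (Fin.cases (len_mono (half_le x)) fun _ => le_rfl)
  · rw [polyVal_cons]
    exact (polyVal_mono _ (Fin.cases (len_mono (tsub_le_self.trans (len_le_self x)))
      fun _ => le_rfl)).trans le_add_self

theorem realize_sumStep {M : Type} [AIDModel M] (v : Option (Fin (k + 1)) → M) :
    (sumStep Af Ag P ([0] :: P)).Realize v := by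
  unfold sumStep
  simp only [realize_imp', realize_ne, realize_up, Term.realize_var, realize_zero, realize_iff',
    realize_sumBit, realize_bitSet, realize_cons, realize_half, realize_sub, realize_len, realize_one,
    Option.elim_none, Option.elim_some]
  intro hx
  set x := v (some 0)
  set y : Fin k → M := fun i => v (some i.succ)
  set i := v none
  obtain ⟨b1, b2⟩ := polyVal_bounds (P := P) y x
  obtain ⟨w, hw⟩ := (small_polyVal ([0] :: P) (Fin.cons x y : Fin (k + 1) → M)).add small_one
  have hw := (lt_iff _ _).2 hw
  have h0 : ∀ {x i : M}, polyVal ([0] :: P) (Fin.cons x y : Fin (k + 1) → M) < Mod.len w →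
      (i < polyVal ([0] :: P) (Fin.cons x y : Fin (k + 1) → M) ∧
        Ag.Realize (Fin.cons i (Fin.cons x y) : Fin (k + 2) → M) ↔ (digitSet hAg w y x).mem i) :=
    fun hx => ⟨fun h => ⟨h.1.trans hx, h.2⟩, fun h => ⟨(H M y).1 _ _ h.2, h.2⟩⟩
  rw [h0 hw, (H M y).2.2 w x hx]
  have hU : (fun j => j < polyVal ([0] :: P) (Fin.cons (Mod.half x) y : Fin (k + 1) → M) ∧
      Ag.Realize (Fin.cons j (Fin.cons (Mod.half x) y) : Fin (k + 2) → M)) =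
      (digitSet hAg w y (Mod.half x)).mem := funext fun j => propext (h0 (b1.trans_lt hw))
  have hV : (fun j => j < polyVal P (Fin.cons (Mod.len x - 1) y : Fin (k + 1) → M) ∧
      Af.Realize (Fin.cons j (Fin.cons (Mod.len x - 1) y) : Fin (k + 2) → M)) =
      (digits (SDef.isDigit hAf P y) w (Mod.len x - 1)).mem :=
    funext fun j => propext ⟨fun h => ⟨h.1.trans (b2.trans_lt hw), h⟩, fun h => h.2⟩
  rw [DSet.add_mem, ← hU, ← hV]
  exact (dsum_of_bounded (fun j h => h.1.trans_le b1) (fun j h => h.1.trans_le b2) hw).symm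

theorem realize_sumStepNum {M : Type} [AIDModel M] (v : Fin (k + 1) ⊕ Fin 3 → M) :
    (sumStepNum Af Ag P ([0] :: P)).Realize v := by
  unfold sumStepNum
  simp only [realize_imp', realize_and, realize_ne, Term.realize_var, realize_zero, realize_isBitSet,
    realize_cons, realize_half, realize_sub, realize_len, realize_one, realize_eqq, realize_add]
  set x := v (Sum.inl 0)
  set y : Fin k → M := fun i => v (Sum.inl i.succ)
  rintro ⟨⟨⟨hx, hw1, hw2⟩, hu1, hu2⟩, hv1, hv2⟩
  obtain ⟨b1, b2⟩ := polyVal_bounds (P := P) y x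
  have hB := small_polyVal ([0] :: P) (Fin.cons x y : Fin (k + 1) → M)
  obtain ⟨z, hz⟩ := hB.add hB
  refine DSet.eq_of_dig (w := z) (hw1.trans (le_self_add.trans hz))
    ((len_add_le _ _).trans ((add_le_add (hu1.trans b1) (hv1.trans b2)).trans hz)) ?_
  rw [DSet.dig_add, dig_eq_digitSet hAg hw1 hw2 fun i h => (H M y).1 _ _ h,
    dig_eq_digitSet hAg hu1 hu2 fun i h => (H M y).1 _ _ h, dig_eq_digits hAf hv1 hv2,
    (H M y).2.2 z x hx]

end Proofs

end BoundedArith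

namespace BoundedArith

open BoundedArith.Mod (polyVal)

/-! ### The standard model -/

namespace Std

variable {α : Type} (v : α → ℕ) (s t u : LAID.Term α)

theorem realize_zero : (0 : LAID.Term α).realize v = 0 := rfl
theorem realize_one : (1 : LAID.Term α).realize v = 1 := rfl
theorem realize_add : (s + t).realize v = s.realize v + t.realize v := rfl
theorem realize_sub : (s - t).realize v = s.realize v - t.realize v := rfl
theorem realize_half : (half t).realize v = t.realize v / 2 := rfl
theorem realize_len : (len t).realize v = (t.realize v).size := rfl
theorem realize_smash : (smash s t).realize v = 2 ^ ((s.realize v).size * (t.realize v).size) := rfl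
theorem realize_pad : (pad s t).realize v = s.realize v * 2 ^ (t.realize v).size := rfl
theorem realize_part : (part s t u).realize v =
  s.realize v / 2 ^ t.realize v % 2 ^ (u.realize v - t.realize v) := rfl
theorem realize_le : (le s t).Realize v ↔ s.realize v ≤ t.realize v := by
  unfold le
  rw [Formula.realize_rel]
  rfl
theorem realize_lt : (lt s t).Realize v ↔ s.realize v < t.realize v := by
  unfold lt
  rw [Formula.realize_not, realize_le, not_le]

theorem size_double {x : ℕ} (h : x ≠ 0) : (x + x).size = x.size + 1 := by
  have := Nat.size_bit (b := false) (n := x) (by simpa using h)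
  rwa [Nat.bit_false_apply, two_mul] at this

theorem size_double_add_one (x : ℕ) : (x + x + 1).size = x.size + 1 := by
  have := Nat.size_bit (b := true) (n := x) (by simp)
  rwa [Nat.bit_true_apply, two_mul] at this

theorem size_half {x : ℕ} (h : x ≠ 0) : x.size = (x / 2).size + 1 := by
  rcases Nat.even_or_odd' x with ⟨y, rfl | rfl⟩
  · rw [show 2 * y / 2 = y by omega, two_mul, size_double (by omega)]
  · rw [show (2 * y + 1) / 2 = y by omega, two_mul, size_double_add_one]

theorem size_half_pow (n : ℕ) : (2 ^ n / 2).size = n := by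
  cases n with
  | zero => rfl
  | succ n => rw [Nat.pow_succ, Nat.mul_div_cancel _ (by norm_num), Nat.size_pow]

theorem buss (φ : LAID.Formula (Fin 4)) (hφ : φ ∈ bussAxioms IndPred) (v : Fin 4 → ℕ) :
    φ.Realize v := by
  revert φ
  simp only [bussAxioms, List.forall_mem_cons, List.not_mem_nil, false_imp_iff, implies_true,
    realize_imp', realize_and, realize_or, realize_iff', realize_eqq, realize_ne, realize_le,
    realize_add, realize_zero, realize_one, realize_len, realize_smash, realize_half]
  generalize (vx IndPred).realize v = x
  generalize (vy IndPred).realize v = y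
  generalize (vz IndPred).realize v = z
  refine ⟨by omega, by omega, by omega, by omega, by omega, by omega, by omega, by omega,
    Nat.size_zero, fun h => ⟨size_double h, size_double_add_one x⟩, Nat.size_one, Nat.size_le_size,
    by simp, fun h => ?_, by rw [mul_comm], fun h => by rw [h], by omega, by omega, by omega,
    by omega, by omega, by omega, by omega, size_half, by omega, trivial⟩
  rw [size_double h, size_double_add_one, Nat.size_one, one_mul, one_mul, pow_succ]
  omega

theorem new (φ : LAID.Formula (Fin 4)) (hφ : φ ∈ newAxioms IndPred) (v : Fin 4 → ℕ) :
    φ.Realize v := by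
  revert φ
  simp only [newAxioms, List.forall_mem_cons, List.not_mem_nil, false_imp_iff, implies_true,
    realize_imp', realize_and, realize_eqq, realize_ne, realize_le,
    realize_lt, realize_sub, realize_part, realize_pad,
    realize_add, realize_zero, realize_one, realize_half]
  generalize (vx IndPred).realize v = x
  generalize (vy IndPred).realize v = y
  generalize (vz IndPred).realize v = i
  generalize (vw IndPred).realize v = j
  refine ⟨fun h => ?_, fun h => ?_, ⟨?_, ?_⟩, by simp, fun h => ?_, by omega, by omega, trivial⟩
  · rw [Nat.sub_eq_zero_of_le h, pow_zero, Nat.mod_one]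
  · rw [Nat.add_sub_add_right, pow_succ', Nat.div_div_eq_div_mul]
  · simp only [pow_zero, Nat.div_one, Nat.sub_zero]
    rw [← two_mul, ← two_mul, pow_succ', Nat.mul_mod_mul_left]
  · simp only [pow_zero, Nat.div_one, Nat.sub_zero]
    have h1 := Nat.mod_lt x (Nat.two_pow_pos j)
    have h2 := Nat.div_add_mod x (2 ^ j)
    have e : x + x + 1 = (x % 2 ^ j + x % 2 ^ j + 1) + 2 ^ (j + 1) * (x / 2 ^ j) := by
      rw [pow_succ]
      nlinarith
    rw [e, Nat.add_mul_mod_self_left, Nat.mod_eq_of_lt]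
    · rw [pow_succ]; omega
  · rw [size_half h, pow_succ]
    ring

theorem further (φ : LAID.Formula (Fin 4)) (hφ : φ ∈ furtherAxioms IndPred) (v : Fin 4 → ℕ) :
    φ.Realize v := by
  revert φ
  simp only [furtherAxioms, List.forall_mem_cons, List.not_mem_nil, false_imp_iff, implies_true,
    realize_imp', realize_eqq, realize_le, msp, realize_sub, realize_part, realize_pad,
    realize_add, realize_zero, realize_one, realize_len, realize_smash, realize_half]
  generalize (vx IndPred).realize v = x
  generalize (vy IndPred).realize v = y
  generalize (vz IndPred).realize v = i
  generalize (vw IndPred).realize v = j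
  have hm : ∀ i, x / 2 ^ i % 2 ^ (x.size - i) = x / 2 ^ i := by
    intro i
    refine Nat.mod_eq_of_lt ?_
    have := Nat.lt_size_self x
    rw [Nat.div_lt_iff_lt_mul (Nat.two_pow_pos i), ← pow_add]
    exact this.trans_le (Nat.pow_le_pow_right (by norm_num) (by omega))
  refine ⟨?_, fun h => ?_, by simp [Nat.size_one], ?_, ?_, fun h => ?_, by omega, trivial⟩
  · rw [Nat.size_pow]; omega
  · rw [size_half_pow, h, add_mul, pow_add]
  · rw [hm]; simp
  · rw [hm, hm, pow_succ, Nat.div_div_eq_div_mul]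
  · have : x / 2 ^ i = 0 := Nat.div_eq_of_lt ((Nat.lt_size_self x).trans_le
      (Nat.pow_le_pow_right (by norm_num) h))
    rw [this, Nat.zero_mod]

theorem realize_bit : (bit s t).realize v = ((t.realize v).testBit (s.realize v)).toNat := by
  rw [bit, realize_part, realize_add, realize_one, Nat.add_sub_cancel_left, pow_one,
    ← Nat.shiftRight_eq_div_pow, Nat.toNat_testBit, Nat.shiftRight_eq_div_pow]

theorem bitExt_realize (v : Fin 2 → ℕ) : (bitExt IndPred).Realize v := by
  simp only [bitExt, realize_imp', realize_and, realize_eqq, realize_allV, realize_lt, realize_bit,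
    realize_up, realize_len, Term.realize_var, Option.elim]
  rintro ⟨h, h'⟩
  refine Nat.eq_of_testBit_eq fun i => ?_
  by_cases hi : i < (v 0).size
  · have := h' i hi
    revert this
    cases (v 0).testBit i <;> cases (v 1).testBit i <;> simp
  · have hb : ∀ x : ℕ, x.size ≤ i → x.testBit i = false := fun x hx =>
      Nat.testBit_lt_two_pow ((Nat.lt_size_self x).trans_le (Nat.pow_le_pow_right (by norm_num) hx))
    rw [hb _ (not_lt.1 hi), hb _ (h ▸ not_lt.1 hi)]

theorem lind_realize {n : ℕ} (A : LAID.Formula (Fin (n + 1))) (v : Fin (n + 1) → ℕ) :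
    (lind A).Realize v := by
  have e : ∀ (γ : Type) (t : LAID.Term γ) (f : Fin n → LAID.Term γ) (v : γ → ℕ),
      (fun a => ((Fin.cons t f : Fin (n + 1) → LAID.Term γ) a).realize v) =
        (Fin.cons (t.realize v) fun i => (f i).realize v : Fin (n + 1) → ℕ) := by
    intro γ t f v
    funext a
    refine Fin.cases ?_ (fun i => ?_) a <;> simp
  simp only [lind, realize_imp', realize_and, realize_formula_subst, realize_allV, e, realize_lt,
    realize_up, realize_len, realize_zero, realize_add, realize_one, Term.realize_var, Option.elim]
  rintro ⟨h0, hs⟩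
  have key : ∀ m, m ≤ (v 0).size → A.Realize (Fin.cons m fun i : Fin n => v i.succ) := by
    intro m
    induction m with
    | zero => exact fun _ => h0
    | succ m ih => exact fun hm => hs m hm (ih (Nat.le_of_succ_le hm))
  exact key _ le_rfl

section Ind

variable {n : ℕ} (d : IndDef n)

theorem realize_times (c : ℕ) : (times c t).realize v = c * t.realize v := by
  induction c with
  | zero => rw [zero_mul]; rfl
  | succ c ih => rw [add_mul, one_mul, ← ih]; rfl

theorem realize_ellTerm (v : Fin (n + 1) → ℕ) : (ellTerm d).realize v = d.ell (Fin.init v) := by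
  have : ∀ l : List (Fin n), ((l.map fun i => times (d.coeff i) (len (len (xv i)))).foldr (· + ·)
      (times d.const 1)).realize v =
      (l.map fun i => d.coeff i * (v i.castSucc).size.size).sum + d.const := by
    intro l
    induction l with
    | nil => simp [realize_times, realize_one]
    | cons a l ih =>
      simp only [List.map_cons, List.foldr_cons, realize_add, ih, List.sum_cons, realize_times,
        realize_len, add_assoc]
      rfl
  rw [ellTerm, this, IndDef.ell]
  congr 1

theorem relMap_ind (v : Fin (n + 1) → ℕ) :
    Structure.RelMap (L := LAID) (M := ℕ) (n := n + 1) (Sum.inr (IndPred.mk d)) v ↔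
      d.holds (Fin.init v) (v (Fin.last n)) := Iff.rfl

theorem realize_indAtom (t : LAID.Term (Fin (n + 1))) (x : Fin n → ℕ) (p : ℕ) :
    (indAtom d t).Realize (Fin.snoc x p : Fin (n + 1) → ℕ) ↔
      d.holds x (t.realize (Fin.snoc x p : Fin (n + 1) → ℕ)) := by
  unfold indAtom
  rw [Formula.realize_rel]
  have e : (fun i => Term.realize (Fin.snoc x p : Fin (n + 1) → ℕ)
      ((Fin.snoc xv t : Fin (n + 1) → LAID.Term (Fin (n + 1))) i)) =
      Fin.snoc x (t.realize (Fin.snoc x p : Fin (n + 1) → ℕ)) := by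
    funext i
    refine Fin.lastCases ?_ (fun i => ?_) i
    · simp
    · simp [xv]
  rw [e, relMap_ind, Fin.init_snoc, Fin.snoc_last]

instance : (incl : LBase →ᴸ LAID).IsExpansionOn ℕ where
  map_onFunction _ _ := rfl
  map_onRelation R _ := by rcases R with R | R <;> first | rfl | exact R.elim

theorem ind_realize {φ : LAID.Formula (Fin (n + 1))} (h : φ = axA0 d ∨ φ = axA1 d ∨ φ = axA2 d)
    (v : Fin (n + 1) → ℕ) : φ.Realize v := by
  obtain ⟨x, p, rfl⟩ : ∃ (x : Fin n → ℕ) (p : ℕ), v = Fin.snoc x p :=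
    ⟨Fin.init v, v (Fin.last n), (Fin.snoc_init_self v).symm⟩
  rcases h with rfl | rfl | rfl
  · simp only [axA0, realize_imp', realize_indAtom, realize_and, realize_ne, realize_le, realize_len,
      realize_ellTerm, realize_zero, pv, Term.realize_var, Fin.snoc_last, Fin.init_snoc]
    exact fun h => ⟨h.1, h.2.1⟩
  · simp only [axA1, realize_imp', realize_iff', realize_indAtom, realize_and, realize_ne,
      realize_eqq, realize_len, realize_ellTerm, realize_zero, pv, Term.realize_var, Fin.snoc_last,
      Fin.init_snoc, LHom.realize_onFormula]
    rintro ⟨h0, h⟩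
    unfold IndDef.holds
    rw [h, Nat.sub_self]
    exact ⟨fun h => h.2.2, fun h' => ⟨h ▸ h0, le_rfl, h'⟩⟩
  · simp only [axA2, realize_imp', realize_iff', realize_indAtom, realize_and, realize_ne,
      realize_lt, realize_len, realize_ellTerm, realize_zero, pv, Term.realize_var, Fin.snoc_last,
      Fin.init_snoc, BoolForm.realize_inst]
    rintro ⟨h0, h⟩
    obtain ⟨c, hc⟩ := Nat.exists_eq_add_of_lt h
    have hp : p ≠ 0 := by rintro rfl; exact h0 Nat.size_zero.symm
    have e1 : d.ell x - p.size = c + 1 := by omega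
    have hs : ∀ b : Bool, (if b then 2 * p + 1 else 2 * p).size = p.size + 1 := by
      intro b
      cases b
      · simpa [two_mul] using size_double hp
      · simpa [two_mul] using size_double_add_one p
    have h1 : d.holds x p ↔ d.value x (c + 1) p := by
      unfold IndDef.holds
      rw [e1]
      exact ⟨fun h => h.2.2, fun h' => ⟨h0, h.le, h'⟩⟩
    rw [h1, IndDef.value]
    refine iff_of_eq (congrArg (fun u => d.I.eval u) (funext fun i => ?_))
    rcases i with j | b
    · exact propext (LHom.realize_onFormula _ _).symm
    · refine propext (Iff.trans ?_ (realize_indAtom d _ x p).symm)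
      have e2 : (if b = true then pv + pv + 1 else pv + pv : LAID.Term (Fin (n + 1))).realize
          (Fin.snoc x p : Fin (n + 1) → ℕ) = if b then 2 * p + 1 else 2 * p := by
        cases b <;> simp [realize_add, realize_one, pv, two_mul]
      simp only [pv] at e2
      rw [e2]
      unfold IndDef.holds
      rw [hs b, show d.ell x - (p.size + 1) = c by omega]
      exact ⟨fun h => ⟨by omega, by omega, h⟩, fun h => h.2.2⟩

end Ind

theorem models_AID : ℕ ⊨ AID := by
  refine ⟨?_⟩
  rintro σ ((((⟨φ, hφ, rfl⟩) | ⟨n, A, _, rfl⟩) | rfl) | ⟨n, d, h⟩)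
  · refine (realize_closure φ).2 fun v => ?_
    rcases List.mem_append.1 hφ with hφ | hφ
    · rcases List.mem_append.1 hφ with hφ | hφ
      · exact buss φ hφ v
      · exact new φ hφ v
    · exact further φ hφ v
  · exact (realize_closure _).2 (lind_realize A)
  · exact (realize_closure _).2 bitExt_realize
  · rcases h with rfl | rfl | rfl
    · exact (realize_closure _).2 (ind_realize d (Or.inl rfl))
    · exact (realize_closure _).2 (ind_realize d (Or.inr (Or.inl rfl)))
    · exact (realize_closure _).2 (ind_realize d (Or.inr (Or.inr rfl)))

/-- The natural numbers with the intended functions and predicates. This is a synonym, since the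
operations of a model are instances that would compete with those of `ℕ`. -/
def StdModel : Type := ℕ

instance : AIDModel StdModel where
  toStructure := stdAID
  models := models_AID

theorem lt_iff (x y : StdModel) : x < y ↔ @LT.lt ℕ _ x y := by
  rw [Mod.lt_iff]
  exact Iff.rfl

theorem polyVal_eq {n : ℕ} (P : LenPoly n) (a : Fin n → ℕ) :
    polyVal (M := StdModel) P a = P.eval fun i => (a i).size := by
  have hm : ∀ N : List (Fin n), Nat.size (Mod.monoVal (M := StdModel) N a) =
      (N.map fun i => (a i).size).prod := by
    intro N
    induction N with
    | nil => exact Nat.size_one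
    | cons i N ih =>
      rw [List.map_cons, List.prod_cons, ← ih]
      exact size_half_pow _
  induction P with
  | nil => rfl
  | cons N P ih =>
    exact congrArg₂ (fun a b : ℕ => a + b) (hm N) ih

end Std

end BoundedArith

namespace BoundedArith

open BoundedArith.Mod (polyVal digits)

/-! ### The sum in the standard model -/

namespace Std

section

variable {k : ℕ} {Af Ag : LAID.Formula (Fin (k + 2))} (hAf : IsSigma0 Af) (hAg : IsSigma0 Ag)
  {P : LenPoly (k + 1)} {f : (Fin (k + 1) → ℕ) → ℕ}

theorem bit_eq_one (i x : ℕ) : Mod.bit (M := StdModel) i x = (1 : StdModel) ↔ x.testBit i = true := by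
  have : (Mod.bit (M := StdModel) i x : ℕ) = (x.testBit i).toNat := by
    show x / 2 ^ i % 2 ^ (i + 1 - i) = _
    rw [Nat.add_sub_cancel_left, pow_one, Nat.toNat_testBit]
  refine (iff_of_eq (congrArg (fun u : ℕ => u = 1) this)).trans ?_
  cases x.testBit i <;> simp

theorem lt_of_testBit {i x n : ℕ} (h : x.testBit i = true) (hx : x.size ≤ n) : i < n := by
  by_contra hn
  have := Nat.testBit_lt_two_pow ((Nat.lt_size_self x).trans_le
    (Nat.pow_le_pow_right (by norm_num) (hx.trans (not_lt.1 hn))))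
  rw [h] at this
  exact absurd this (by simp)

/-- In the standard model the set of digits of a summand is the one of the number. -/
theorem digits_eq (hf : BitDefines Af P f) (w : StdModel) (y : Fin k → ℕ) (m : ℕ) :
    digits (M := StdModel) (SDef.isDigit (M := StdModel) hAf P y) w m =
      Mod.DSet.dig (M := StdModel) w (f (Fin.cons m y) : ℕ) := by
  refine Mod.DSet.ext_iff_lt fun i _ => and_congr_right fun _ => ?_
  rw [bit_eq_one i]
  have h1 : @LT.lt StdModel _ i (polyVal (M := StdModel) P (Fin.cons m y : Fin (k + 1) → ℕ)) ↔
      @LT.lt ℕ _ i (P.eval fun i => ((Fin.cons m y : Fin (k + 1) → ℕ) i).size) :=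
    (lt_iff _ _).trans (by rw [polyVal_eq])
  refine (and_congr h1 (hf.bitgraph (Fin.cons m y) i)).trans ⟨fun h => h.2, fun h => ⟨?_, h⟩⟩
  exact lt_of_testBit h (hf.growth _)

theorem vectorSum_half (f : (Fin (k + 1) → ℕ) → ℕ) (y : Fin k → ℕ) {x : ℕ} (hx : x ≠ 0) :
    vectorSum f (Fin.cons x y) =
      vectorSum f (Fin.cons (x / 2) y) + f (Fin.cons (x.size - 1) y) := by
  simp only [vectorSum, Fin.cons_zero, Fin.tail_cons]
  rw [size_half hx, Finset.sum_range_succ, Nat.add_sub_cancel]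

/-- By the recursion equations, the formula defines the digits of the sum in the standard model. -/
theorem digitSet_eq (hf : BitDefines Af P f) (H : ∀ (M : Type) [AIDModel M] (y : Fin k → M),
      (∀ i x : M, Ag.Realize (Fin.cons i (Fin.cons x y) : Fin (k + 2) → M) →
        i < polyVal ([0] :: P) (Fin.cons x y : Fin (k + 1) → M)) ∧
      (∀ w : M, digitSet hAg w y 0 = 0) ∧
      ∀ w x : M, x ≠ 0 → digitSet hAg w y x =
        digitSet hAg w y (Mod.half x) + digits (SDef.isDigit hAf P y) w (Mod.len x - 1))
    (w : StdModel) (y : Fin k → ℕ) (x : ℕ) : digitSet (M := StdModel) hAg w y x =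
      Mod.DSet.dig w (vectorSum f (Fin.cons x y) : StdModel) := by
  induction x using Nat.strong_induction_on with
  | _ x ih =>
    by_cases hx : x = 0
    · subst hx
      have e : vectorSum f (Fin.cons 0 y) = 0 := by simp [vectorSum]
      rw [e]
      exact ((H StdModel y).2.1 w).trans Mod.DSet.dig_zero.symm
    · refine ((H StdModel y).2.2 w x hx).trans ?_
      rw [vectorSum_half f y hx]
      refine (congrArg₂ (fun U V : Mod.DSet w => U + V) (ih (x / 2) (by omega))
        (digits_eq hAf hf w y (x.size - 1))).trans ?_
      exact (Mod.DSet.dig_add (M := StdModel) (vectorSum f (Fin.cons (x / 2) y))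
        (f (Fin.cons (x.size - 1) y))).symm

theorem bitDefines (hf : BitDefines Af P f) (H : ∀ (M : Type) [AIDModel M] (y : Fin k → M),
      (∀ i x : M, Ag.Realize (Fin.cons i (Fin.cons x y) : Fin (k + 2) → M) →
        i < polyVal ([0] :: P) (Fin.cons x y : Fin (k + 1) → M)) ∧
      (∀ w : M, digitSet hAg w y 0 = 0) ∧
      ∀ w x : M, x ≠ 0 → digitSet hAg w y x =
        digitSet hAg w y (Mod.half x) + digits (SDef.isDigit hAf P y) w (Mod.len x - 1)) :
    BitDefines Ag ([0] :: P) (vectorSum f) := by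
  have hbit : ∀ (v : Fin (k + 1) → ℕ) (i : ℕ),
      Ag.Realize (Fin.cons i v : Fin (k + 2) → ℕ) ↔ (vectorSum f v).testBit i = true := by
    intro v i
    obtain ⟨x, y, rfl⟩ : ∃ (x : ℕ) (y : Fin k → ℕ), v = Fin.cons x y :=
      ⟨v 0, Fin.tail v, (Fin.cons_self_tail v).symm⟩
    have h := digitSet_eq hAf hAg hf H (2 ^ i : ℕ) y x
    have hi : @LT.lt StdModel _ i (Mod.len (M := StdModel) (2 ^ i : ℕ)) :=
      (lt_iff _ _).2 ((Nat.lt_succ_self i).trans_eq (Nat.size_pow (n := i)).symm)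
    have h' := iff_of_eq (congrArg (fun U : Mod.DSet (M := StdModel) (2 ^ i : ℕ) => U.mem i) h)
    exact ⟨fun h => (bit_eq_one _ _).1 (h'.1 ⟨hi, h⟩).2, fun h => (h'.2 ⟨hi, (bit_eq_one _ _).2 h⟩).2⟩
  refine ⟨hAg, fun v => ?_, hbit⟩
  rw [Nat.size_le]
  refine Nat.lt_pow_two_of_testBit _ fun i hi => ?_
  by_contra hn
  have h := (hbit v i).2 (by simpa using hn)
  obtain ⟨x, y, rfl⟩ : ∃ (x : ℕ) (y : Fin k → ℕ), v = Fin.cons x y :=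
    ⟨v 0, Fin.tail v, (Fin.cons_self_tail v).symm⟩
  have h2 := (lt_iff _ _).1 ((H StdModel y).1 i x h)
  have h3 := polyVal_eq ([0] :: P) (Fin.cons x y)
  exact absurd (h2.trans_eq h3) (not_lt.2 hi)

end

end Std

end BoundedArith

theorem theorem2p1 (k : ℕ) (f : (Fin (k + 1) → ℕ) → ℕ)
    (Af : BoundedArith.LAID.Formula (Fin (k + 2))) (P : BoundedArith.LenPoly (k + 1))
    (hf : BoundedArith.BitDefines Af P f) :
    ∃ (Ag : BoundedArith.LAID.Formula (Fin (k + 2))) (Q : BoundedArith.LenPoly (k + 1)),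
      BoundedArith.BitDefines Ag Q (BoundedArith.vectorSum f) ∧
      BoundedArith.AID ⊨ᵇ BoundedArith.sumZero Ag Q ∧
      BoundedArith.AID ⊨ᵇ BoundedArith.sumStep Af Ag P Q ∧
      BoundedArith.AID ⊨ᵇ BoundedArith.sumZeroNum Ag Q ∧
      BoundedArith.AID ⊨ᵇ BoundedArith.sumStepNum Af Ag P Q := by
  obtain ⟨Ag, hAg, H⟩ := BoundedArith.exists_sum hf.sigma0 P
  refine ⟨Ag, [0] :: P, BoundedArith.Std.bitDefines hf.sigma0 hAg hf H, fun M v xs => ?_,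
    fun M v xs => ?_, fun M v xs => ?_, fun M v xs => ?_⟩ <;> rw [Subsingleton.elim xs default]
  · exact BoundedArith.realize_sumZero hf.sigma0 hAg H v
  · exact BoundedArith.realize_sumStep hf.sigma0 hAg H v
  · exact BoundedArith.realize_sumZeroNum hf.sigma0 hAg H v
  · exact BoundedArith.realize_sumStepNum hf.sigma0 hAg H v
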